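/- Let $g\ge 2$ and let $F_g=\mathbb{H}^2/\Gamma_g$, where $\Gamma_g$ is the group of isometries generated by the hyperbolic translations $\delta_1,\dots,\delta_{2g}$ given by the matrices $M_g^{-j}Q_gM_g^{j}$, with $$M_g=\begin{pmatrix}\cos\frac{(2g-1)\pi}{4g}&\sin\frac{(2g-1)\pi}{4g}\\-\sin\frac{(2g-1)\pi}{4g}&\cos\frac{(2g-1)\pi}{4g}\end{pmatrix},\quad Q_g=\begin{pmatrix}\lambda&0\\0&\lambda^{-1}\end{pmatrix},\quad \lambda=\frac{\cos\frac{\pi}{4g}+\sqrt{\cos\frac{\pi}{2g}}}{\sin\frac{\pi}{4g}}.$$ Let $p:\mathbb{H}^2\to F_g$ be the projection and $y_0=p(i)$; then $\pi_1(F_g,y_0)=\langle c_1,\dots,c_{2g}\mid c_1\cdots c_{2g}=c_{2g}\cdots c_1\rangle$, with $c_j$ corresponding to $\delta_j$. Let $D$ be the following set of binomials (leading word first), a Gröbner basis of this presentation for the length-lexicographical order with $c_{2g}^{-1}\succ\cdots\succ c_1^{-1}\succ c_1\succ\cdots\succ c_{2g}$: for $2\le j\le 2g$ and $s\ge1$,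 $c_j(c_{j-1}\cdots c_1c_{2g}^{-1}\cdots c_{j+1}^{-1})^sc_j^{-1}-(c_{j+1}^{-1}\cdots c_{2g}^{-1}c_1\cdots c_{j-1})^s$ and $c_j(c_{j+1}\cdots c_{2g}c_1^{-1}\cdots c_{j-1}^{-1})^sc_j^{-1}-(c_{j-1}^{-1}\cdots c_1^{-1}c_{2g}\cdots c_{j+1})^s$; $c_{2g}^{-1}\cdots c_1^{-1}-c_1^{-1}\cdots c_{2g}^{-1}$; $c_1\cdots c_{2g}-c_{2g}\cdots c_1$; for $2\le i\le 2g$, $c_i^{-1}\cdots c_{2g}^{-1}c_1\cdots c_{i-1}-c_{i-1}\cdots c_1c_{2g}^{-1}\cdots c_i^{-1}$ and $c_{i-1}^{-1}\cdots c_1^{-1}c_{2g}\cdots c_i-c_i\cdots c_{2g}c_1^{-1}\cdots c_{i-1}^{-1}$; and $c_i^{-1}c_i-1$, $c_ic_i^{-1}-1$ for $1\le i\le 2g$. A word in the letters $c_j^{\pm1}$ is $D$-reduced if it contains no leading word of an element of $D$ as a subword, and cyclically $D$-reduced if all its rotations are $D$-reduced. Let $u_1\cdots u_m$ be a cyclically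 $D$-reduced word and let $\varphi:S^1\to F_g$ be the piecewise-geodesic loop it determines: for $k=1,\dots,m$ the path $[0,1]\ni\lambda\mapsto\varphi(e^{2\pi(k-1+\lambda)\mathrm{i}/m})$ is the projection of the constant-speed geodesic from $i$ to $u_k(i)$ (for $m=0$, $\varphi$ is the constant loop at $y_0$). A self-common value class of $\varphi$ is a non-empty subset of $S^1\times S^1$ of the form $\{(e^{2\pi \mathrm{i}s},e^{2\pi \mathrm{i}t})\mid \tilde\varphi(s)=\tilde\varphi'(t)\}$, where $\tilde\varphi,\tilde\varphi':\mathbb{R}\to\mathbb{H}^2$ are liftings of $\varphi$. It is symmetric if it contains both $(x',x'')$ and $(x'',x')$ for some $x',x''\in S^1$. The index of a subset $C$ isolated in $\{(x,y)\mid\varphi(x)=\varphi(y)\}$ is the homomorphism $$H_2(S^1\times S^1)\to H_2(S^1\times S^1,S^1\times S^1-C)\cong H_2(N,N-C)\xrightarrow{(\varphi\times\varphi)_*}H_2(F_g\times F_g,F_g\times F_g-\Delta)$$ (equivalently, an integer, once generators of the two infinite cyclic end groups are chosen), where $N$ is an open neighborhood of $C$ with $N\cap\{(x,y)\mid\varphi(x)=\varphi(y)\}=C$,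 the isomorphism is excision, and $\Delta$ is the diagonal. A class is essential if its index is non-zero. Then every self-common value class of $\varphi$ is isolated, and every symmetric self-common value class of $\varphi$ has index zero. Consequently the essential self-common value classes come in pairs: if $C$ is an essential self-common value class, then $C^{*}=\{(y,x)\mid(x,y)\in C\}$ is an essential self-common value class different from $C$; and the number of essential self-common value classes of $\varphi$ is finite and even. -/

import Mathlib

open CategoryTheory CategoryTheory.Limits
open scoped UpperHalfPlane MatrixGroups

noncomputable section

namespace SurfaceLoops

/-! ### The surface of genus `g` as a quotient of the hyperbolic plane -/

/-- The rotation matrix `M_g`. -/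
def rotM (g : ℕ) : SL(2, ℝ) :=
  ⟨!![Real.cos ((2 * g - 1) * Real.pi / (4 * g)), Real.sin ((2 * g - 1) * Real.pi / (4 * g));
      -Real.sin ((2 * g - 1) * Real.pi / (4 * g)), Real.cos ((2 * g - 1) * Real.pi / (4 * g))], by
    rw [Matrix.det_fin_two_of]
    nlinarith [Real.sin_sq_add_cos_sq ((2 * g - 1) * Real.pi / (4 * g))]⟩

/-- The number `(cos (π / 4g) + √(cos (π / 2g))) / sin (π / 4g)`. -/
def stretch (g : ℕ) : ℝ :=
  (Real.cos (Real.pi / (4 * g)) + Real.sqrt (Real.cos (Real.pi / (2 * g)))) /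
    Real.sin (Real.pi / (4 * g))

theorem stretch_ne_zero {g : ℕ} (hg : 2 ≤ g) : stretch g ≠ 0 := by
  have h2 : (2 : ℝ) ≤ g := by exact_mod_cast hg
  have hpi := Real.pi_pos
  have h0 : 0 < Real.pi / (4 * g) := by positivity
  have h1 : Real.pi / (4 * g) < Real.pi / 2 := by
    apply div_lt_div_of_pos_left hpi (by norm_num) (by linarith)
  have hs : 0 < Real.sin (Real.pi / (4 * g)) :=
    Real.sin_pos_of_pos_of_lt_pi h0 (by linarith)
  have hc : 0 < Real.cos (Real.pi / (4 * g)) :=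
    Real.cos_pos_of_mem_Ioo ⟨by linarith, h1⟩
  unfold stretch
  positivity

/-- The diagonal matrix `Q_g`, for `g ≥ 2` (the value for `g < 2` is irrelevant). -/
def transQ (g : ℕ) : SL(2, ℝ) :=
  if hg : 2 ≤ g then
    ⟨!![stretch g, 0; 0, (stretch g)⁻¹], by
      rw [Matrix.det_fin_two_of, mul_inv_cancel₀ (stretch_ne_zero hg)]; ring⟩
  else 1

/-- The matrix `M_g⁻ʲ Q_g Mʲ_g` of the hyperbolic translation `δ_j`. -/
def delta (g j : ℕ) : SL(2, ℝ) := (rotM g)⁻¹ ^ j * transQ g * rotM g ^ j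

/-- The group `Γ_g`, generated by `δ_1, …, δ_{2g}`; it acts on `ℍ` by Möbius transformations. -/
def Gam (g : ℕ) : Subgroup SL(2, ℝ) :=
  Subgroup.closure {x | ∃ j : ℕ, 1 ≤ j ∧ j ≤ 2 * g ∧ x = delta g j}

/-- The closed surface `F_g = ℍ / Γ_g`, with the quotient topology. -/
abbrev Surface (g : ℕ) : Type := MulAction.orbitRel.Quotient (Gam g) ℍ

/-- The universal covering map `ℍ → F_g`. -/
def proj (g : ℕ) (z : ℍ) : Surface g := Quotient.mk _ z

/-- The universal covering map `ℝ → S¹`, `t ↦ exp (2 π i t)`. -/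
def circleCover (t : ℝ) : Circle := Circle.exp (2 * Real.pi * t)

/-! ### Words and `D`-reduced words -/

/-- A letter: `(j, true)` stands for `c_j`, `(j, false)` stands for `c_j⁻¹`. -/
abbrev Letter : Type := ℕ × Bool

/-- `w` is a word in the letters `c_1, …, c_{2g}` and their inverses. -/
def IsWord (g : ℕ) (w : List Letter) : Prop := ∀ a ∈ w, 1 ≤ a.1 ∧ a.1 ≤ 2 * g

/-- The word `c_a c_{a+1} ⋯ c_b` (if `ε = true`) or `c_a⁻¹ c_{a+1}⁻¹ ⋯ c_b⁻¹` (if `ε = false`);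
it is empty for `b < a`. -/
def asc (ε : Bool) (a b : ℕ) : List Letter := (List.range' a (b + 1 - a)).map fun j => (j, ε)

/-- The word `c_b c_{b-1} ⋯ c_a` (if `ε = true`) or `c_b⁻¹ c_{b-1}⁻¹ ⋯ c_a⁻¹` (if `ε = false`);
it is empty for `b < a`. -/
def desc (ε : Bool) (b a : ℕ) : List Letter := (asc ε a b).reverse

/-- The power `w ^ s` of a word. -/
def wpow (w : List Letter) (s : ℕ) : List Letter := (List.replicate s w).flatten

/-- The Gröbner basis `D` of the surface group
`⟨c_1, …, c_{2g} ∣ c_1 c_2 ⋯ c_{2g} = c_{2g} ⋯ c_2 c_1⟩` for the length-lexicographical order with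
`c_{2g}⁻¹ ≻ ⋯ ≻ c_1⁻¹ ≻ c_1 ≻ ⋯ ≻ c_{2g}`:  `GroebnerD g l r` says that the binomial `l - r` is an
element of `D`, and `l` is its leading word. -/
inductive GroebnerD (g : ℕ) : List Letter → List Letter → Prop
  | d1 (j s : ℕ) (hj : 2 ≤ j) (hj' : j ≤ 2 * g) (hs : 1 ≤ s) : GroebnerD g
      ([(j, true)] ++ wpow (desc true (j - 1) 1 ++ desc false (2 * g) (j + 1)) s ++ [(j, false)])
      (wpow (asc false (j + 1) (2 * g) ++ asc true 1 (j - 1)) s)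
  | d2 (j s : ℕ) (hj : 2 ≤ j) (hj' : j ≤ 2 * g) (hs : 1 ≤ s) : GroebnerD g
      ([(j, true)] ++ wpow (asc true (j + 1) (2 * g) ++ asc false 1 (j - 1)) s ++ [(j, false)])
      (wpow (desc false (j - 1) 1 ++ desc true (2 * g) (j + 1)) s)
  | d3 : GroebnerD g (desc false (2 * g) 1) (asc false 1 (2 * g))
  | d4 : GroebnerD g (asc true 1 (2 * g)) (desc true (2 * g) 1)
  | d5 (i : ℕ) (hi : 2 ≤ i) (hi' : i ≤ 2 * g) : GroebnerD g
      (asc false i (2 * g) ++ asc true 1 (i - 1))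
      (desc true (i - 1) 1 ++ desc false (2 * g) i)
  | d6 (i : ℕ) (hi : 2 ≤ i) (hi' : i ≤ 2 * g) : GroebnerD g
      (desc false (i - 1) 1 ++ desc true (2 * g) i)
      (asc true i (2 * g) ++ asc false 1 (i - 1))
  | d7 (i : ℕ) (hi : 1 ≤ i) (hi' : i ≤ 2 * g) : GroebnerD g [(i, false), (i, true)] []
  | d8 (i : ℕ) (hi : 1 ≤ i) (hi' : i ≤ 2 * g) : GroebnerD g [(i, true), (i, false)] []

/-- A word is `D`-reduced if it has no leading word of an element of `D` as a subword. -/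
def IsDReduced (g : ℕ) (w : List Letter) : Prop := ∀ l r, GroebnerD g l r → ¬ l <:+: w

/-- A word is cyclically `D`-reduced if all its rotations are `D`-reduced. -/
def IsCyclicallyDReduced (g : ℕ) (w : List Letter) : Prop := ∀ n : ℕ, IsDReduced g (w.rotate n)

/-! ### Piecewise-geodesic loops -/

/-- The deck transformation of a letter: `δ_j` for `c_j` and `δ_j⁻¹` for `c_j⁻¹`. -/
def letterElt (g : ℕ) (a : Letter) : SL(2, ℝ) := if a.2 then delta g a.1 else (delta g a.1)⁻¹

/-- `c` restricted to `[0, 1]` is the geodesic from `x` to `y`, with constant speed. -/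
def IsGeodesicArc (c : ℝ → ℍ) (x y : ℍ) : Prop :=
  c 0 = x ∧ c 1 = y ∧
    ∀ s ∈ Set.Icc (0 : ℝ) 1, ∀ t ∈ Set.Icc (0 : ℝ) 1, dist (c s) (c t) = |s - t| * dist x y

/-- `φ` is the piecewise-geodesic loop determined by the word `w = u_1 ⋯ u_m`: on the `k`-th of the
`m` arcs of equal length of the circle it is the projection of the geodesic from `i` to `u_k(i)`,
with constant speed. The empty word determines the constant loop at the base point. -/
def IsPiecewiseGeodesicLoop (g : ℕ) (w : List Letter) (φ : C(Circle, Surface g)) : Prop :=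
  (w = [] → ∀ x, φ x = proj g UpperHalfPlane.I) ∧
  ∀ (k : ℕ) (hk : k < w.length), ∃ c : ℝ → ℍ,
    IsGeodesicArc c UpperHalfPlane.I (letterElt g w[k] • UpperHalfPlane.I) ∧
    ∀ t ∈ Set.Icc (0 : ℝ) 1, φ (circleCover ((k + t) / w.length)) = proj g (c t)

/-! ### Common value pairs and common value classes -/

/-- The set of common value pairs of two maps. -/
def cvp {X Y : Type} (φ ψ : X → Y) : Set (X × X) := {x | φ x.1 = ψ x.2}

/-- `Φ` is a lifting of the loop `φ` to the universal coverings. -/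
def IsLifting {g : ℕ} (φ : C(Circle, Surface g)) (Φ : ℝ → ℍ) : Prop :=
  Continuous Φ ∧ ∀ t, proj g (Φ t) = φ (circleCover t)

/-- `C` is a common value class of `φ` and `ψ`: a non-empty set which is the image of the set of
common value pairs of a lifting of `φ` and a lifting of `ψ`. -/
def IsCommonValueClass {g : ℕ} (φ ψ : C(Circle, Surface g)) (C : Set (Circle × Circle)) : Prop :=
  C.Nonempty ∧ ∃ Φ Ψ : ℝ → ℍ, IsLifting φ Φ ∧ IsLifting ψ Ψ ∧
    C = Prod.map circleCover circleCover '' cvp Φ Ψ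

/-- A self-common value class is symmetric if it contains both `(x', x'')` and `(x'', x')`
for some `x'`, `x''`. -/
def IsSymmetricClass (C : Set (Circle × Circle)) : Prop :=
  ∃ x' x'' : Circle, (x', x'') ∈ C ∧ (x'', x') ∈ C

/-! ### Relative singular homology with integer coefficients -/

/-- The integral singular chain complex functor. -/
abbrev singC : TopCat.{0} ⥤ ChainComplex (ModuleCat.{0} ℤ) ℕ :=
  (AlgebraicTopology.singularChainComplexFunctor (ModuleCat.{0} ℤ)).obj (ModuleCat.of ℤ ℤ)

/-- The inclusion of a subspace. -/
def incl {X : Type} [TopologicalSpace X] (A : Set X) : TopCat.of A ⟶ TopCat.of X :=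
  TopCat.ofHom ⟨Subtype.val, continuous_subtype_val⟩

/-- The relative singular chain complex of the pair `(X, A)`. -/
def relComplex (X : Type) [TopologicalSpace X] (A : Set X) : ChainComplex (ModuleCat.{0} ℤ) ℕ :=
  cokernel (singC.map (incl A))

/-- The chain map induced by a map of pairs `(X, A) → (Y, B)`. -/
def relComplexMap {X Y : Type} [TopologicalSpace X] [TopologicalSpace Y] (f : C(X, Y))
    {A : Set X} {B : Set Y} (h : Set.MapsTo f A B) : relComplex X A ⟶ relComplex Y B :=
  cokernel.map _ _
    (singC.map (TopCat.ofHom ⟨h.restrict, f.continuous.continuousOn.mapsToRestrict h⟩))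
    (singC.map (TopCat.ofHom f))
    (by rw [← Functor.map_comp, ← Functor.map_comp]; rfl)

/-- The singular homology `H_n(X)`. -/
abbrev H (n : ℕ) (X : Type) [TopologicalSpace X] : ModuleCat.{0} ℤ :=
  (singC.obj (TopCat.of X)).homology n

/-- The relative singular homology `H_n(X, A)`. -/
abbrev relH (n : ℕ) (X : Type) [TopologicalSpace X] (A : Set X) : ModuleCat.{0} ℤ :=
  (relComplex X A).homology n

/-- The canonical homomorphism `H_n(X) → H_n(X, A)`. -/
def toRelH (n : ℕ) (X : Type) [TopologicalSpace X] (A : Set X) : H n X ⟶ relH n X A :=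
  HomologicalComplex.homologyMap
    (cokernel.π (singC.map (incl A)) : singC.obj (TopCat.of X) ⟶ relComplex X A) n

/-- The homomorphism `H_n(X, A) → H_n(Y, B)` induced by a map of pairs. -/
def relHMap (n : ℕ) {X Y : Type} [TopologicalSpace X] [TopologicalSpace Y] (f : C(X, Y))
    {A : Set X} {B : Set Y} (h : Set.MapsTo f A B) : relH n X A ⟶ relH n Y B :=
  HomologicalComplex.homologyMap (relComplexMap f h) n

/-! ### The index of an isolated common value subset -/

section Index

variable {Y : Type} [TopologicalSpace Y] (φ ψ : C(Circle, Y))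

/-- `N` is an open neighborhood of `C` in the torus with `N ∩ cvp φ ψ = C`. -/
def IsIsolating (C N : Set (Circle × Circle)) : Prop := IsOpen N ∧ N ∩ cvp φ ψ = C

/-- `C` is an isolated common value subset. -/
def IsIsolated (C : Set (Circle × Circle)) : Prop := ∃ N, IsIsolating φ ψ C N

/-- The map `φ × ψ : N → Y × Y`. -/
def prodMapOn (N : Set (Circle × Circle)) : C(N, Y × Y) :=
  (φ.prodMap ψ).comp ⟨Subtype.val, continuous_subtype_val⟩

theorem mapsTo_val (C N : Set (Circle × Circle)) :
    Set.MapsTo (⟨Subtype.val, continuous_subtype_val⟩ : C(N, Circle × Circle))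
      {x : N | (x : Circle × Circle) ∉ C} Cᶜ :=
  fun _ hx => hx

variable {φ ψ}

theorem mapsTo_prodMapOn {C N : Set (Circle × Circle)} (h : IsIsolating φ ψ C N) :
    Set.MapsTo (prodMapOn φ ψ N) {x : N | (x : Circle × Circle) ∉ C} (Set.diagonal Y)ᶜ :=
  fun x hx hd => hx (h.2 ▸ ⟨x.2, hd⟩)

variable (φ ψ)

/-- The graph of the homomorphism index of `φ × ψ` at the isolated common value subset `C`,
i.e. of the composition
`H_n(S¹ × S¹) → H_n(S¹ × S¹, S¹ × S¹ - C) ≅ H_n(N, N - C) → H_n(Y × Y, Y × Y - Δ)`,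
where the middle isomorphism is the inverse of the excision isomorphism given by the inclusion
`(N, N - C) → (S¹ × S¹, S¹ × S¹ - C)`, and the last homomorphism is induced by `φ × ψ`:
the index maps `z` to `v`. -/
def IndexMapsTo (n : ℕ) (C : Set (Circle × Circle)) (z : H n (Circle × Circle))
    (v : relH n (Y × Y) (Set.diagonal Y)ᶜ) : Prop :=
  ∃ (N : Set (Circle × Circle)) (hN : IsIsolating φ ψ C N)
    (y : relH n N {x : N | (x : Circle × Circle) ∉ C}),
    (relHMap n _ (mapsTo_val C N)).hom y = (toRelH n (Circle × Circle) Cᶜ).hom z ∧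
    (relHMap n _ (mapsTo_prodMapOn hN)).hom y = v

/-- The index of `C` is zero, i.e. the homomorphism index in dimension `2` is zero. -/
def HasIndexZero (C : Set (Circle × Circle)) : Prop :=
  ∀ (z : H 2 (Circle × Circle)) (v : relH 2 (Y × Y) (Set.diagonal Y)ᶜ),
    IndexMapsTo φ ψ 2 C z v → v = 0

end Index

/-- An essential common value class: one with non-zero index. -/
def IsEssentialClass {g : ℕ} (φ ψ : C(Circle, Surface g)) (C : Set (Circle × Circle)) : Prop :=
  IsCommonValueClass φ ψ C ∧ ¬ HasIndexZero φ ψ C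

end SurfaceLoops

end

open SurfaceLoops

/-!
The hyperbolic plane is treated in the hyperboloid model `lor`, in which the polygon around `i`
bounded by the perpendicular bisectors between `i` and its images under the `4g` letters is given
by the linear inequalities `0 < side g a v`. Its angles are `π / 2g`, and the letters pair its
sides.

*Normal forms.* If a word is read as a path through translates of the polygon, then the position
of the starting point relative to the last polygon is confined to one of the sectors `Sec` at
either end of the side crossed last. The index `secIdx` of the sector depends on the word only,
and for a `D`-reduced word it is at most `2g`, so that the starting point stays beyond the side
crossed last (`IsTight.sec`, `IsTight.side_neg`). Hence a non-empty `D`-reduced word does not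
represent the identity, and `D`-reduced words representing the same element are equal
(`IsDReduced.eq_of_wordElt_eq`). As every word can be shortened to a tight one by means of the
relator (`exists_tight`), the translates of the polygon do not overlap (`exists_side_neg`), and
the group is torsion-free, discrete and acts freely, with a uniform lower bound for the
displacement on compact sets (`exists_displacement`).

*Classes.* A lifting `Φ` of the loop satisfies `Φ (t + 1) = h • Φ t` for an element `h` of the
group, and every class has the form `classOf Φ η = {(s, t) | Φ s = η • Φ t}`, up to the projection
of the line to the circle (`IsLiftingWith.exists_classOf`). Discreteness makes the classes
isolated and finite in number (`IsLiftingWith.isIsolated`, `IsLiftingWith.finite_classes`).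

*Symmetric classes.* A symmetric class is given by an element `ζ` with `ζ² = h ^ k`
(`IsLiftingWith.exists_of_isSymmetricClass`). The lifting is the edge path `path` of the
bi-infinite word `⋯ w w w ⋯`, and since two translates of edges meet only in a common end or along
the whole edge (`eq_of_smul_edge_eq`), `ζ` moves some vertex of the path to a vertex of the path
(`path_eq_smul_path`). Seen from these two vertices, `h` is represented by two rotations of `w`,
and since `ζ` commutes with `h ^ k`, powers of these two rotations represent the same element.
They are `D`-reduced, so they are equal. Therefore the rotations are equal and `ζ` shifts the path
along itself (`exists_shift`); for `k = 0`, `ζ = 1` as there is no torsion. The path being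
injective (`path_injective`), the class is a shifted diagonal of the torus.

*Removing a shifted diagonal.* The path never turns back, so it can be pushed off itself to its
left, equivariantly and without new intersections nearby (`pathNormal`, `lor_path_add_ne_smul`).
Pushing one of the two copies of the loop by an amount that vanishes away from the shifted
diagonal is a homotopy that removes the common values in the class and creates no others
(`hasIndexZero_of_shift`). By homotopy invariance of relative homology, the index is zero
(`hasIndexZero_of_homotopy`). The constant loop is treated in the same way
(`hasIndexZero_of_const`).

Interchanging the coordinates preserves the vanishing of the index (`HasIndexZero.swap`), and it
fixes no essential class, since a class equal to its image would be symmetric. It is thus an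
involution without fixed points on the finite set of essential classes, which gives the pairs and
the parity.
-/

noncomputable section

namespace SurfaceLoops

/-- The point of the hyperboloid `T² - X² - Y² = 1` that corresponds to a point of `ℍ`. -/
def lor (z : ℍ) : ℝ × ℝ × ℝ :=
  ((1 + z.re ^ 2 + z.im ^ 2) / (2 * z.im), (z.re ^ 2 + z.im ^ 2 - 1) / (2 * z.im), z.re / z.im)

/-- The Lorentzian product of signature `(1, 2)`. -/
def lprod (v w : ℝ × ℝ × ℝ) : ℝ := v.1 * w.1 - v.2.1 * w.2.1 - v.2.2 * w.2.2

theorem lprod_lor_self (z : ℍ) : lprod (lor z) (lor z) = 1 := by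
  have := z.im_ne_zero
  simp only [lprod, lor]
  field_simp
  ring

theorem lor_fst_pos (z : ℍ) : 0 < (lor z).1 := by
  have := z.im_pos
  simp only [lor]
  positivity

/-- The hyperboloid model carries the hyperbolic metric. -/
theorem cosh_dist_eq_lprod (z w : ℍ) : Real.cosh (dist z w) = lprod (lor z) (lor w) := by
  have := z.im_ne_zero
  have := w.im_ne_zero
  rw [UpperHalfPlane.cosh_dist, Complex.dist_eq_re_im, Real.sq_sqrt (by positivity)]
  simp only [lprod, lor, UpperHalfPlane.coe_re, UpperHalfPlane.coe_im]
  field_simp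
  ring

theorem lor_injective : Function.Injective lor := by
  intro z w h
  have h1 := cosh_dist_eq_lprod z w
  rw [h, lprod_lor_self] at h1
  by_contra hne
  have := Real.one_lt_cosh.2 (dist_ne_zero.2 hne)
  linarith

theorem lor_I : lor UpperHalfPlane.I = (1, 0, 0) := by
  simp [lor]

theorem continuous_lor : Continuous lor := by
  have h : ∀ z : ℍ, z.im ≠ 0 := fun z => z.im_ne_zero
  have h2 : ∀ z : ℍ, 2 * z.im ≠ 0 := fun z => mul_ne_zero two_ne_zero z.im_ne_zero
  have h3 := UpperHalfPlane.continuous_re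
  have h4 := UpperHalfPlane.continuous_im
  unfold lor
  fun_prop (disch := assumption)

/-- The linear action of `SL(2, ℝ)` on Lorentzian space. -/
def lact (A : SL(2, ℝ)) (v : ℝ × ℝ × ℝ) : ℝ × ℝ × ℝ :=
  let s := A 0 0 ^ 2 * (v.1 + v.2.1) + 2 * A 0 0 * A 0 1 * v.2.2 + A 0 1 ^ 2 * (v.1 - v.2.1)
  let p := A 1 0 ^ 2 * (v.1 + v.2.1) + 2 * A 1 0 * A 1 1 * v.2.2 + A 1 1 ^ 2 * (v.1 - v.2.1)
  ((s + p) / 2, (s - p) / 2, A 0 0 * A 1 0 * (v.1 + v.2.1) +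
    (A 0 0 * A 1 1 + A 0 1 * A 1 0) * v.2.2 + A 0 1 * A 1 1 * (v.1 - v.2.1))

theorem lact_mul (A B : SL(2, ℝ)) (v : ℝ × ℝ × ℝ) : lact (A * B) v = lact A (lact B v) := by
  simp only [lact, Matrix.SpecialLinearGroup.coe_mul, Matrix.mul_apply, Fin.sum_univ_two]
  refine Prod.ext ?_ (Prod.ext ?_ ?_) <;> dsimp only <;> ring

theorem lact_one (v : ℝ × ℝ × ℝ) : lact 1 v = v := by
  simp [lact]

theorem lact_add (A : SL(2, ℝ)) (v w : ℝ × ℝ × ℝ) : lact A (v + w) = lact A v + lact A w := by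
  simp only [lact, Prod.fst_add, Prod.snd_add]
  refine Prod.ext ?_ (Prod.ext ?_ ?_) <;> simp only [Prod.fst_add, Prod.snd_add] <;> ring

theorem lact_smul (A : SL(2, ℝ)) (r : ℝ) (v : ℝ × ℝ × ℝ) : lact A (r • v) = r • lact A v := by
  simp only [lact, Prod.smul_fst, Prod.smul_snd, smul_eq_mul]
  refine Prod.ext ?_ (Prod.ext ?_ ?_) <;>
    simp only [Prod.smul_fst, Prod.smul_snd, smul_eq_mul] <;> ring

theorem det_eq (A : SL(2, ℝ)) : A 0 0 * A 1 1 - A 0 1 * A 1 0 = 1 := by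
  have := A.2
  rwa [Matrix.det_fin_two] at this

theorem lprod_lact (A : SL(2, ℝ)) (v w : ℝ × ℝ × ℝ) : lprod (lact A v) (lact A w) = lprod v w := by
  have h := det_eq A
  have : lprod (lact A v) (lact A w) = (A 0 0 * A 1 1 - A 0 1 * A 1 0) ^ 2 * lprod v w := by
    simp only [lprod, lact]
    ring
  rw [this, h]
  ring

/-- The hyperboloid model is equivariant: `lact` is the action of `SL(2, ℝ)` by Lorentz
transformations. -/
theorem lor_smul (A : SL(2, ℝ)) (z : ℍ) : lor (A • z) = lact A (lor z) := by
  have h := det_eq A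
  have hy := z.im_ne_zero
  have hd : (A 1 0 * z.re + A 1 1) ^ 2 + (A 1 0 * z.im) ^ 2 ≠ 0 := by
    intro h0
    have h1 : A 1 0 * z.im = 0 := by
      nlinarith [sq_nonneg (A 1 0 * z.re + A 1 1), sq_nonneg (A 1 0 * z.im)]
    have h2 : A 1 0 * z.re + A 1 1 = 0 := by
      nlinarith [sq_nonneg (A 1 0 * z.re + A 1 1), sq_nonneg (A 1 0 * z.im)]
    have h3 : A 1 0 = 0 := by simpa [hy] using h1
    rw [h3] at h2 h
    have h4 : A 1 1 = 0 := by linarith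
    rw [h4] at h
    linarith
  have hre : (A • z).re = ((A 0 0 * z.re + A 0 1) * (A 1 0 * z.re + A 1 1) +
      A 0 0 * A 1 0 * z.im ^ 2) / ((A 1 0 * z.re + A 1 1) ^ 2 + (A 1 0 * z.im) ^ 2) := by
    rw [← UpperHalfPlane.coe_re, UpperHalfPlane.coe_specialLinearGroup_apply, Complex.div_re]
    simp only [Complex.normSq_apply, Complex.add_re, Complex.add_im, Complex.mul_re, Complex.mul_im,
      Complex.ofReal_re, Complex.ofReal_im, UpperHalfPlane.coe_re, UpperHalfPlane.coe_im,
      Algebra.algebraMap_self, RingHom.id_apply]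
    rw [← add_div]
    congr 1 <;> ring
  have him : (A • z).im = z.im / ((A 1 0 * z.re + A 1 1) ^ 2 + (A 1 0 * z.im) ^ 2) := by
    rw [← UpperHalfPlane.coe_im, UpperHalfPlane.coe_specialLinearGroup_apply, Complex.div_im]
    simp only [Complex.normSq_apply, Complex.add_re, Complex.add_im, Complex.mul_re, Complex.mul_im,
      Complex.ofReal_re, Complex.ofReal_im, UpperHalfPlane.coe_re, UpperHalfPlane.coe_im,
      Algebra.algebraMap_self, RingHom.id_apply]
    rw [← sub_div]
    congr 1
    · linear_combination z.im * h
    · ring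
  have hn : (A • z).re ^ 2 + (A • z).im ^ 2 = ((A 0 0 * z.re + A 0 1) ^ 2 + (A 0 0 * z.im) ^ 2) /
      ((A 1 0 * z.re + A 1 1) ^ 2 + (A 1 0 * z.im) ^ 2) := by
    rw [hre, him, div_pow, div_pow, ← add_div, div_eq_div_iff (pow_ne_zero 2 hd) hd]
    linear_combination (-(z.im ^ 2) * ((A 1 0 * z.re + A 1 1) ^ 2 + (A 1 0 * z.im) ^ 2) *
      (A 0 0 * A 1 1 - A 0 1 * A 1 0 + 1)) * h
  generalize hD : (A 1 0 * z.re + A 1 1) ^ 2 + (A 1 0 * z.im) ^ 2 = d at *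
  have e1 : (lor (A • z)).1 = (1 + ((A • z).re ^ 2 + (A • z).im ^ 2)) / (2 * (A • z).im) := by
    simp only [lor]; ring
  have e3 : (lor (A • z)).2.2 = (A • z).re / (A • z).im := rfl
  refine Prod.ext ?_ (Prod.ext ?_ ?_)
  · rw [e1, hn, him]
    simp only [lact, lor]
    field_simp
    rw [← hD]
    ring
  · rw [show (lor (A • z)).2.1 = (((A • z).re ^ 2 + (A • z).im ^ 2) - 1) / (2 * (A • z).im) from
      rfl,
      hn, him]
    simp only [lact, lor]
    field_simp
    rw [← hD]
    ring
  · rw [e3, hre, him]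
    simp only [lact, lor]
    field_simp
    ring

/-! ### Letters as directions -/

/-- The inverse letter. -/
def opp (a : Letter) : Letter := (a.1, !a.2)

/-- The successor of a letter in the cyclic word `c_1 ⋯ c_{2g} c_1⁻¹ ⋯ c_{2g}⁻¹` (if `ε = true`) or
in the cyclic word `c_{2g} ⋯ c_1 c_{2g}⁻¹ ⋯ c_1⁻¹` (if `ε = false`), i.e. in the relator or its
inverse. -/
def nxt (g : ℕ) (ε : Bool) (a : Letter) : Letter :=
  if ε then (if a.1 < 2 * g then (a.1 + 1, a.2) else (1, !a.2))
  else (if 1 < a.1 then (a.1 - 1, a.2) else (2 * g, !a.2))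

/-- A letter `c_j` or `c_j⁻¹` with `1 ≤ j ≤ 2g`. -/
def IsLetter (g : ℕ) (a : Letter) : Prop := 1 ≤ a.1 ∧ a.1 ≤ 2 * g

theorem IsLetter.opp {g : ℕ} {a : Letter} (h : IsLetter g a) : IsLetter g (opp a) := h

theorem IsLetter.nxt {g : ℕ} {a : Letter} (h : IsLetter g a) (ε : Bool) :
    IsLetter g (nxt g ε a) := by
  obtain ⟨h1, h2⟩ := h
  unfold SurfaceLoops.nxt IsLetter
  split_ifs <;> constructor <;> dsimp only <;> omega

@[simp] theorem opp_opp (a : Letter) : opp (opp a) = a := by simp [opp]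

theorem opp_injective : Function.Injective opp := fun a b h => by
  rw [← opp_opp a, h, opp_opp]

theorem nxt_nxt_not {g : ℕ} {a : Letter} (h : IsLetter g a) (ε : Bool) :
    nxt g (!ε) (nxt g ε a) = a := by
  obtain ⟨j, e⟩ := a
  obtain ⟨h1, h2⟩ := h
  dsimp only at h1 h2
  cases ε <;> simp only [nxt, Bool.not_true, Bool.not_false, if_true, if_false, Bool.false_eq_true]
    <;>
    split_ifs <;> simp_all <;> omega

theorem nxt_opp {g : ℕ} (a : Letter) (ε : Bool) : nxt g ε (opp a) = opp (nxt g ε a) := by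
  unfold nxt opp
  split_ifs <;> rfl

/-- The direction of the axis of a letter at `i`, as a multiple of the angle `π / 2g`. -/
def dir (g : ℕ) (a : Letter) : ℤ := a.1 * (2 * g - 1) + if a.2 then 0 else 2 * g

/-- The sign of a boolean. -/
def sgn (ε : Bool) : ℤ := if ε then 1 else -1

theorem dir_opp (g : ℕ) (a : Letter) : ∃ k : ℤ, dir g (opp a) = dir g a + 2 * g + 4 * g * k := by
  obtain ⟨j, _ | _⟩ := a
  · exact ⟨-1, by simp [dir, opp]; ring⟩
  · exact ⟨0, by simp [dir, opp]⟩

theorem dir_nxt {g : ℕ} {a : Letter} (h : IsLetter g a) (ε : Bool) :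
    ∃ k : ℤ, dir g (nxt g ε a) = dir g a + 2 * g - sgn ε + 4 * g * k := by
  obtain ⟨j, e⟩ := a
  obtain ⟨h1, h2⟩ := h
  dsimp only at h1 h2
  cases ε
  · by_cases hj : 1 < j
    · refine ⟨-1, ?_⟩
      simp only [nxt, hj, if_true, dir, sgn, Bool.false_eq_true, if_false]
      push_cast [Nat.cast_sub h1]
      ring
    · obtain rfl : j = 1 := by omega
      cases e
      · exact ⟨g - 2, by simp [nxt, dir, sgn]; ring⟩
      · exact ⟨g - 1, by simp [nxt, dir, sgn]; ring⟩
  · by_cases hj : j < 2 * g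
    · refine ⟨0, ?_⟩
      simp only [nxt, hj, if_true, dir, sgn]
      push_cast
      ring
    · obtain rfl : j = 2 * g := by omega
      cases e
      · exact ⟨-g, by simp [nxt, dir, sgn]; ring⟩
      · exact ⟨1 - g, by simp [nxt, dir, sgn]; ring⟩

theorem dir_injective {g : ℕ} {a b : Letter} (ha : IsLetter g a) (hb : IsLetter g b)
    (h : ∃ k : ℤ, dir g a = dir g b + 4 * g * k) : a = b := by
  -- modulo `4g`, the direction of `c_j` is `-j` or `2g - j`, according to the parity of `j`
  have key : ∀ c : Letter, ∃ q f : ℤ, (f = 0 ∨ f = 1) ∧ (c.2 = true ↔ ((f + c.1) % 2 = 0)) ∧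
      dir g c = -c.1 + 2 * g * f + 4 * g * q := by
    rintro ⟨j, e⟩
    obtain ⟨i, rfl | rfl⟩ := Nat.even_or_odd' j <;> cases e
    · exact ⟨i, 1, by simp, by simp, by simp [dir]; ring⟩
    · exact ⟨i, 0, by simp, by simp, by simp [dir]; ring⟩
    · exact ⟨i + 1, 0, by simp, by simp, by simp [dir]; ring⟩
    · exact ⟨i, 1, by simp, by simp; omega, by simp [dir]; ring⟩
  obtain ⟨k, hk⟩ := h
  obtain ⟨q, f, hf, hfa, hqa⟩ := key a
  obtain ⟨q', f', hf', hfb, hqb⟩ := key b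
  obtain ⟨ha1, ha2⟩ := ha
  obtain ⟨hb1, hb2⟩ := hb
  have e1 : (b.1 : ℤ) - a.1 = 2 * g * (f' - f + 2 * (k + q' - q)) := by
    rw [hqa, hqb] at hk
    linear_combination hk
  have hz : f' - f + 2 * (k + q' - q) = 0 := by
    have h3 : ((b.1 : ℤ) - a.1) < 2 * g := by omega
    have h4 : -(2 * g : ℤ) < ((b.1 : ℤ) - a.1) := by omega
    rw [e1] at h3 h4
    have hg : (0 : ℤ) < 2 * g := by omega
    have h5 : f' - f + 2 * (k + q' - q) < 1 := by
      by_contra hc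
      nlinarith
    have h6 : -1 < f' - f + 2 * (k + q' - q) := by
      by_contra hc
      nlinarith
    omega
  have e2 : f = f' := by omega
  have e3 : a.1 = b.1 := by
    rw [hz, mul_zero] at e1
    omega
  have e4 : a.2 = b.2 := by
    rw [Bool.eq_iff_iff, hfa, hfb, e2, e3]
  exact Prod.ext e3 e4

/-! ### The sides of the polygon -/

/-- The angle `π / 2g`. -/
def stepAngle (g : ℕ) : ℝ := Real.pi / (2 * g)

/-- The hyperbolic cosine of the distance from `i` to the sides of the fundamental polygon. -/
def sideC (g : ℕ) : ℝ := Real.cos (Real.pi / (4 * g)) / Real.sin (Real.pi / (4 * g))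

/-- The hyperbolic sine of the distance from `i` to the sides of the fundamental polygon. -/
def sideS (g : ℕ) : ℝ := Real.sqrt (Real.cos (Real.pi / (2 * g))) / Real.sin (Real.pi / (4 * g))

/-- The coordinate of a vector in the direction of angle `α`. -/
def dco (α : ℝ) (v : ℝ × ℝ × ℝ) : ℝ := Real.cos α * v.2.1 + Real.sin α * v.2.2

/-- The coordinate of a vector in the direction obtained by a left turn from angle `α`. -/
def wco (α : ℝ) (v : ℝ × ℝ × ℝ) : ℝ := -Real.sin α * v.2.1 + Real.cos α * v.2.2

/-- The linear form that vanishes on the side in direction `α` and is positive at `i`. -/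
def sideAt (g : ℕ) (α : ℝ) (v : ℝ × ℝ × ℝ) : ℝ := sideS g * v.1 - sideC g * dco α v

/-- The angle of the direction of a letter. -/
def ang (g : ℕ) (a : Letter) : ℝ := dir g a * stepAngle g

/-- The linear form of the side of the polygon that is crossed by a letter. -/
def side (g : ℕ) (a : Letter) (v : ℝ × ℝ × ℝ) : ℝ := sideAt g (ang g a) v

section Trig

variable {g : ℕ} (hg : 2 ≤ g)
include hg

theorem mul_stepAngle : 2 * (g : ℝ) * stepAngle g = Real.pi := by
  have : (g : ℝ) ≠ 0 := by positivity
  unfold stepAngle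
  field_simp

theorem stepAngle_pos : 0 < stepAngle g := by
  have : (0 : ℝ) < g := by positivity
  have := Real.pi_pos
  unfold stepAngle
  positivity

theorem stepAngle_le : stepAngle g ≤ Real.pi / 4 := by
  have h2 : (2 : ℝ) ≤ g := by exact_mod_cast hg
  have := Real.pi_pos
  unfold stepAngle
  exact div_le_div_of_nonneg_left this.le (by norm_num) (by linarith)

omit hg in
theorem pi_div_eq : Real.pi / (4 * g) = stepAngle g / 2 := by
  unfold stepAngle
  rw [div_div]
  congr 1
  ring

theorem sin_half_pos : 0 < Real.sin (stepAngle g / 2) := by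
  have := stepAngle_pos hg
  have := stepAngle_le hg
  have := Real.pi_pos
  exact Real.sin_pos_of_pos_of_lt_pi (by linarith) (by linarith)

theorem cos_half_pos : 0 < Real.cos (stepAngle g / 2) := by
  have := stepAngle_pos hg
  have := stepAngle_le hg
  have := Real.pi_pos
  exact Real.cos_pos_of_mem_Ioo ⟨by linarith, by linarith⟩

theorem cos_step_pos : 0 < Real.cos (stepAngle g) := by
  have := stepAngle_pos hg
  have := stepAngle_le hg
  have := Real.pi_pos
  exact Real.cos_pos_of_mem_Ioo ⟨by linarith, by linarith⟩

theorem sin_step_pos : 0 < Real.sin (stepAngle g) := by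
  have := stepAngle_pos hg
  have := stepAngle_le hg
  have := Real.pi_pos
  exact Real.sin_pos_of_pos_of_lt_pi (by linarith) (by linarith)

theorem sideC_pos : 0 < sideC g := by
  unfold sideC
  rw [pi_div_eq]
  exact div_pos (cos_half_pos hg) (sin_half_pos hg)

theorem sideS_pos : 0 < sideS g := by
  unfold sideS
  rw [pi_div_eq]
  exact div_pos (Real.sqrt_pos.2 (cos_step_pos hg)) (sin_half_pos hg)

theorem sideS_sq : sideS g ^ 2 = Real.cos (stepAngle g) / Real.sin (stepAngle g / 2) ^ 2 := by
  unfold sideS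
  rw [pi_div_eq, div_pow]
  exact congrArg (· / _) (Real.sq_sqrt (cos_step_pos hg).le)

theorem sideC_sq_sub : sideC g ^ 2 - sideS g ^ 2 = 1 := by
  have h1 := (sin_half_pos hg).ne'
  rw [sideS_sq hg, sideC, pi_div_eq, div_pow, ← sub_div, div_eq_one_iff_eq (pow_ne_zero 2 h1)]
  have h2 : Real.cos (stepAngle g) = 2 * Real.cos (stepAngle g / 2) ^ 2 - 1 := by
    rw [← Real.cos_two_mul]; ring_nf
  have h3 := Real.sin_sq_add_cos_sq (stepAngle g / 2)
  linarith

/-- The sides meet at the interior angle `π / 2g`. -/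
theorem sideS_sq_eq : sideS g ^ 2 = Real.cos (stepAngle g) * (1 + sideC g ^ 2) := by
  have h1 := (sin_half_pos hg).ne'
  have h3 := Real.sin_sq_add_cos_sq (stepAngle g / 2)
  rw [sideS_sq hg, sideC, pi_div_eq, div_pow]
  field_simp
  linear_combination (-Real.cos (stepAngle g)) * h3

omit hg in
theorem stretch_eq : stretch g = sideC g + sideS g := by
  unfold stretch sideC sideS
  rw [add_div]

theorem stretch_inv_eq : (stretch g)⁻¹ = sideC g - sideS g := by
  symm
  apply eq_inv_of_mul_eq_one_left
  rw [stretch_eq]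
  linear_combination sideC_sq_sub hg

end Trig

theorem cos_int_step {g : ℕ} (hg : 2 ≤ g) (α : ℝ) (k : ℤ) :
    Real.cos (α + 4 * g * k * stepAngle g) = Real.cos α := by
  rw [show α + 4 * g * k * stepAngle g = α + k * (2 * Real.pi) by
    rw [← mul_stepAngle hg]; ring]
  exact Real.cos_add_int_mul_two_pi _ _

theorem sin_int_step {g : ℕ} (hg : 2 ≤ g) (α : ℝ) (k : ℤ) :
    Real.sin (α + 4 * g * k * stepAngle g) = Real.sin α := by
  rw [show α + 4 * g * k * stepAngle g = α + k * (2 * Real.pi) by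
    rw [← mul_stepAngle hg]; ring]
  exact Real.sin_add_int_mul_two_pi _ _

theorem trig_opp {g : ℕ} (hg : 2 ≤ g) (a : Letter) :
    Real.cos (ang g (opp a)) = -Real.cos (ang g a) ∧ Real.sin (ang g (opp a)) = -Real.sin (ang g a)
      := by
  obtain ⟨k, hk⟩ := dir_opp g a
  have : ang g (opp a) = (ang g a + Real.pi) + 4 * g * k * stepAngle g := by
    unfold ang
    rw [hk, ← mul_stepAngle hg]
    push_cast
    ring
  rw [this, cos_int_step hg, sin_int_step hg, Real.cos_add_pi, Real.sin_add_pi]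
  exact ⟨rfl, rfl⟩

theorem trig_nxt {g : ℕ} (hg : 2 ≤ g) {a : Letter} (ha : IsLetter g a) (ε : Bool) :
    Real.cos (ang g (nxt g ε a)) = -Real.cos (ang g a - sgn ε * stepAngle g) ∧
      Real.sin (ang g (nxt g ε a)) = -Real.sin (ang g a - sgn ε * stepAngle g) := by
  obtain ⟨k, hk⟩ := dir_nxt ha ε
  have : ang g (nxt g ε a) = ((ang g a - sgn ε * stepAngle g) + Real.pi) + 4 * g * k * stepAngle g
      := by
    unfold ang
    rw [hk, ← mul_stepAngle hg]
    push_cast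
    ring
  rw [this, cos_int_step hg, sin_int_step hg, Real.cos_add_pi, Real.sin_add_pi]
  exact ⟨rfl, rfl⟩

/-! ### Letters as boosts -/

/-- The boost along the direction `α` with the translation length of the letters. -/
def boost (g : ℕ) (α : ℝ) (v : ℝ × ℝ × ℝ) : ℝ × ℝ × ℝ :=
  let d := 2 * sideS g * sideC g * v.1 + (sideC g ^ 2 + sideS g ^ 2) * dco α v
  ((sideC g ^ 2 + sideS g ^ 2) * v.1 + 2 * sideS g * sideC g * dco α v,
    Real.cos α * d - Real.sin α * wco α v, Real.sin α * d + Real.cos α * wco α v)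

theorem lact_transQ {g : ℕ} (hg : 2 ≤ g) (v : ℝ × ℝ × ℝ) :
    lact (transQ g) v = boost g 0 v := by
  have h := sideC_sq_sub hg
  have e : (transQ g).1 = !![stretch g, 0; 0, (stretch g)⁻¹] :=
    congrArg Subtype.val (dif_pos hg)
  rw [stretch_inv_eq hg, stretch_eq] at e
  simp only [lact, e, boost, dco, wco, Real.cos_zero, Real.sin_zero]
  simp only [Matrix.of_apply, Matrix.cons_val', Matrix.cons_val_zero, Matrix.cons_val_one,
    Matrix.cons_val_fin_one]
  refine Prod.ext ?_ (Prod.ext ?_ ?_) <;> dsimp only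
  · ring
  · ring
  · linear_combination v.2.2 * h

/-- The rotation of Lorentzian space by the angle `α`. -/
def rotv (α : ℝ) (v : ℝ × ℝ × ℝ) : ℝ × ℝ × ℝ :=
  (v.1, Real.cos α * v.2.1 - Real.sin α * v.2.2, Real.sin α * v.2.1 + Real.cos α * v.2.2)

theorem rotv_rotv (α β : ℝ) (v : ℝ × ℝ × ℝ) : rotv α (rotv β v) = rotv (α + β) v := by
  simp only [rotv, Real.cos_add, Real.sin_add]
  refine Prod.ext ?_ (Prod.ext ?_ ?_) <;> dsimp only <;> ring

theorem rotv_zero (v : ℝ × ℝ × ℝ) : rotv 0 v = v := by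
  simp [rotv]

theorem lact_rotM {g : ℕ} (v : ℝ × ℝ × ℝ) :
    lact (rotM g) v = rotv (-(2 * ((2 * g - 1) * Real.pi / (4 * g)))) v := by
  simp only [lact, rotM, rotv, Real.cos_neg, Real.sin_neg, Real.cos_two_mul', Real.sin_two_mul]
  simp only [Matrix.of_apply, Matrix.cons_val', Matrix.cons_val_zero, Matrix.cons_val_one,
    Matrix.cons_val_fin_one]
  have h := Real.sin_sq_add_cos_sq ((2 * g - 1) * Real.pi / (4 * g))
  refine Prod.ext ?_ (Prod.ext ?_ ?_) <;> dsimp only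
  · linear_combination v.1 * h
  · ring
  · ring

theorem lact_rotM_pow {g : ℕ} (j : ℕ) (v : ℝ × ℝ × ℝ) :
    lact (rotM g ^ j) v = rotv (-(j * ((2 * g - 1) * stepAngle g))) v := by
  induction j with
  | zero => simp [lact_one, rotv_zero]
  | succ j ih =>
    rw [pow_succ', lact_mul, ih, lact_rotM, rotv_rotv]
    congr 1
    push_cast
    rw [stepAngle]
    ring

theorem lact_rotM_inv_pow {g : ℕ} (j : ℕ) (v : ℝ × ℝ × ℝ) :
    lact ((rotM g)⁻¹ ^ j) v = rotv (j * ((2 * g - 1) * stepAngle g)) v := by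
  have h : v = lact (rotM g ^ j) (rotv (j * ((2 * g - 1) * stepAngle g)) v) := by
    rw [lact_rotM_pow, rotv_rotv, neg_add_cancel, rotv_zero]
  conv_lhs => rw [h]
  rw [← lact_mul, inv_pow, inv_mul_cancel, lact_one]

theorem rotv_boost (g : ℕ) (α : ℝ) (v : ℝ × ℝ × ℝ) :
    rotv α (boost g 0 (rotv (-α) v)) = boost g α v := by
  simp only [rotv, boost, dco, wco, Real.cos_zero, Real.sin_zero, Real.cos_neg, Real.sin_neg]
  refine Prod.ext ?_ (Prod.ext ?_ ?_) <;> dsimp only <;> ring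

theorem letterElt_opp (g : ℕ) (a : Letter) : letterElt g (opp a) = (letterElt g a)⁻¹ := by
  obtain ⟨j, _ | _⟩ := a <;> simp [letterElt, opp]

theorem boost_congr {g : ℕ} {α β : ℝ} (hc : Real.cos α = Real.cos β)
    (hs : Real.sin α = Real.sin β) :
    boost g α = boost g β := by
  funext v
  simp only [boost, dco, wco, hc, hs]

theorem boost_add_pi_boost {g : ℕ} (hg : 2 ≤ g) (α : ℝ) (v : ℝ × ℝ × ℝ) :
    boost g (α + Real.pi) (boost g α v) = v := by
  have h := sideC_sq_sub hg
  have h2 := Real.sin_sq_add_cos_sq α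
  have hd : dco α (boost g α v) = 2 * sideS g * sideC g * v.1 +
      (sideC g ^ 2 + sideS g ^ 2) * dco α v := by
    simp only [dco, boost]
    linear_combination (2 * sideS g * sideC g * v.1 +
      (sideC g ^ 2 + sideS g ^ 2) * (Real.cos α * v.2.1 + Real.sin α * v.2.2)) * h2
  have hw : wco α (boost g α v) = wco α v := by
    simp only [wco, boost]
    linear_combination (-Real.sin α * v.2.1 + Real.cos α * v.2.2) * h2
  have hd' : ∀ v, dco (α + Real.pi) v = -dco α v := fun v => by
    simp only [dco, Real.cos_add_pi, Real.sin_add_pi]; ring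
  have hw' : ∀ v, wco (α + Real.pi) v = -wco α v := fun v => by
    simp only [wco, Real.cos_add_pi, Real.sin_add_pi]; ring
  have e :
      (boost g α v).1 = (sideC g ^ 2 + sideS g ^ 2) * v.1 + 2 * sideS g * sideC g * dco α v := rfl
  rw [boost]
  simp only [hd', hw', hd, hw, e, Real.cos_add_pi, Real.sin_add_pi]
  have hC : sideC g ^ 2 = 1 + sideS g ^ 2 := by linarith
  refine Prod.ext ?_ (Prod.ext ?_ ?_) <;> dsimp only
  · linear_combination (v.1 * (sideC g ^ 2 - sideS g ^ 2 + 1)) * h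
  · simp only [dco, wco]
    linear_combination (Real.cos α * (Real.cos α * v.2.1 + Real.sin α * v.2.2) *
      (sideC g ^ 2 - sideS g ^ 2 + 1)) * h + v.2.1 * h2
  · simp only [dco, wco]
    linear_combination (Real.sin α * (Real.cos α * v.2.1 + Real.sin α * v.2.2) *
      (sideC g ^ 2 - sideS g ^ 2 + 1)) * h + v.2.2 * h2

theorem lact_letterElt {g : ℕ} (hg : 2 ≤ g) (a : Letter) (v : ℝ × ℝ × ℝ) :
    lact (letterElt g a) v = boost g (ang g a) v := by
  have key : ∀ (j : ℕ) (v : ℝ × ℝ × ℝ), lact (delta g j) v = boost g (ang g (j, true)) v := by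
    intro j v
    rw [delta, lact_mul, lact_mul, lact_rotM_pow, lact_rotM_inv_pow, lact_transQ hg, rotv_boost]
    congr 1
    simp only [ang, dir, if_true]
    push_cast
    ring
  obtain ⟨j, _ | _⟩ := a
  · have hb : boost g (ang g (j, false)) = boost g (ang g (j, true) + Real.pi) := by
      obtain ⟨h1, h2⟩ := trig_opp hg (j, true)
      exact boost_congr (by rw [Real.cos_add_pi]; exact h1) (by rw [Real.sin_add_pi]; exact h2)
    have h := boost_add_pi_boost hg (ang g (j, true)) (lact (delta g j)⁻¹ v)
    rw [← key, ← lact_mul, mul_inv_cancel, lact_one] at h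
    rw [hb, h]
    rfl
  · exact key j v

/-! ### Crossing a side -/

/-- A letter carries the side of its inverse to its own side, and the polygon to the other side of
it. -/
theorem side_opp_lact_inv {g : ℕ} (hg : 2 ≤ g) (a : Letter) (v : ℝ × ℝ × ℝ) :
    side g (opp a) (lact (letterElt g a)⁻¹ v) = -side g a v := by
  rw [← letterElt_opp, lact_letterElt hg]
  obtain ⟨h1, h2⟩ := trig_opp hg a
  have h := sideC_sq_sub hg
  have h3 := Real.sin_sq_add_cos_sq (ang g a)
  simp only [side, sideAt, boost, dco, wco, h1, h2]
  have e : sideC g ^ 2 = 1 + sideS g ^ 2 := by linarith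
  linear_combination
    (sideC g * (Real.cos (ang g a) * v.2.1 + Real.sin (ang g a) * v.2.2) - sideS g * v.1) * h +
      (-2 * sideS g * sideC g ^ 2 * v.1 + sideC g * (sideC g ^ 2 + sideS g ^ 2) *
        (Real.cos (ang g a) * v.2.1 + Real.sin (ang g a) * v.2.2)) * h3

/-- At an end of the side of `a`, where the polygon has angle `π / 2g`: the second side of the
neighboring polygon at this vertex, expressed by the two sides of the polygon itself. -/
theorem side_nxt_lact_inv {g : ℕ} (hg : 2 ≤ g) {a : Letter} (ha : IsLetter g a) (ε : Bool)
    (v : ℝ × ℝ × ℝ) :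
    side g (nxt g ε a) (lact (letterElt g a)⁻¹ v) =
      side g (opp (nxt g (!ε) a)) v + 2 * Real.cos (stepAngle g) * side g a v := by
  rw [← letterElt_opp, lact_letterElt hg]
  obtain ⟨h1, h2⟩ := trig_opp hg a
  obtain ⟨n1, n2⟩ := trig_nxt hg ha ε
  obtain ⟨m1, m2⟩ := trig_opp hg (nxt g (!ε) a)
  obtain ⟨k1, k2⟩ := trig_nxt hg ha (!ε)
  have hs : (sgn (!ε) : ℝ) = -sgn ε := by cases ε <;> simp [sgn]
  have hcs : Real.cos (sgn ε * stepAngle g) = Real.cos (stepAngle g) := by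
    cases ε <;> simp [sgn]
  rw [k1] at m1
  rw [k2] at m2
  rw [hs, neg_mul, sub_neg_eq_add, neg_neg, Real.cos_add] at m1
  rw [hs, neg_mul, sub_neg_eq_add, neg_neg, Real.sin_add] at m2
  rw [Real.cos_sub] at n1
  rw [Real.sin_sub] at n2
  have h := sideC_sq_sub hg
  have h' := sideS_sq_eq hg
  have h3 := Real.sin_sq_add_cos_sq (ang g a)
  rw [hcs] at m1 m2 n1 n2
  simp only [side, sideAt, boost, dco, wco, h1, h2, n1, n2, m1, m2]
  generalize Real.sin (sgn ε * stepAngle g) = σ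
  generalize Real.cos (stepAngle g) = κ at *
  generalize Real.cos (ang g a) = c at *
  generalize Real.sin (ang g a) = s at *
  generalize sideS g = S at *
  generalize sideC g = C at *
  generalize v.1 = T at *
  generalize v.2.1 = X at *
  generalize v.2.2 = Y at *
  linear_combination (S * T - C * κ * (c * X + s * Y)) * h +
    (2 * S * T - 2 * C * (c * X + s * Y)) * h' -
    C * (κ * (2 * S * C * T - (C ^ 2 + S ^ 2) * (c * X + s * Y)) + σ * (-s * X + c * Y)) * h3

/-! ### Position with respect to the sides of the polygon -/

theorem cos_le_of_not_adjacent {g : ℕ} (hg : 2 ≤ g) {n : ℤ} (h0 : ¬ ∃ k : ℤ, n = 4 * g * k)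
    (h1 : ¬ ∃ k : ℤ, n = 1 + 4 * g * k) (h2 : ¬ ∃ k : ℤ, n = -1 + 4 * g * k) :
    Real.cos (n * stepAngle g) ≤ Real.cos (2 * stepAngle g) := by
  have hpos := stepAngle_pos hg
  have hpi := mul_stepAngle hg
  set r := n % (4 * g) with hr
  have hn : n = r + 4 * g * (n / (4 * g)) := (Int.emod_add_mul_ediv n (4 * g)).symm
  have hr0 : 0 ≤ r := Int.emod_nonneg _ (by omega)
  have hr1 : r < 4 * g := Int.emod_lt_of_pos _ (by omega)
  have e0 : r ≠ 0 := fun h => h0 ⟨n / (4 * g), by rw [h, zero_add] at hn; exact hn⟩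
  have e1 : r ≠ 1 := fun h => h1 ⟨n / (4 * g), by rw [h] at hn; exact hn⟩
  have e2 : r ≠ 4 * g - 1 := fun h => h2 ⟨n / (4 * g) + 1, by rw [h] at hn; linear_combination hn⟩
  have key :
      ∀ t : ℤ, 2 ≤ t → t ≤ 2 * g → Real.cos (t * stepAngle g) ≤ Real.cos (2 * stepAngle g) := by
    intro t ht ht'
    have ht2 : (2 : ℝ) ≤ t := by exact_mod_cast ht
    have ht3 : (t : ℝ) ≤ 2 * g := by exact_mod_cast ht'
    apply Real.cos_le_cos_of_nonneg_of_le_pi (by positivity)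
    · rw [← hpi]; gcongr
    · gcongr
  have e3 : Real.cos (n * stepAngle g) = Real.cos (r * stepAngle g) := by
    conv_lhs => rw [hn]
    push_cast
    rw [add_mul]
    exact_mod_cast cos_int_step hg (r * stepAngle g) (n / (4 * g))
  rw [e3]
  by_cases h : r ≤ 2 * g
  · exact key r (by omega) h
  · have e4 : Real.cos (r * stepAngle g) = Real.cos (((4 * g - r : ℤ) : ℝ) * stepAngle g) := by
      rw [← Real.cos_neg, ← cos_int_step hg (-(r * stepAngle g)) 1]
      congr 1
      push_cast
      ring
    rw [e4]
    exact key _ (by omega) (by omega)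

theorem lor_sq (z : ℍ) : (lor z).2.1 ^ 2 + (lor z).2.2 ^ 2 = (lor z).1 ^ 2 - 1 := by
  have := lprod_lor_self z
  unfold lprod at this
  linarith

/-- A point cannot lie beyond two sides that are not adjacent. -/
theorem side_pos_of_not_adjacent {g : ℕ} (hg : 2 ≤ g) {p q : Letter} (hp : IsLetter g p)
    (hq : IsLetter g q) (hpq : p ≠ q) (hadj : ∀ ε, p ≠ opp (nxt g ε q)) (z : ℍ)
    (h : side g p (lor z) ≤ 0) : 0 < side g q (lor z) := by
  have hcos : Real.cos (ang g p - ang g q) ≤ Real.cos (2 * stepAngle g) := by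
    have : ang g p - ang g q = ((dir g p - dir g q : ℤ) : ℝ) * stepAngle g := by
      unfold ang; push_cast; ring
    rw [this]
    have hdir : ∀ ε, ∃ k : ℤ, dir g (opp (nxt g ε q)) = dir g q - sgn ε + 4 * g * k := by
      intro ε
      obtain ⟨k, hk⟩ := dir_opp g (nxt g ε q)
      obtain ⟨k', hk'⟩ := dir_nxt hq ε
      exact ⟨k + k' + 1, by rw [hk, hk']; ring⟩
    apply cos_le_of_not_adjacent hg
    · rintro ⟨k, hk⟩
      exact hpq (dir_injective hp hq ⟨k, by linarith⟩)
    · rintro ⟨k, hk⟩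
      obtain ⟨k', hk'⟩ := hdir false
      refine hadj false (dir_injective hp (hq.nxt _).opp ⟨k - k', ?_⟩)
      rw [hk']
      simp only [sgn, Bool.false_eq_true, if_false]
      linear_combination hk
    · rintro ⟨k, hk⟩
      obtain ⟨k', hk'⟩ := hdir true
      refine hadj true (dir_injective hp (hq.nxt _).opp ⟨k - k', ?_⟩)
      rw [hk']
      simp only [sgn, if_true]
      linear_combination hk
  suffices hsum : 0 < side g p (lor z) + side g q (lor z) by linarith
  have hC := sideC_pos hg
  have hS := sideS_pos hg
  have hκ := cos_step_pos hg
  have hSC := sideS_sq_eq hg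
  have hT := lor_fst_pos z
  have hXY := lor_sq z
  rw [Real.cos_sub, Real.cos_two_mul] at hcos
  have t1 := Real.sin_sq_add_cos_sq (ang g p)
  have t2 := Real.sin_sq_add_cos_sq (ang g q)
  have hκ1 : Real.cos (stepAngle g) ≤ 1 := Real.cos_le_one _
  simp only [side, sideAt, dco]
  generalize Real.sin (ang g p) = s at *
  generalize Real.cos (ang g p) = c at *
  generalize Real.sin (ang g q) = s' at *
  generalize Real.cos (ang g q) = c' at *
  generalize Real.cos (stepAngle g) = κ at *
  generalize sideS g = S at *
  generalize sideC g = C at *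
  generalize (lor z).1 = T at *
  generalize (lor z).2.1 = X at *
  generalize (lor z).2.2 = Y at *
  have hsq : ((c + c') * X + (s + s') * Y) ^ 2 ≤ 4 * κ ^ 2 * T ^ 2 := by
    have a1 :
        ((c + c') * X + (s + s') * Y) ^ 2 ≤ ((c + c') ^ 2 + (s + s') ^ 2) * (X ^ 2 + Y ^ 2) := by
      nlinarith [sq_nonneg ((c + c') * Y - (s + s') * X)]
    have a2 : (c + c') ^ 2 + (s + s') ^ 2 ≤ 4 * κ ^ 2 := by nlinarith
    have a3 : X ^ 2 + Y ^ 2 ≤ T ^ 2 := by linarith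
    calc _ ≤ _ := a1
      _ ≤ _ := by gcongr
  have hle : (c + c') * X + (s + s') * Y ≤ 2 * κ * T := by
    refine (le_abs_self _).trans (abs_le_of_sq_le_sq ?_ (by positivity))
    calc _ ≤ _ := hsq
      _ = _ := by ring
  have hCS : C * κ < S := by
    apply lt_of_pow_lt_pow_left₀ 2 hS.le
    rw [hSC]
    have : C ^ 2 * κ ^ 2 ≤ C ^ 2 * κ := by
      apply mul_le_mul_of_nonneg_left _ (by positivity)
      nlinarith
    nlinarith
  have : C * ((c + c') * X + (s + s') * Y) ≤ C * (2 * κ * T) := by gcongr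
  nlinarith

/-- The sector with index `r` at a vertex of the polygon: `x` and `y` are the values of the linear
forms of the two sides at the vertex, the point lies beyond the first side, and the sector of the
polygon itself has index `0`. The parameters `x₀`, `y₀` are the values of these forms at the image
of the point in the sector with index `0`, up to the factor `sin θ`. -/
def Sec (g : ℕ) (r : ℕ) (x y : ℝ) : Prop :=
  ∃ x₀ y₀ : ℝ, 0 < x₀ ∧ 0 < y₀ ∧
    -x = x₀ * Real.sin (r * stepAngle g) + y₀ * Real.sin ((r - 1) * stepAngle g) ∧
    y = x₀ * Real.sin ((r + 1) * stepAngle g) + y₀ * Real.sin (r * stepAngle g)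

theorem Sec.one {g : ℕ} (hg : 2 ≤ g) {x y : ℝ} (hx : 0 < x) (hy : 0 < y) :
    Sec g 1 (-x) (y + 2 * Real.cos (stepAngle g) * x) := by
  have h := sin_step_pos hg
  refine ⟨x / Real.sin (stepAngle g), y / Real.sin (stepAngle g), by positivity, by positivity, ?_,
    ?_⟩
  · simp [h.ne']
  · rw [show (((1 : ℕ) : ℝ) + 1) * stepAngle g = 2 * stepAngle g by norm_num,
      Nat.cast_one, one_mul, Real.sin_two_mul]
    field_simp
    ring

theorem Sec.succ {g : ℕ} {r : ℕ} {x y : ℝ} (h : Sec g r x y) :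
    Sec g (r + 1) (-y) (x + 2 * Real.cos (stepAngle g) * y) := by
  obtain ⟨x₀, y₀, hx, hy, e1, e2⟩ := h
  refine ⟨x₀, y₀, hx, hy, ?_, ?_⟩
  · rw [neg_neg, e2]
    push_cast
    ring_nf
  · have h1 : x = -(x₀ * Real.sin (r * stepAngle g) + y₀ * Real.sin ((r - 1) * stepAngle g)) := by
      linarith
    have hrec : ∀ t : ℝ, Real.sin ((t + 1) * stepAngle g) =
        2 * Real.cos (stepAngle g) * Real.sin (t * stepAngle g) - Real.sin ((t - 1) * stepAngle g)
            := by
      intro t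
      rw [add_mul, sub_mul, one_mul, Real.sin_add, Real.sin_sub]
      ring
    rw [h1, e2]
    push_cast
    have r1 := hrec r
    have r2 := hrec (r + 1)
    rw [add_sub_cancel_right] at r2
    rw [r2]
    linear_combination -y₀ * r1

theorem sin_nonneg_of_le {g : ℕ} (hg : 2 ≤ g) {t : ℝ} (h0 : 0 ≤ t) (h1 : t ≤ 2 * g) :
    0 ≤ Real.sin (t * stepAngle g) := by
  have := stepAngle_pos hg
  apply Real.sin_nonneg_of_nonneg_of_le_pi (by positivity)
  rw [← mul_stepAngle hg]
  gcongr

theorem sin_pos_of_lt {g : ℕ} (hg : 2 ≤ g) {t : ℝ} (h0 : 0 < t) (h1 : t < 2 * g) :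
    0 < Real.sin (t * stepAngle g) := by
  have := stepAngle_pos hg
  apply Real.sin_pos_of_pos_of_lt_pi (by positivity)
  rw [← mul_stepAngle hg]
  gcongr

/-- Up to index `2g`, the point lies beyond the first side, because `r π / 2g ≤ π`. -/
theorem Sec.neg {g : ℕ} (hg : 2 ≤ g) {r : ℕ} {x y : ℝ} (h : Sec g r x y) (h1 : 1 ≤ r)
    (h2 : r ≤ 2 * g) : x < 0 := by
  obtain ⟨x₀, y₀, hx, hy, e1, -⟩ := h
  have hr : (1 : ℝ) ≤ r := by exact_mod_cast h1
  have hr' : (r : ℝ) ≤ 2 * g := by exact_mod_cast h2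
  have a1 := sin_nonneg_of_le hg (t := r) (by linarith) hr'
  have a2 := sin_nonneg_of_le hg (t := r - 1) (by linarith) (by linarith)
  rcases h2.lt_or_eq with h3 | h3
  · have h3' : (r : ℝ) < 2 * g := by exact_mod_cast h3
    have a3 := sin_pos_of_lt hg (t := r) (by linarith) h3'
    nlinarith [mul_pos hx a3, mul_nonneg hy.le a2]
  · have h4 : (r : ℝ) = 2 * g := by exact_mod_cast h3
    have hg' : (2 : ℝ) ≤ g := by exact_mod_cast hg
    have a3 := sin_pos_of_lt hg (t := r - 1) (by linarith) (by linarith)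
    nlinarith [mul_pos hy a3, mul_nonneg hx.le a1]

/-- Below index `2g`, the point lies on the inner side of the second side. -/
theorem Sec.pos {g : ℕ} (hg : 2 ≤ g) {r : ℕ} {x y : ℝ} (h : Sec g r x y) (h1 : 1 ≤ r)
    (h2 : r < 2 * g) : 0 < y := by
  obtain ⟨x₀, y₀, hx, hy, -, e2⟩ := h
  have hr : (1 : ℝ) ≤ r := by exact_mod_cast h1
  have hr' : (r : ℝ) < 2 * g := by exact_mod_cast h2
  have hr2 : (r : ℝ) + 1 ≤ 2 * g := by exact_mod_cast h2
  have a1 := sin_nonneg_of_le hg (t := r + 1) (by linarith) hr2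
  have a3 := sin_pos_of_lt hg (t := r) (by linarith) hr'
  nlinarith [mul_pos hy a3, mul_nonneg hx.le a1]

/-- With index `2g`, the point lies beyond both sides, in the sector opposite to the polygon. -/
theorem Sec.neg_of_eq {g : ℕ} (hg : 2 ≤ g) {x y : ℝ} (h : Sec g (2 * g) x y) : y < 0 := by
  obtain ⟨x₀, y₀, hx, hy, -, e2⟩ := h
  have := sin_step_pos hg
  have e : ((2 * g : ℕ) : ℝ) * stepAngle g = Real.pi := by
    push_cast
    exact mul_stepAngle hg
  rw [add_mul, one_mul, e, Real.sin_pi, add_comm Real.pi, Real.sin_add_pi] at e2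
  nlinarith

/-! ### Tracking a point along a word -/

/-- The index of the sector in which the starting point of a path is found after the path, at the
end `ε` of the side that has been crossed last. The path is given by its list of letters in reverse
order. -/
def secIdx (g : ℕ) (ε : Bool) : List Letter → ℕ
  | [] => 0
  | [_] => 1
  | a' :: a :: l =>
    if a' = nxt g ε a then secIdx g ε (a :: l) + 1
    else if secIdx g ε (a :: l) = 2 * g ∧ a' = opp (nxt g ε (nxt g ε a)) then 2 else 1

theorem one_le_secIdx (g : ℕ) (ε : Bool) (a : Letter) (l : List Letter) :
    1 ≤ secIdx g ε (a :: l) := by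
  cases l with
  | nil => simp [secIdx]
  | cons b l =>
    rw [secIdx]
    split_ifs <;> omega

theorem nxt_ne_opp {g : ℕ} {a : Letter} (ha : IsLetter g a) (ε : Bool) :
    nxt g ε a ≠ opp a := by
  obtain ⟨j, e⟩ := a
  obtain ⟨h1, h2⟩ := ha
  dsimp only at h1 h2
  unfold nxt opp
  split_ifs <;> simp [Prod.ext_iff] <;> omega

theorem nxt_nxt_ne {g : ℕ} (hg : 2 ≤ g) {a : Letter} (ha : IsLetter g a) (ε : Bool) :
    nxt g ε (nxt g ε a) ≠ a := by
  obtain ⟨j, e⟩ := a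
  obtain ⟨h1, h2⟩ := ha
  dsimp only at h1 h2
  unfold nxt
  split_ifs <;> simp_all [Prod.ext_iff] <;> omega

theorem nxt_not_eq {g : ℕ} {a b : Letter} (ha : IsLetter g a) (hb : IsLetter g b) (ε : Bool) :
    nxt g (!ε) a = b ↔ a = nxt g ε b := by
  constructor
  · rintro rfl
    have := nxt_nxt_not ha (!ε)
    rw [Bool.not_not] at this
    exact this.symm
  · rintro rfl
    exact nxt_nxt_not hb ε

/-- The sides beyond which a point can lie that is beyond the side of `opp a`. -/
theorem side_pos_of_behind {g : ℕ} (hg : 2 ≤ g) {a b : Letter} (ha : IsLetter g a)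
    (hb : IsLetter g b) (hba : b ≠ opp a) (hn : ∀ ε, b ≠ nxt g ε a) {z : ℍ}
    (h : side g (opp a) (lor z) ≤ 0) : 0 < side g b (lor z) := by
  refine side_pos_of_not_adjacent hg ha.opp hb hba.symm (fun ε h' => ?_) z h
  have : a = nxt g ε b := opp_injective h'
  have h2 := (nxt_not_eq ha hb ε).2 this
  exact hn _ h2.symm

/-- Near a vertex of the polygon: a point beyond both sides at a vertex is, at the next vertex, in
the sector that is adjacent to the polygon. -/
theorem side_chain_pos {g : ℕ} (hg : 2 ≤ g) {a : Letter} (ha : IsLetter g a) (ε : Bool) {z : ℍ}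
    (h1 : side g (opp a) (lor z) < 0) (h2 : side g (nxt g ε a) (lor z) < 0) :
    0 < side g (opp (nxt g ε (nxt g ε a))) (lor z) +
      2 * Real.cos (stepAngle g) * side g (nxt g ε a) (lor z) := by
  have hκ := cos_step_pos hg
  have c := ha.nxt ε
  have e1 := side_nxt_lact_inv hg c ε (lor z)
  have e2 := side_nxt_lact_inv hg c (!ε) (lor z)
  rw [Bool.not_not] at e2
  rw [nxt_nxt_not ha] at e1 e2
  rw [← lor_smul] at e1 e2
  have h3 : 0 < side g a (lor ((letterElt g (nxt g ε a))⁻¹ • z)) := by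
    refine side_pos_of_not_adjacent hg (p := nxt g ε (nxt g ε a)) (c.nxt _) ha
      (nxt_nxt_ne hg ha ε) (fun ε' h' => ?_) _ ?_
    · have e3 : nxt g ε (nxt g ε a) = nxt g ε' (opp a) := by rw [h', nxt_opp]
      have hε : ∀ b, b ≠ ε → b = !ε := fun b hb => by cases b <;> cases ε <;> simp_all
      by_cases hε' : ε' = ε
      · subst hε'
        have := congrArg (nxt g (!ε')) e3
        rw [nxt_nxt_not c, nxt_nxt_not ha.opp] at this
        exact nxt_ne_opp ha ε' this
      · rw [hε _ hε'] at e3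
        -- three steps in the same direction would lead to the opposite letter
        have e4 := congrArg (nxt g ε) e3
        have e5 := nxt_nxt_not ha.opp (!ε)
        rw [Bool.not_not] at e5
        rw [e5] at e4
        obtain ⟨k1, hk1⟩ := dir_nxt ha ε
        obtain ⟨k2, hk2⟩ := dir_nxt c ε
        obtain ⟨k3, hk3⟩ := dir_nxt (c.nxt ε) ε
        obtain ⟨k4, hk4⟩ := dir_opp g a
        rw [e4, hk4, hk2, hk1] at hk3
        have hs : sgn ε = 1 ∨ sgn ε = -1 := by cases ε <;> simp [sgn]
        have h5 : 3 * sgn ε = 4 * g * (k1 + k2 + k3 - k4 + 1) := by linear_combination hk3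
        rcases hs with hs | hs <;> rw [hs] at h5
        · have : (4 : ℤ) ∣ 3 := ⟨g * (k1 + k2 + k3 - k4 + 1), by linear_combination h5⟩
          norm_num at this
        · have : (4 : ℤ) ∣ 3 := ⟨-g * (k1 + k2 + k3 - k4 + 1), by linear_combination -h5⟩
          norm_num at this
    · rw [e1]
      nlinarith
  rwa [e2] at h3

/-- How the sector of a point changes when the path is continued by one letter. -/
theorem Sec.step {g : ℕ} (hg : 2 ≤ g) {a a' : Letter} (ha : IsLetter g a) (ha' : IsLetter g a')
    {z : ℍ} {r : Bool → ℕ} (hr1 : ∀ ε, 1 ≤ r ε) (hr2 : ∀ ε, r ε ≤ 2 * g)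
    (hsec : ∀ ε, Sec g (r ε) (side g (opp a) (lor z)) (side g (nxt g ε a) (lor z)))
    (h1 : a' ≠ opp a) (h2 : ∀ ε, r ε = 2 * g → a' ≠ nxt g ε a) (ε : Bool) :
    Sec g (if a' = nxt g ε a then r ε + 1 else
        if r ε = 2 * g ∧ a' = opp (nxt g ε (nxt g ε a)) then 2 else 1)
      (side g (opp a') (lor ((letterElt g a')⁻¹ • z)))
      (side g (nxt g ε a') (lor ((letterElt g a')⁻¹ • z))) := by
  rw [lor_smul, side_opp_lact_inv hg, side_nxt_lact_inv hg ha']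
  have hbeh : side g (opp a) (lor z) < 0 := (hsec true).neg hg (hr1 _) (hr2 _)
  have hpos : 0 < side g a' (lor z) := by
    by_cases h : ∃ ε', a' = nxt g ε' a
    · obtain ⟨ε', h'⟩ := h
      have h3 : r ε' < 2 * g := lt_of_le_of_ne (hr2 _) fun h4 => h2 _ h4 h'
      rw [h']
      exact (hsec ε').pos hg (hr1 _) h3
    · push Not at h
      exact side_pos_of_behind hg ha ha' h1 h hbeh.le
  split_ifs with h3 h4
  · have e : opp (nxt g (!ε) a') = opp a := by rw [h3, nxt_nxt_not ha]
    rw [e, h3]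
    exact (hsec ε).succ
  · -- the two sides at the vertex are both behind; the path goes on around the next vertex
    have e : opp (nxt g (!ε) a') = nxt g ε a := by
      rw [h4.2, nxt_opp, opp_opp, nxt_nxt_not (ha.nxt ε)]
    rw [e]
    have hy : side g (nxt g ε a) (lor z) < 0 := by
      have := hsec ε
      rw [h4.1] at this
      exact this.neg_of_eq hg
    have hc := side_chain_pos hg ha ε hbeh hy
    rw [← h4.2] at hc
    have := (Sec.one hg (neg_pos.2 hy) hc).succ
    rw [neg_neg] at this
    convert this using 1 <;> ring
  · apply Sec.one hg hpos
    by_cases hq : opp (nxt g (!ε) a') = nxt g ε a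
    · have h5 : r ε < 2 * g := by
        refine lt_of_le_of_ne (hr2 _) fun h6 => h4 ⟨h6, ?_⟩
        rw [← hq, nxt_opp, opp_opp]
        have := nxt_nxt_not ha' (!ε)
        rw [Bool.not_not] at this
        exact this.symm
      rw [hq]
      exact (hsec ε).pos hg (hr1 _) h5
    · refine side_pos_of_behind hg ha (ha'.nxt _).opp (fun h => h3 ?_) (fun ε' h => ?_) hbeh.le
      · exact (nxt_not_eq ha' ha ε).1 (opp_injective h)
      · have hε : ε' = ε ∨ ε' = !ε := by cases ε <;> cases ε' <;> simp
        rcases hε with rfl | rfl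
        · exact hq h
        · rw [← nxt_opp] at h
          have h6 := congrArg (nxt g ε) h
          have e1 := nxt_nxt_not ha'.opp (!ε)
          have e2 := nxt_nxt_not ha (!ε)
          rw [Bool.not_not] at e1 e2
          rw [e1, e2] at h6
          apply h1
          rw [← h6, opp_opp]

/-! ### `D`-reduced words and chains of relators -/

theorem IsDReduced.of_infix {g : ℕ} {u w : List Letter} (hw : IsDReduced g w) (h : u <:+: w) :
    IsDReduced g u := fun l r hl hlu => hw l r hl (hlu.trans h)

theorem iterate_nxt_fst {g : ℕ} {a : Letter} (ha : IsLetter g a) (ε : Bool) (n : ℕ) :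
    IsLetter g ((nxt g ε)^[n] a) ∧ ∃ k : ℤ,
      dir g ((nxt g ε)^[n] a) = dir g a + n * (2 * g - sgn ε) + 4 * g * k := by
  induction n with
  | zero => exact ⟨ha, 0, by simp⟩
  | succ n ih =>
    obtain ⟨h, k, hk⟩ := ih
    rw [Function.iterate_succ_apply']
    obtain ⟨k', hk'⟩ := dir_nxt h ε
    exact ⟨h.nxt ε, k + k', by rw [hk', hk]; push_cast; ring⟩

/-- Half of the relator leads from a letter to its inverse. -/
theorem iterate_nxt_two_mul {g : ℕ} {a : Letter} (ha : IsLetter g a) (ε : Bool) :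
    (nxt g ε)^[2 * g] a = opp a := by
  obtain ⟨h, k, hk⟩ := iterate_nxt_fst ha ε (2 * g)
  obtain ⟨k', hk'⟩ := dir_opp g a
  have hs : sgn ε = 1 ∨ sgn ε = -1 := by cases ε <;> simp [sgn]
  refine dir_injective h ha.opp ?_
  rcases hs with hs | hs <;> rw [hs] at hk
  · exact ⟨g + k - k' - 1, by rw [hk, hk']; push_cast; ring⟩
  · exact ⟨g + k - k', by rw [hk, hk']; push_cast; ring⟩

theorem iterate_nxt_true {g : ℕ} (j : ℕ) (e : Bool) (n : ℕ) (h : j + n ≤ 2 * g) :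
    (nxt g true)^[n] (j, e) = (j + n, e) := by
  induction n with
  | zero => simp
  | succ n ih =>
    rw [Function.iterate_succ_apply', ih (by omega), nxt, if_pos rfl, if_pos (by dsimp only; omega)]
    rfl

theorem iterate_nxt_false {g : ℕ} (j : ℕ) (e : Bool) (n : ℕ) (h : n < j) :
    (nxt g false)^[n] (j, e) = (j - n, e) := by
  induction n with
  | zero => simp
  | succ n ih =>
    rw [Function.iterate_succ_apply', ih (by omega), nxt, if_neg Bool.false_ne_true,
      if_pos (by dsimp only; omega)]
    rfl

theorem list_iterate_add {α : Type*} (f : α → α) (a : α) (m n : ℕ) :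
    List.iterate f a (m + n) = List.iterate f a m ++ List.iterate f (f^[m] a) n := by
  induction m generalizing a with
  | zero => simp
  | succ m ih =>
    rw [Nat.add_right_comm]
    simp [ih]

theorem list_iterate_succ' {α : Type*} (f : α → α) (a : α) (n : ℕ) :
    List.iterate f a (n + 1) = List.iterate f a n ++ [f^[n] a] := by
  rw [list_iterate_add]
  rfl

theorem iterate_true_eq_asc {g : ℕ} {j : ℕ} (hj : 1 ≤ j) (e : Bool) (n : ℕ)
    (h : j + n ≤ 2 * g + 1) :
    List.iterate (nxt g true) (j, e) n = asc e j (j + n - 1) := by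
  have e1 : j + n - 1 + 1 - j = n := by omega
  rw [asc, e1]
  clear e1
  induction n with
  | zero => simp
  | succ n ih =>
    rw [list_iterate_succ', ih (by omega), iterate_nxt_true j e n (by omega), List.range'_1_concat]
    simp

theorem iterate_false_eq_desc {g : ℕ} (j : ℕ) (e : Bool) (n : ℕ) (h : n ≤ j) :
    List.iterate (nxt g false) (j, e) n = desc e j (j + 1 - n) := by
  have e1 : j + 1 - (j + 1 - n) = n := by omega
  rw [desc, asc, e1]
  clear e1
  induction n with
  | zero => simp
  | succ n ih =>
    rw [list_iterate_succ', ih (by omega), iterate_nxt_false j e n (by omega),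
      show j + 1 - (n + 1) = j - n by omega, show j + 1 - n = j - n + 1 by omega, List.range'_succ]
    simp

/-- Ascending subwords of the relator, with a passage from `c_{2g}` to `c_1⁻¹` (or from `c_{2g}⁻¹`
to `c_1`). -/
theorem iterate_true_eq {g : ℕ} {i : ℕ} (h1 : 1 ≤ i) (h2 : i ≤ 2 * g) (e : Bool) {n : ℕ}
    (hn : n ≤ 2 * g) {k : ℕ} (hk : k = (2 * g + 1 - i) + n) :
    List.iterate (nxt g true) (i, e) k = asc e i (2 * g) ++ asc (!e) 1 n := by
  have e1 : (nxt g true)^[2 * g + 1 - i] (i, e) = (1, !e) := by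
    rw [show 2 * g + 1 - i = (2 * g - i) + 1 by omega, Function.iterate_succ_apply',
      iterate_nxt_true i e _ (by omega), nxt, if_pos rfl, if_neg (by dsimp only; omega)]
  rw [hk, list_iterate_add, e1, iterate_true_eq_asc h1 e _ (by omega),
    iterate_true_eq_asc le_rfl _ _ (by omega)]
  congr 2 <;> omega

/-- Descending subwords of the inverse relator, with a passage from `c_1` to `c_{2g}⁻¹` (or from
`c_1⁻¹` to `c_{2g}`). -/
theorem iterate_false_eq {g : ℕ} {i : ℕ} (h1 : 1 ≤ i) (h2 : i ≤ 2 * g) (e : Bool) {n : ℕ}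
    (hn : n ≤ 2 * g) {k : ℕ} (hk : k = i + n) :
    List.iterate (nxt g false) (i, e) k = desc e i 1 ++ desc (!e) (2 * g) (2 * g + 1 - n) := by
  have e1 : (nxt g false)^[i] (i, e) = (2 * g, !e) := by
    obtain ⟨i, rfl⟩ : ∃ m, i = m + 1 := ⟨i - 1, by omega⟩
    rw [Function.iterate_succ_apply', iterate_nxt_false _ e _ (by omega), nxt,
      if_neg Bool.false_ne_true, if_neg (by dsimp only; omega)]
  rw [hk, list_iterate_add, e1, iterate_false_eq_desc _ e _ le_rfl,
    iterate_false_eq_desc _ _ _ hn]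
  congr 2
  omega

/-- The block that is repeated in a chain of relators with first letter `c`: the `2g - 1` letters
that follow `c` in the cyclic word given by `ε`. -/
def block (g : ℕ) (ε : Bool) (c : Letter) : List Letter :=
  List.iterate (nxt g ε) (nxt g ε c) (2 * g - 1)

/-- The letters `c` for which the half of the (inverse) relator that starts with `c` is the leading
word of an element of the Gröbner basis. -/
def IsLead (ε : Bool) (c : Letter) : Prop :=
  if ε then c = (1, true) ∨ (2 ≤ c.1 ∧ c.2 = false) else c.2 = false

theorem IsLead.groebnerD {g : ℕ} {ε : Bool} {c : Letter} (hc : IsLetter g c) (h : IsLead ε c) :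
    ∃ r, GroebnerD g (List.iterate (nxt g ε) c (2 * g)) r := by
  obtain ⟨j, e⟩ := c
  obtain ⟨h1, h2⟩ := hc
  dsimp only at h1 h2
  unfold IsLead at h
  cases ε
  · simp only [Bool.false_eq_true, if_false] at h
    subst h
    rcases h2.lt_or_eq with h3 | h3
    · have e2 := GroebnerD.d6 (g := g) (j + 1) (by omega) (by omega)
      rw [Nat.add_sub_cancel] at e2
      rw [iterate_false_eq h1 h2 false (n := 2 * g - j) (by omega) (by omega)]
      rw [show 2 * g + 1 - (2 * g - j) = j + 1 by omega]
      exact ⟨_, e2⟩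
    · subst h3
      rw [iterate_false_eq_desc _ _ _ le_rfl, Nat.add_sub_cancel_left]
      exact ⟨_, GroebnerD.d3⟩
  · simp only [if_true, Prod.mk.injEq] at h
    rcases h with ⟨rfl, rfl⟩ | ⟨h3, rfl⟩
    · rw [iterate_true_eq_asc le_rfl _ _ (by omega), Nat.add_sub_cancel_left]
      exact ⟨_, GroebnerD.d4⟩
    · rw [iterate_true_eq h1 h2 false (n := j - 1) (by omega) (by omega)]
      exact ⟨_, GroebnerD.d5 j h3 h2⟩

/-- One half of each relator in a chain, with a letter at either end, is a leading word, if none of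
the halves of the relator contained in it is one already. -/
theorem groebnerD_chain {g : ℕ} {ε : Bool} {c : Letter} (hc : IsLetter g c) (h : ¬ IsLead ε c)
    (h' : ¬ IsLead ε (nxt g ε c)) {s : ℕ} (hs : 1 ≤ s) :
    ∃ r, GroebnerD g ([c] ++ wpow (block g ε c) s ++ [opp c]) r := by
  obtain ⟨j, e⟩ := c
  obtain ⟨h1, h2⟩ := hc
  dsimp only at h1 h2
  unfold IsLead at h h'
  cases ε
  · simp only [Bool.false_eq_true, if_false, Bool.not_eq_false] at h h'
    subst h
    have h3 : 2 ≤ j := by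
      by_contra h3
      obtain rfl : j = 1 := by omega
      simp [nxt] at h'
    rw [block, nxt, if_neg Bool.false_ne_true, if_pos (by dsimp only; omega),
      iterate_false_eq (by omega) (by omega) _ (n := 2 * g - j) (by omega) (by omega),
      show 2 * g + 1 - (2 * g - j) = j + 1 by omega]
    exact ⟨_, GroebnerD.d1 (g := g) j s h3 h2 hs⟩
  · simp only [if_true, Prod.mk.injEq, not_or, not_and, Bool.not_eq_false] at h h'
    have h3 : 2 ≤ j ∧ e = true := by
      cases e
      · have h4 : j = 1 := by
          by_contra h4
          exact absurd (h.2 (by omega)) (by simp)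
        subst h4
        simp only [nxt, if_true] at h'
        rw [if_pos (by omega)] at h'
        exact absurd (h'.2 (by simp)) (by simp)
      · refine ⟨?_, rfl⟩
        by_contra h3
        exact h.1 (by omega) rfl
    obtain ⟨h3, rfl⟩ := h3
    have e1 : block g true (j, true) = asc true (j + 1) (2 * g) ++ asc false 1 (j - 1) := by
      rw [block, nxt, if_pos rfl]
      dsimp only
      split_ifs with h4
      · exact iterate_true_eq (by omega) (by omega) _ (by omega) (by omega)
      · obtain rfl : j = 2 * g := by omega
        rw [iterate_true_eq_asc le_rfl _ _ (by omega), Nat.add_sub_cancel_left]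
        simp [asc]
    rw [e1]
    exact ⟨_, GroebnerD.d2 (g := g) j s h3 h2 hs⟩

theorem wpow_succ (w : List Letter) (s : ℕ) : wpow w (s + 1) = w ++ wpow w s := by
  simp [wpow, List.replicate_succ]

theorem wpow_succ' (w : List Letter) (s : ℕ) : wpow w (s + 1) = wpow w s ++ w := by
  simp [wpow, List.replicate_succ']

theorem iterate_eq_cons_block {g : ℕ} (hg : 2 ≤ g) (ε : Bool) (c : Letter) :
    List.iterate (nxt g ε) c (2 * g) = [c] ++ block g ε c := by
  rw [block, show 2 * g = (2 * g - 1) + 1 by omega]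
  rfl

theorem iterate_nxt_eq_block {g : ℕ} (hg : 2 ≤ g) (ε : Bool) {c : Letter} (hc : IsLetter g c) :
    List.iterate (nxt g ε) (nxt g ε c) (2 * g) = block g ε c ++ [opp c] := by
  rw [block, ← iterate_nxt_two_mul hc ε]
  obtain ⟨n, hn⟩ : ∃ n, 2 * g = n + 1 := ⟨2 * g - 1, by omega⟩
  rw [hn, Nat.add_sub_cancel, list_iterate_succ', ← Function.iterate_succ_apply]

/-- A word that goes along a chain of relators and then crosses the last relator a second time is
not `D`-reduced. -/
theorem not_isDReduced_chain {g : ℕ} (hg : 2 ≤ g) {ε : Bool} {c : Letter} (hc : IsLetter g c)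
    {s : ℕ}
    (hs : 1 ≤ s) : ¬ IsDReduced g ([c] ++ wpow (block g ε c) s ++ [opp c]) := by
  intro h
  obtain ⟨s, rfl⟩ : ∃ t, s = t + 1 := ⟨s - 1, by omega⟩
  by_cases h1 : IsLead ε c
  · obtain ⟨r, hr⟩ := h1.groebnerD hc
    refine h _ r hr ?_
    rw [iterate_eq_cons_block hg, wpow_succ]
    exact ⟨[], wpow (block g ε c) s ++ [opp c], by simp⟩
  by_cases h2 : IsLead ε (nxt g ε c)
  · obtain ⟨r, hr⟩ := h2.groebnerD (hc.nxt ε)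
    refine h _ r hr ?_
    rw [iterate_nxt_eq_block hg ε hc, wpow_succ']
    exact ⟨[c] ++ wpow (block g ε c) s, [], by simp⟩
  obtain ⟨r, hr⟩ := groebnerD_chain hc h1 h2 hs
  exact h _ r hr List.infix_rfl

/-- A word is tight if it does not contain a letter followed by its inverse, and does not go along
more than one half of a relator, or along one half of each relator in a chain and one more letter.
-/
def IsTight (g : ℕ) (w : List Letter) : Prop :=
  (∀ c, IsLetter g c → ¬ [c, opp c] <:+: w) ∧
  ∀ c, IsLetter g c → ∀ ε s, 1 ≤ s → ¬ ([c] ++ wpow (block g ε c) s ++ [opp c]) <:+: w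

theorem IsTight.of_infix {g : ℕ} {u w : List Letter} (hw : IsTight g w) (h : u <:+: w) :
    IsTight g u :=
  ⟨fun c hc hu => hw.1 c hc (hu.trans h), fun c hc ε s hs hu => hw.2 c hc ε s hs (hu.trans h)⟩

theorem IsDReduced.isTight {g : ℕ} (hg : 2 ≤ g) {w : List Letter} (hD : IsDReduced g w) :
    IsTight g w := by
  refine ⟨?_, fun c hc ε s hs h => not_isDReduced_chain hg hc hs (hD.of_infix h)⟩
  rintro ⟨j, _ | _⟩ hc h
  · exact hD _ _ (GroebnerD.d7 j hc.1 hc.2) h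
  · exact hD _ _ (GroebnerD.d8 j hc.1 hc.2) h

/-- A tight word ends with a piece of a chain of relators, and the length of the last piece is
given by `secIdx`. -/
theorem exists_chain {g : ℕ} (hg : 2 ≤ g) (ε : Bool) {a : Letter} {l : List Letter}
    (hw : ∀ b ∈ a :: l, IsLetter g b) (hD : IsTight g (a :: l).reverse) :
    ∃ (c : Letter) (s q : ℕ), IsLetter g c ∧ q ≤ 2 * g - 1 ∧ (q = 0 → s = 0) ∧
      secIdx g ε (a :: l) = q + 1 ∧ a = (nxt g ε)^[q] c ∧
      ([c] ++ wpow (block g ε c) s ++ List.iterate (nxt g ε) (nxt g ε c) q) <:+ (a :: l).reverse :=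
          by
  induction l generalizing a with
  | nil =>
    exact ⟨a, 0, 0, hw a (by simp), by omega, by simp, rfl, rfl, by simp [wpow]⟩
  | cons b l ih =>
    have hpre : (b :: l).reverse <:+: (a :: b :: l).reverse := ⟨[], [a], by simp⟩
    obtain ⟨c, s, q, hc, hq, hqs, hidx, hb, hsuf⟩ :=
      ih (fun x hx => hw x (List.mem_cons_of_mem _ hx)) (hD.of_infix hpre)
    have hrev : (a :: b :: l).reverse = (b :: l).reverse ++ [a] := by simp
    have hsuf' : ∀ u, u <:+ (b :: l).reverse → u ++ [a] <:+ (a :: b :: l).reverse := by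
      rintro u ⟨t, ht⟩
      exact ⟨t, by rw [hrev, ← ht, List.append_assoc]⟩
    rw [secIdx, hidx]
    by_cases h1 : a = nxt g ε b
    · have ha : a = (nxt g ε)^[q + 1] c := by rw [h1, hb, Function.iterate_succ_apply']
      rw [if_pos h1]
      rcases hq.lt_or_eq with hq' | hq'
      · refine ⟨c, s, q + 1, hc, hq', by omega, rfl, ha, ?_⟩
        rw [list_iterate_succ', ← Function.iterate_succ_apply, ← ha, ← List.append_assoc]
        exact hsuf' _ hsuf
      · exfalso
        have e1 : a = opp c := by
          rw [ha, hq', show 2 * g - 1 + 1 = 2 * g by omega, iterate_nxt_two_mul hc]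
        have h2 := hsuf' _ hsuf
        nth_rw 1 [e1] at h2
        rw [hq', ← block, List.append_assoc [c], ← wpow_succ'] at h2
        exact hD.2 c hc ε _ (Nat.le_add_left 1 s) h2.isInfix
    · rw [if_neg h1]
      split_ifs with h2
      · have hq' : q = 2 * g - 1 := by omega
        have e1 : a = nxt g ε c := by
          have e2 : nxt g ε b = opp c := by
            rw [hb, ← Function.iterate_succ_apply' (nxt g ε), hq', show (2 * g - 1).succ = 2 * g by
              omega,
              iterate_nxt_two_mul hc]
          rw [h2.2, e2, nxt_opp, opp_opp]
        refine ⟨c, s + 1, 1, hc, by omega, by omega, rfl, e1, ?_⟩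
        rw [wpow_succ', ← List.append_assoc]
        have h3 := hsuf' _ hsuf
        rw [hq', ← block] at h3
        rw [show List.iterate (nxt g ε) (nxt g ε c) 1 = [a] by rw [e1]; rfl]
        exact h3
      · refine ⟨a, 0, 0, hw a (by simp), by omega, by simp, rfl, rfl, ?_⟩
        exact ⟨(b :: l).reverse, by rw [hrev]; simp [wpow]⟩

theorem secIdx_le {g : ℕ} (hg : 2 ≤ g) (ε : Bool) {a : Letter} {l : List Letter}
    (hw : ∀ b ∈ a :: l, IsLetter g b) (hD : IsTight g (a :: l).reverse) :
    secIdx g ε (a :: l) ≤ 2 * g := by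
  obtain ⟨c, s, q, hc, hq, hqs, hidx, hb, hsuf⟩ := exists_chain hg ε hw hD
  omega

theorem ne_nxt_of_secIdx {g : ℕ} (hg : 2 ≤ g) (ε : Bool) {a b : Letter} {l : List Letter}
    (hw : ∀ c ∈ a :: b :: l, IsLetter g c) (hD : IsTight g (a :: b :: l).reverse)
    (h : secIdx g ε (b :: l) = 2 * g) : a ≠ nxt g ε b := by
  intro h1
  have := secIdx_le hg ε hw hD
  rw [secIdx, if_pos h1] at this
  omega

/-- If a `D`-reduced word ends with one half of a relator, then the other half starts with a letter
for which the former is not a leading word. -/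
theorem not_isLead_of_secIdx {g : ℕ} (hg : 2 ≤ g) (ε : Bool) {a : Letter} {l : List Letter}
    (hw : ∀ c ∈ a :: l, IsLetter g c) (hD : IsDReduced g (a :: l).reverse)
    (h : secIdx g ε (a :: l) = 2 * g) : ¬ IsLead ε (opp (nxt g ε a)) := by
  intro h1
  obtain ⟨c, s, q, hc, hq, hqs, hidx, hb, hsuf⟩ := exists_chain hg ε hw (hD.isTight hg)
  have hq' : q = 2 * g - 1 := by omega
  have e2 : nxt g ε a = opp c := by
    rw [hb, ← Function.iterate_succ_apply' (nxt g ε), hq', show (2 * g - 1).succ = 2 * g by omega,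
      iterate_nxt_two_mul hc]
  rw [e2, opp_opp] at h1
  obtain ⟨r, hr⟩ := h1.groebnerD hc
  rw [hq', ← block, List.append_assoc, ← wpow_succ', wpow_succ, ← List.append_assoc,
    ← iterate_eq_cons_block hg] at hsuf
  exact hD _ r hr ((List.prefix_append _ _).isInfix.trans hsuf.isInfix)

theorem IsTight.ne_opp {g : ℕ} {a b : Letter} {l : List Letter} (hb : IsLetter g b)
    (hD : IsTight g (a :: b :: l).reverse) : a ≠ opp b := by
  rintro rfl
  exact hD.1 b hb ⟨l.reverse, [], by simp⟩

/-! ### Words as elements of the group -/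

/-- The element of the group that is represented by a word. -/
def wordElt (g : ℕ) (w : List Letter) : SL(2, ℝ) := (w.map (letterElt g)).prod

@[simp] theorem wordElt_nil (g : ℕ) : wordElt g [] = 1 := rfl

@[simp] theorem wordElt_append (g : ℕ) (u v : List Letter) :
    wordElt g (u ++ v) = wordElt g u * wordElt g v := by
  simp [wordElt]

@[simp] theorem wordElt_cons (g : ℕ) (a : Letter) (v : List Letter) :
    wordElt g (a :: v) = letterElt g a * wordElt g v := by
  simp [wordElt]

theorem wordElt_wpow (g : ℕ) (u : List Letter) (s : ℕ) :
    wordElt g (wpow u s) = wordElt g u ^ s := by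
  induction s with
  | zero => rfl
  | succ s ih => rw [wpow_succ, wordElt_append, ih, pow_succ']

theorem wordElt_reverse_opp (g : ℕ) (u : List Letter) :
    wordElt g (u.reverse.map opp) = (wordElt g u)⁻¹ := by
  induction u with
  | nil => simp
  | cons a u ih =>
    rw [List.reverse_cons, List.map_append, wordElt_append, ih]
    simp [letterElt_opp]

/-- The interior of the fundamental polygon. -/
def InPoly (g : ℕ) (z : ℍ) : Prop := ∀ a, IsLetter g a → 0 < side g a (lor z)

theorem inPoly_I {g : ℕ} (hg : 2 ≤ g) : InPoly g UpperHalfPlane.I := by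
  intro a _
  rw [side, lor_I, sideAt, dco]
  simpa using sideS_pos hg

/-- The position, relative to the polygon at the end of a tight path, of a point of the polygon at
its beginning. -/
theorem IsTight.sec {g : ℕ} (hg : 2 ≤ g) {z : ℍ} (hz : InPoly g z) {a : Letter} {l : List Letter}
    (hw : ∀ b ∈ a :: l, IsLetter g b) (hD : IsTight g (a :: l).reverse) (ε : Bool) :
    Sec g (secIdx g ε (a :: l))
      (side g (opp a) (lor ((wordElt g (a :: l).reverse)⁻¹ • z)))
      (side g (nxt g ε a) (lor ((wordElt g (a :: l).reverse)⁻¹ • z))) := by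
  induction l generalizing a ε with
  | nil =>
    have ha : IsLetter g a := hw a (by simp)
    have e : wordElt g [a].reverse = letterElt g a := by simp
    rw [e, lor_smul, side_opp_lact_inv hg, side_nxt_lact_inv hg ha]
    exact Sec.one hg (hz a ha) (hz _ (ha.nxt _).opp)
  | cons b l ih =>
    have hpre : (b :: l).reverse <:+: (a :: b :: l).reverse := ⟨[], [a], by simp⟩
    have hw' : ∀ x ∈ b :: l, IsLetter g x := fun x hx => hw x (List.mem_cons_of_mem _ hx)
    have hD' := hD.of_infix hpre
    have hb : IsLetter g b := hw' b (by simp)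
    have e : (wordElt g (a :: b :: l).reverse)⁻¹ • z =
        (letterElt g a)⁻¹ • (wordElt g (b :: l).reverse)⁻¹ • z := by
      rw [← mul_smul, ← mul_inv_rev]
      simp [mul_assoc]
    rw [e]
    exact Sec.step hg hb (hw a (by simp)) (r := fun ε => secIdx g ε (b :: l))
      (fun ε => one_le_secIdx g ε b l) (fun ε => secIdx_le hg ε hw' hD')
      (fun ε => ih hw' hD' ε) (hD.ne_opp hb) (fun ε h => ne_nxt_of_secIdx hg ε hw hD h) ε

/-- A point of the polygon at the beginning of a tight path stays beyond the side crossed last. -/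
theorem IsTight.side_neg {g : ℕ} (hg : 2 ≤ g) {z : ℍ} (hz : InPoly g z) {a : Letter}
    {l : List Letter}
    (hw : ∀ b ∈ a :: l, IsLetter g b) (hD : IsTight g (a :: l).reverse) :
    side g (opp a) (lor ((wordElt g (a :: l).reverse)⁻¹ • z)) < 0 :=
  (hD.sec hg hz hw true).neg hg (one_le_secIdx _ _ _ _) (secIdx_le hg _ hw hD)

/-- Beyond a second side, a point of the polygon at the beginning of a tight path can only be if the
path has run along one half of a relator, and this side is the next one at the same vertex. -/
theorem eq_nxt_of_side_neg {g : ℕ} (hg : 2 ≤ g) {z : ℍ} (hz : InPoly g z) {a b : Letter}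
    {l : List Letter} (hw : ∀ b ∈ a :: l, IsLetter g b) (hD : IsTight g (a :: l).reverse)
    (hb : IsLetter g b) (hba : b ≠ opp a)
    (h : side g b (lor ((wordElt g (a :: l).reverse)⁻¹ • z)) < 0) :
    ∃ ε, b = nxt g ε a ∧ secIdx g ε (a :: l) = 2 * g := by
  by_cases h1 : ∃ ε, b = nxt g ε a
  · obtain ⟨ε, rfl⟩ := h1
    refine ⟨ε, rfl, (secIdx_le hg ε hw hD).eq_of_not_lt fun h2 => ?_⟩
    exact h.not_gt ((hD.sec hg hz hw ε).pos hg (one_le_secIdx _ _ _ _) h2)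
  · push Not at h1
    exact absurd (side_pos_of_behind hg (hw a (by simp)) hb hba h1 (hD.side_neg hg hz hw).le)
      h.not_gt

/-- `D`-reduced words that represent the same element are equal. -/
theorem IsDReduced.eq_of_wordElt_eq {g : ℕ} (hg : 2 ≤ g) {u v : List Letter}
    (hu : ∀ b ∈ u, IsLetter g b) (hv : ∀ b ∈ v, IsLetter g b) (hDu : IsDReduced g u)
    (hDv : IsDReduced g v) (h : wordElt g u = wordElt g v) : u = v := by
  -- the argument is by induction on the reversed words
  suffices H : ∀ l k : List Letter, (∀ b ∈ l, IsLetter g b) → (∀ b ∈ k, IsLetter g b) →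
      IsDReduced g l.reverse → IsDReduced g k.reverse → wordElt g l.reverse = wordElt g k.reverse →
      l = k by
    have := H u.reverse v.reverse (by simpa using hu) (by simpa using hv) (by simpa using hDu)
      (by simpa using hDv) (by simpa using h)
    simpa using this
  clear! u v
  have hne : ∀ (a : Letter) (l : List Letter), (∀ b ∈ a :: l, IsLetter g b) →
      IsDReduced g (a :: l).reverse → wordElt g (a :: l).reverse ≠ 1 := by
    intro a l hw hD h1
    have h2 := (hD.isTight hg).side_neg hg (inPoly_I hg) hw
    rw [h1, inv_one, one_smul] at h2
    exact h2.not_gt (inPoly_I hg _ (hw a (by simp)).opp)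
  intro l
  induction l with
  | nil =>
    rintro (_ | ⟨b, k⟩) - hk - hDk h
    · rfl
    · exact absurd h.symm (hne b k hk hDk)
  | cons a l ih =>
    rintro (_ | ⟨b, k⟩) hl hk hDl hDk h
    · exact absurd h (hne a l hl hDl)
    by_cases hab : a = b
    · subst hab
      rw [ih k (fun x hx => hl x (List.mem_cons_of_mem _ hx))
        (fun x hx => hk x (List.mem_cons_of_mem _ hx))
        (hDl.of_infix ⟨[], [a], by simp⟩) (hDk.of_infix ⟨[], [a], by simp⟩) (by simpa using h)]
    exfalso
    have ha := hl a (by simp)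
    have hb := hk b (by simp)
    have n1 := (hDk.isTight hg).side_neg hg (inPoly_I hg) hk
    have n2 := (hDl.isTight hg).side_neg hg (inPoly_I hg) hl
    rw [← h] at n1
    rw [h] at n2
    have hab' : opp a ≠ opp b := fun h' => hab (opp_injective h')
    obtain ⟨ε, e1, r1⟩ := eq_nxt_of_side_neg hg (inPoly_I hg) hl (hDl.isTight hg) hb.opp hab'.symm
      n1
    obtain ⟨ε', e2, r2⟩ := eq_nxt_of_side_neg hg (inPoly_I hg) hk (hDk.isTight hg) ha.opp hab' n2
    have l1 := not_isLead_of_secIdx hg ε hl hDl r1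
    have l2 := not_isLead_of_secIdx hg ε' hk hDk r2
    rw [← e1, opp_opp] at l1
    rw [← e2, opp_opp] at l2
    have hεε' : ε' = !ε := by
      have h3 : ε' = ε ∨ ε' = !ε := by cases ε <;> cases ε' <;> simp
      rcases h3 with rfl | h3
      · exfalso
        have e3 := congrArg opp e2
        rw [opp_opp, ← nxt_opp, e1] at e3
        exact nxt_nxt_ne hg ha ε' e3.symm
      · exact h3
    subst hεε'
    have e3 : a = nxt g (!ε) (opp b) := by rw [nxt_opp, ← e2, opp_opp]
    obtain ⟨j, e⟩ := b
    have hb1 := hb.1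
    have hb2 := hb.2
    dsimp only at hb1 hb2
    rw [e3] at l2
    cases ε
    · have he : e = true := by simpa [IsLead] using l1
      subst he
      refine l2 ?_
      rw [Bool.not_false, IsLead, if_pos rfl, nxt, if_pos rfl]
      by_cases h5 : j < 2 * g
      · rw [if_pos (by exact h5)]
        exact Or.inr ⟨Nat.succ_le_succ hb1, rfl⟩
      · rw [if_neg (by exact h5)]
        exact Or.inl rfl
    · refine l2 ?_
      rw [Bool.not_true, IsLead, if_neg Bool.false_ne_true, nxt, if_neg Bool.false_ne_true]
      cases e
      · have h5 : ¬ 1 < j := fun h5 => l1 (by rw [IsLead, if_pos rfl]; exact Or.inr ⟨h5, rfl⟩)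
        rw [if_neg (by exact h5)]
        rfl
      · have h5 : 1 < j := by
          by_contra h5
          obtain rfl : j = 1 := by omega
          exact l1 (by rw [IsLead, if_pos rfl]; exact Or.inl rfl)
        rw [if_pos (by exact h5)]
        rfl

/-! ### The relator -/

theorem rotM_pow_coe (g n : ℕ) : ((rotM g ^ n : SL(2, ℝ)) : Matrix (Fin 2) (Fin 2) ℝ) =
    !![Real.cos (n * ((2 * g - 1) * Real.pi / (4 * g))),
      Real.sin (n * ((2 * g - 1) * Real.pi / (4 * g)));
      -Real.sin (n * ((2 * g - 1) * Real.pi / (4 * g))),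
      Real.cos (n * ((2 * g - 1) * Real.pi / (4 * g)))] := by
  induction n with
  | zero =>
    ext i j
    fin_cases i <;> fin_cases j <;> simp
  | succ n ih =>
    rw [pow_succ, Matrix.SpecialLinearGroup.coe_mul, ih]
    push_cast
    rw [add_mul, one_mul, Real.cos_add, Real.sin_add]
    ext i j
    fin_cases i <;> fin_cases j <;> simp [rotM, Matrix.mul_apply, Fin.sum_univ_two] <;> ring

/-- Powers of a matrix with determinant `1` and trace `2 cos x`. -/
theorem sin_smul_pow (A : Matrix (Fin 2) (Fin 2) ℝ) (x : ℝ) (hdet : A.det = 1)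
    (htr : A 0 0 + A 1 1 = 2 * Real.cos x) (n : ℕ) :
    Real.sin x • A ^ (n + 1) = Real.sin ((n + 1) * x) • A - Real.sin (n * x) • 1 := by
  rw [Matrix.det_fin_two] at hdet
  have hsq : A * A = (2 * Real.cos x) • A - 1 := by
    rw [← htr]
    ext i j
    fin_cases i <;> fin_cases j <;> simp [Matrix.mul_apply, Fin.sum_univ_two]
    · linear_combination -hdet
    · ring
    · ring
    · linear_combination -hdet
  induction n with
  | zero => simp
  | succ n ih =>
    rw [pow_succ, ← Matrix.smul_mul, ih, Matrix.sub_mul, Matrix.smul_mul, Matrix.smul_mul, hsq,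
      Matrix.one_mul]
    push_cast
    have h1 : Real.sin ((n + 1 + 1) * x) = 2 * Real.cos x * Real.sin ((n + 1) * x) - Real.sin
        (n * x) := by
      rw [show ((n : ℝ) + 1 + 1) * x = (n + 1) * x + x by ring,
        show (n : ℝ) * x = (n + 1) * x - x by ring, Real.sin_add, Real.sin_sub]
      ring
    rw [h1]
    module

theorem wordElt_asc_eq (g n : ℕ) :
    wordElt g (asc true 1 n) = ((rotM g)⁻¹ * transQ g) ^ n * rotM g ^ n := by
  induction n with
  | zero => simp [asc]
  | succ n ih =>
    have e : asc true 1 (n + 1) = asc true 1 n ++ [(n + 1, true)] := by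
      simp [asc, List.range'_1_concat, add_comm]
    rw [e, wordElt_append, ih]
    simp only [wordElt_cons, wordElt_nil, letterElt, if_true, delta, mul_one]
    rw [pow_succ (_ * _) n, inv_pow, pow_succ]
    group

theorem wordElt_desc_eq (g n : ℕ) :
    wordElt g (desc true n 1) = (rotM g)⁻¹ ^ n * (transQ g * rotM g) ^ n := by
  induction n with
  | zero => simp [desc, asc]
  | succ n ih =>
    have e : desc true (n + 1) 1 = [(n + 1, true)] ++ desc true n 1 := by
      simp [desc, asc, List.range'_1_concat, add_comm]
    rw [e, wordElt_append, ih]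
    simp only [wordElt_cons, wordElt_nil, letterElt, if_true, delta, mul_one]
    rw [pow_succ' (_ * _) n, pow_succ' (rotM g) n, inv_pow, inv_pow, pow_succ' (rotM g) n]
    simp only [mul_assoc, mul_inv_rev, mul_inv_cancel_left]

/-- The relation `c_1 ⋯ c_{2g} = c_{2g} ⋯ c_1` holds in the group: the matrices `Q M` and `M⁻¹ Q`
have the trace `2 cos (π / 4g)`, so that their powers with exponent `2g` are known. -/
theorem wordElt_asc_eq_desc {g : ℕ} (hg : 2 ≤ g) :
    wordElt g (asc true 1 (2 * g)) = wordElt g (desc true (2 * g) 1) := by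
  have hg0 : (g : ℝ) ≠ 0 := by positivity
  set x : ℝ := stepAngle g / 2 with hx
  have hs : Real.sin x ≠ 0 := (sin_half_pos hg).ne'
  have hgx : 2 * g * x = Real.pi / 2 := by
    rw [hx, ← mul_stepAngle hg]; ring
  have hβ : (2 * (g : ℝ) - 1) * Real.pi / (4 * g) = Real.pi / 2 - x := by
    rw [hx, ← pi_div_eq]
    field_simp
    ring
  have hcβ : Real.cos ((2 * (g : ℝ) - 1) * Real.pi / (4 * g)) = Real.sin x := by
    rw [hβ, Real.cos_pi_div_two_sub]
  have htr : (stretch g + (stretch g)⁻¹) * Real.sin x = 2 * Real.cos x := by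
    rw [stretch_inv_eq hg, stretch_eq, sideC, pi_div_eq, ← hx]
    field_simp
    ring
  have hM : (rotM g).1 = !![Real.sin x, Real.sin ((2 * (g : ℝ) - 1) * Real.pi / (4 * g));
      -Real.sin ((2 * (g : ℝ) - 1) * Real.pi / (4 * g)), Real.sin x] := by
    rw [← hcβ]; rfl
  have hMi : ((rotM g)⁻¹).1 = !![Real.sin x, -Real.sin ((2 * (g : ℝ) - 1) * Real.pi / (4 * g));
      Real.sin ((2 * (g : ℝ) - 1) * Real.pi / (4 * g)), Real.sin x] := by
    rw [Matrix.SpecialLinearGroup.coe_inv, hM, Matrix.adjugate_fin_two_of, neg_neg]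
  have hQ : (transQ g).1 = !![stretch g, 0; 0, (stretch g)⁻¹] := congrArg Subtype.val (dif_pos hg)
  generalize Real.sin ((2 * (g : ℝ) - 1) * Real.pi / (4 * g)) = σ at hM hMi
  -- the power `M ^ (2g)` is `± J`, where `J` is the rotation by a right angle
  obtain ⟨τ, hJ⟩ : ∃ τ : ℝ, (rotM g ^ (2 * g)).1 = !![0, τ; -τ, 0] := by
    refine ⟨Real.sin ((2 * g : ℕ) * ((2 * g - 1) * Real.pi / (4 * g))),
      (rotM_pow_coe g (2 * g)).trans ?_⟩
    have e1 :
        ((2 * g : ℕ) : ℝ) * ((2 * g - 1) * Real.pi / (4 * g)) = g * Real.pi - Real.pi / 2 := by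
      push_cast
      field_simp
      ring
    rw [e1, Real.cos_sub_pi_div_two, Real.sin_nat_mul_pi]
  have hJi : ((rotM g)⁻¹ ^ (2 * g)).1 = !![0, -τ; τ, 0] := by
    rw [inv_pow, Matrix.SpecialLinearGroup.coe_inv, hJ, Matrix.adjugate_fin_two_of, neg_neg]
  have hpow : ∀ A : SL(2, ℝ), A.1 0 0 + A.1 1 1 = 2 * Real.cos x →
      Real.sin x • (A ^ (2 * g)).1 = A.1 - Real.cos x • 1 := by
    intro A hA
    have h := sin_smul_pow A.1 x A.2 hA (2 * g - 1)
    have e2 : 2 * g - 1 + 1 = 2 * g := by omega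
    have e3 : ((2 * g - 1 : ℕ) : ℝ) + 1 = 2 * g := by exact_mod_cast e2
    have e4 : ((2 * g - 1 : ℕ) : ℝ) * x = Real.pi / 2 - x := by
      rw [← hgx]; linear_combination x * e3
    rw [e2, e3, hgx, e4, Real.sin_pi_div_two, Real.sin_pi_div_two_sub, one_smul] at h
    rw [← h]
    exact congrArg _ (Matrix.SpecialLinearGroup.coe_pow _ _)
  have h1 := hpow (transQ g * rotM g) (by
    rw [Matrix.SpecialLinearGroup.coe_mul, hQ, hM, ← htr]
    simp [Matrix.mul_apply, Fin.sum_univ_two]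
    ring)
  have h2 := hpow ((rotM g)⁻¹ * transQ g) (by
    rw [Matrix.SpecialLinearGroup.coe_mul, hQ, hMi, ← htr]
    simp [Matrix.mul_apply, Fin.sum_univ_two]
    ring)
  rw [wordElt_asc_eq, wordElt_desc_eq]
  apply Subtype.ext
  have hinj : Function.Injective fun B : Matrix (Fin 2) (Fin 2) ℝ => Real.sin x • B :=
    smul_right_injective _ hs
  apply hinj
  dsimp only
  rw [Matrix.SpecialLinearGroup.coe_mul, Matrix.SpecialLinearGroup.coe_mul, ← Matrix.smul_mul,
    ← Matrix.mul_smul, h1, h2, hJ, hJi, Matrix.SpecialLinearGroup.coe_mul,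
    Matrix.SpecialLinearGroup.coe_mul, hQ, hM, hMi]
  ext i j
  fin_cases i <;> fin_cases j <;> simp [Matrix.mul_apply, Fin.sum_univ_two]
  · ring
  · linear_combination τ * htr
  · linear_combination -τ * htr
  · ring

/-- Every rotation of the relator and of its inverse represents the identity. -/
theorem wordElt_relator {g : ℕ} (hg : 2 ≤ g) (ε : Bool) {c : Letter} (hc : IsLetter g c) :
    wordElt g (List.iterate (nxt g ε) c (2 * g + 2 * g)) = 1 := by
  have hshift : ∀ c, IsLetter g c → wordElt g (List.iterate (nxt g ε) c (2 * g + 2 * g)) = 1 →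
      ∀ n, wordElt g (List.iterate (nxt g ε) ((nxt g ε)^[n] c) (2 * g + 2 * g)) = 1 := by
    intro c hc h n
    induction n with
    | zero => exact h
    | succ n ih =>
      obtain ⟨hc', -⟩ := iterate_nxt_fst hc ε n
      rw [Function.iterate_succ_apply']
      generalize (nxt g ε)^[n] c = b at ih hc'
      have e1 : List.iterate (nxt g ε) b (2 * g + 2 * g + 1) =
          b :: List.iterate (nxt g ε) (nxt g ε b) (2 * g + 2 * g) := rfl
      have e2 := list_iterate_succ' (nxt g ε) b (2 * g + 2 * g)
      rw [Function.iterate_add_apply, iterate_nxt_two_mul hc', iterate_nxt_two_mul hc'.opp,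
        opp_opp, e1] at e2
      have e3 := congrArg (wordElt g) e2
      rw [wordElt_cons, wordElt_append, ih, one_mul, wordElt_cons, wordElt_nil] at e3
      exact mul_left_cancel e3
  have hinv : ∀ (e : Bool) (a b : ℕ), wordElt g (asc (!e) a b) = (wordElt g (desc e b a))⁻¹ := by
    intro e a b
    rw [← wordElt_reverse_opp, desc, List.reverse_reverse, asc, asc, List.map_map]
    rfl
  have hinv' : ∀ (e : Bool) (a b : ℕ), wordElt g (desc (!e) b a) = (wordElt g (asc e a b))⁻¹ := by
    intro e a b
    rw [← wordElt_reverse_opp, ← List.map_reverse.symm, desc, asc, asc, List.map_map]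
    rfl
  have hrel := wordElt_asc_eq_desc hg
  obtain ⟨j, e⟩ := c
  obtain ⟨hj1, hj2⟩ := hc
  dsimp only at hj1 hj2
  cases ε
  · have base : wordElt g (List.iterate (nxt g false) (2 * g, true) (2 * g + 2 * g)) = 1 := by
      rw [iterate_false_eq (by omega) le_rfl _ le_rfl rfl, wordElt_append, hinv',
        Nat.add_sub_cancel_left, hrel, mul_inv_cancel]
    have hl : IsLetter g (2 * g, true) := ⟨by dsimp only; omega, le_rfl⟩
    have hn := hshift _ hl base
    have e1 : (nxt g false)^[2 * g - j] (2 * g, true) = (j, true) := by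
      rw [iterate_nxt_false _ _ _ (by omega)]
      congr 1
      omega
    cases e
    · have e2 := hn (2 * g + (2 * g - j))
      rw [Function.iterate_add_apply, e1, iterate_nxt_two_mul ⟨hj1, hj2⟩] at e2
      exact e2
    · have e2 := hn (2 * g - j)
      rwa [e1] at e2
  · have base : wordElt g (List.iterate (nxt g true) (1, true) (2 * g + 2 * g)) = 1 := by
      rw [iterate_true_eq le_rfl (by omega) _ le_rfl (by omega), wordElt_append, hinv, hrel,
        mul_inv_cancel]
    have hl : IsLetter g (1, true) := ⟨le_rfl, by dsimp only; omega⟩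
    have hn := hshift _ hl base
    have e1 : (nxt g true)^[j - 1] (1, true) = (j, true) := by
      rw [iterate_nxt_true _ _ _ (by omega)]
      congr 1
      omega
    cases e
    · have e2 := hn (2 * g + (j - 1))
      rw [Function.iterate_add_apply, e1, iterate_nxt_two_mul ⟨hj1, hj2⟩] at e2
      exact e2
    · have e2 := hn (j - 1)
      rwa [e1] at e2

/-- The letters at the ends of a chain can be removed. -/
theorem wordElt_chain {g : ℕ} (hg : 2 ≤ g) (ε : Bool) {c : Letter} (hc : IsLetter g c) (s : ℕ) :
    wordElt g ([c] ++ wpow (block g ε c) s ++ [opp c]) =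
      wordElt g (wpow ((block g ε (opp c)).reverse.map opp) s) := by
  have h := wordElt_relator hg ε hc
  rw [list_iterate_add, iterate_nxt_two_mul hc, iterate_eq_cons_block hg, iterate_eq_cons_block hg]
    at h
  simp only [wordElt_append, wordElt_cons, wordElt_nil, mul_one, letterElt_opp] at h
  simp only [wordElt_append, wordElt_wpow, wordElt_cons, wordElt_nil, mul_one, letterElt_opp,
    wordElt_reverse_opp]
  rw [← conj_pow]
  congr 1
  exact eq_inv_of_mul_eq_one_left (by rw [mul_assoc]; exact h)

/-! ### The group is discrete and acts freely -/

theorem letterElt_mem {g : ℕ} {a : Letter} (ha : IsLetter g a) : letterElt g a ∈ Gam g := by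
  have h : delta g a.1 ∈ Gam g := Subgroup.subset_closure ⟨a.1, ha.1, ha.2, rfl⟩
  unfold letterElt
  split_ifs
  · exact h
  · exact inv_mem h

theorem wordElt_mem {g : ℕ} {w : List Letter} (hw : ∀ a ∈ w, IsLetter g a) :
    wordElt g w ∈ Gam g := by
  induction w with
  | nil => exact one_mem _
  | cons a w ih =>
    rw [wordElt_cons]
    exact mul_mem (letterElt_mem (hw a (by simp))) (ih fun b hb => hw b (by simp [hb]))

theorem exists_wordElt_eq {g : ℕ} {γ : SL(2, ℝ)} (hγ : γ ∈ Gam g) :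
    ∃ w : List Letter, (∀ a ∈ w, IsLetter g a) ∧ wordElt g w = γ := by
  induction hγ using Subgroup.closure_induction with
  | mem x hx =>
    obtain ⟨j, h1, h2, rfl⟩ := hx
    exact ⟨[(j, true)], by simpa [IsLetter] using ⟨h1, h2⟩, by simp [letterElt]⟩
  | one => exact ⟨[], by simp, rfl⟩
  | mul x y _ _ hx hy =>
    obtain ⟨u, hu, rfl⟩ := hx
    obtain ⟨v, hv, rfl⟩ := hy
    refine ⟨u ++ v, fun a ha => ?_, wordElt_append g u v⟩
    rcases List.mem_append.1 ha with h | h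
    exacts [hu a h, hv a h]
  | inv x _ hx =>
    obtain ⟨u, hu, rfl⟩ := hx
    refine ⟨u.reverse.map opp, fun a ha => ?_, wordElt_reverse_opp g u⟩
    obtain ⟨b, hb, rfl⟩ := List.mem_map.1 ha
    exact (hu b (List.mem_reverse.1 hb)).opp

theorem isLetter_of_mem_block {g : ℕ} {ε : Bool} {c b : Letter} (hc : IsLetter g c)
    (hb : b ∈ block g ε c) : IsLetter g b := by
  unfold block at hb
  rw [List.mem_iff_getElem] at hb
  obtain ⟨i, hi, rfl⟩ := hb
  rw [List.getElem_iterate]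
  exact (iterate_nxt_fst (hc.nxt ε) ε i).1

theorem mem_of_mem_wpow {w : List Letter} {s : ℕ} {b : Letter} (hb : b ∈ wpow w s) : b ∈ w := by
  unfold wpow at hb
  obtain ⟨l, hl, hbl⟩ := List.mem_flatten.1 hb
  rwa [List.eq_of_mem_replicate hl] at hbl

theorem length_wpow (w : List Letter) (s : ℕ) : (wpow w s).length = s * w.length := by
  simp [wpow]

/-- A word that is not tight can be shortened. -/
theorem exists_shorter {g : ℕ} (hg : 2 ≤ g) {w : List Letter} (hw : ∀ a ∈ w, IsLetter g a)
    (h : ¬ IsTight g w) : ∃ v : List Letter, (∀ a ∈ v, IsLetter g a) ∧ v.length < w.length ∧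
      wordElt g v = wordElt g w := by
  unfold IsTight at h
  rw [not_and_or] at h
  push Not at h
  rcases h with ⟨c, hc, p, q, rfl⟩ | ⟨c, hc, ε, s, hs, p, q, rfl⟩
  · refine ⟨p ++ q, fun a ha => hw a ?_, by simp, by simp [letterElt_opp]⟩
    simp only [List.mem_append] at ha ⊢
    tauto
  · refine ⟨p ++ wpow ((block g ε (opp c)).reverse.map opp) s ++ q, fun a ha => ?_, ?_, ?_⟩
    · simp only [List.mem_append] at ha
      rcases ha with (ha | ha) | ha
      · exact hw a (by simp [ha])
      · have := mem_of_mem_wpow ha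
        obtain ⟨b, hb, rfl⟩ := List.mem_map.1 this
        exact (isLetter_of_mem_block hc.opp (List.mem_reverse.1 hb)).opp
      · exact hw a (by simp [ha])
    · simp [length_wpow, block]
    · rw [wordElt_append, wordElt_append, ← wordElt_chain hg ε hc]
      simp only [wordElt_append]

theorem exists_tight {g : ℕ} (hg : 2 ≤ g) {γ : SL(2, ℝ)} (hγ : γ ∈ Gam g) :
    ∃ w : List Letter, (∀ a ∈ w, IsLetter g a) ∧ IsTight g w ∧ wordElt g w = γ := by
  obtain ⟨w, ⟨hw, e⟩, hmin⟩ := WellFounded.has_min (measure List.length).wf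
    {w : List Letter | (∀ a ∈ w, IsLetter g a) ∧ wordElt g w = γ} (exists_wordElt_eq hγ)
  refine ⟨w, hw, ?_, e⟩
  by_contra h
  obtain ⟨v, hv, hlt, hvw⟩ := exists_shorter hg hw h
  exact hmin v ⟨hv, hvw.trans e⟩ hlt

theorem exists_side_neg_of_tight {g : ℕ} (hg : 2 ≤ g) {w : List Letter}
    (hw : ∀ a ∈ w, IsLetter g a) (hD : IsTight g w) (hne : w ≠ []) {z : ℍ} (hz : InPoly g z) :
    ∃ b, IsLetter g b ∧ side g b (lor ((wordElt g w)⁻¹ • z)) < 0 := by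
  obtain ⟨l, rfl⟩ : ∃ l, w = List.reverse l := ⟨w.reverse, by simp⟩
  obtain - | ⟨a, l⟩ := l
  · simp at hne
  have hw' : ∀ b ∈ a :: l, IsLetter g b := fun b hb => hw b (List.mem_reverse.2 hb)
  exact ⟨opp a, (hw' a (by simp)).opp, hD.side_neg hg hz hw'⟩

/-- The translates of the polygon by different elements of the group do not overlap. -/
theorem exists_side_neg {g : ℕ} (hg : 2 ≤ g) {γ : SL(2, ℝ)} (hγ : γ ∈ Gam g) (h1 : γ ≠ 1) {z : ℍ}
    (hz : InPoly g z) : ∃ b, IsLetter g b ∧ side g b (lor (γ • z)) < 0 := by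
  obtain ⟨w, hw, hD, e⟩ := exists_tight hg (inv_mem hγ)
  have hne : w ≠ [] := by
    rintro rfl
    exact h1 (by rw [← inv_inv γ, ← e]; simp)
  have := exists_side_neg_of_tight hg hw hD hne hz
  rwa [e, inv_inv] at this

theorem sideC_le_of_side_neg {g : ℕ} (hg : 2 ≤ g) {a : Letter} {z : ℍ} (h : side g a (lor z) ≤ 0) :
    sideC g ≤ (lor z).1 := by
  have hC := sideC_pos hg
  have hS := sideS_pos hg
  have h1 := sideC_sq_sub hg
  have hT := lor_fst_pos z
  have h2 := lor_sq z
  have t1 := Real.sin_sq_add_cos_sq (ang g a)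
  simp only [side, sideAt, dco] at h
  generalize Real.sin (ang g a) = s at *
  generalize Real.cos (ang g a) = c at *
  generalize sideS g = S at *
  generalize sideC g = C at *
  generalize (lor z).1 = T at *
  generalize (lor z).2.1 = X at *
  generalize (lor z).2.2 = Y at *
  have h3 : (c * X + s * Y) ^ 2 ≤ T ^ 2 - 1 := by
    nlinarith [sq_nonneg (c * Y - s * X)]
  have h4 : (S * T) ^ 2 ≤ (C * (c * X + s * Y)) ^ 2 := by
    apply pow_le_pow_left₀ (by positivity)
    linarith
  have h5 : C ^ 2 ≤ T ^ 2 := by nlinarith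
  nlinarith

theorem one_lt_sideC {g : ℕ} (hg : 2 ≤ g) : 1 < sideC g := by
  have hC := sideC_pos hg
  have hS := sideS_pos hg
  have h1 := sideC_sq_sub hg
  nlinarith

/-- The orbit of `i` is separated. -/
theorem sideC_le_cosh_dist {g : ℕ} (hg : 2 ≤ g) {γ : SL(2, ℝ)} (hγ : γ ∈ Gam g) (h1 : γ ≠ 1) :
    sideC g ≤ Real.cosh (dist (γ • UpperHalfPlane.I) UpperHalfPlane.I) := by
  obtain ⟨b, hb, h⟩ := exists_side_neg hg hγ h1 (inPoly_I hg)
  have h2 := sideC_le_of_side_neg hg h.le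
  rw [cosh_dist_eq_lprod, lor_I]
  simpa [lprod] using h2

theorem finite_orbit {g : ℕ} (hg : 2 ≤ g) (R : ℝ) :
    {γ : SL(2, ℝ) | γ ∈ Gam g ∧ dist (γ • UpperHalfPlane.I) UpperHalfPlane.I ≤ R}.Finite := by
  by_contra hinf
  have hinj : Set.InjOn (fun γ : SL(2, ℝ) => γ • UpperHalfPlane.I)
      {γ : SL(2, ℝ) | γ ∈ Gam g ∧ dist (γ • UpperHalfPlane.I) UpperHalfPlane.I ≤ R} := by
    intro γ hγ γ' hγ' h
    by_contra hne
    have h1 : γ'⁻¹ * γ ≠ 1 := fun h1 => hne (inv_mul_eq_one.1 h1).symm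
    have h2 := sideC_le_cosh_dist hg (mul_mem (inv_mem hγ'.1) hγ.1) h1
    have h3 : (γ'⁻¹ * γ) • UpperHalfPlane.I = UpperHalfPlane.I := by
      rw [mul_smul, inv_smul_eq_iff]
      exact h
    rw [h3, dist_self, Real.cosh_zero] at h2
    exact absurd h2 (one_lt_sideC hg).not_ge
  have hinf' := Set.Infinite.image hinj hinf
  obtain ⟨x, hx, hacc⟩ := hinf'.exists_accPt_of_subset_isCompact
    (isCompact_closedBall UpperHalfPlane.I R) (by rintro _ ⟨γ, hγ, rfl⟩; exact hγ.2)
  obtain ⟨c, hc, hc'⟩ : ∃ c : ℝ, 0 < c ∧ Real.cosh c < sideC g := by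
    have h1 : ContinuousAt Real.cosh 0 := Real.continuous_cosh.continuousAt
    have h2 : ∀ᶠ t in nhds (0 : ℝ), Real.cosh t < sideC g :=
      h1.eventually_lt_const (by rw [Real.cosh_zero]; exact one_lt_sideC hg)
    obtain ⟨δ, hδ, h3⟩ := Metric.eventually_nhds_iff.1 h2
    exact ⟨δ / 2, by positivity, h3
      (by rw [Real.dist_eq, sub_zero, abs_of_pos (by positivity)]; linarith)⟩
  -- two distinct orbit points near the accumulation point are too close to each other
  have h4 := accPt_iff_frequently.1 hacc
  obtain ⟨y, ⟨hyx, γ, hγ, rfl⟩, hy⟩ :=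
    (h4.and_eventually (Metric.ball_mem_nhds x (half_pos hc))).exists
  obtain ⟨y', ⟨-, γ', hγ', rfl⟩, hy', hy''⟩ := (h4.and_eventually (Filter.inter_mem
    (Metric.ball_mem_nhds x (half_pos hc)) (Metric.ball_mem_nhds x (dist_pos.2 hyx)))).exists
  dsimp only at hy hy' hy''
  rw [Metric.mem_ball] at hy' hy''
  have h5 : γ' ≠ γ := by
    rintro rfl
    exact lt_irrefl _ hy''
  have h6 : γ⁻¹ * γ' ≠ 1 := fun h6 => h5 (inv_mul_eq_one.1 h6).symm
  have h7 := sideC_le_cosh_dist hg (mul_mem (inv_mem hγ.1) hγ'.1) h6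
  have h8 : dist ((γ⁻¹ * γ') • UpperHalfPlane.I) UpperHalfPlane.I ≤ c := by
    rw [mul_smul, ← dist_smul γ, smul_inv_smul]
    refine (dist_triangle_right _ _ x).trans ?_
    linarith
  have h9 := Real.cosh_le_cosh.2 (by rwa [abs_of_nonneg dist_nonneg, abs_of_pos hc] :
    |dist ((γ⁻¹ * γ') • UpperHalfPlane.I) UpperHalfPlane.I| ≤ |c|)
  linarith

/-! ### Powers of words and fixed points -/

theorem getElem_wpow (w : List Letter) (n i : ℕ) (hi : i < (wpow w n).length)
    (hi' : i % w.length < w.length) : (wpow w n)[i] = w[i % w.length] := by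
  induction n generalizing i with
  | zero => simp [wpow] at hi
  | succ n ih =>
    simp only [wpow_succ, List.getElem_append]
    split_ifs with h
    · simp [Nat.mod_eq_of_lt h]
    · have h1 : i - w.length < (wpow w n).length := by
        rw [length_wpow] at hi ⊢
        rw [Nat.add_mul] at hi
        omega
      have h2 : (i - w.length) % w.length = i % w.length := (Nat.mod_eq_sub_mod (by omega)).symm
      rw [ih (i - w.length) h1 (by rwa [h2])]
      simp only [h2]

/-- A subword of a power of `w` whose first letter does not recur is a subword of a rotation
of `w`. -/
theorem infix_rotate_of_infix_wpow {w t : List Letter} {c : Letter} {n : ℕ} (hc : c ∉ t)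
    (h : c :: t <:+: wpow w n) : ∃ k, c :: t <:+: w.rotate k := by
  obtain ⟨p, q, e⟩ := h
  have hlen := congrArg List.length e
  simp only [List.length_append, List.length_cons] at hlen
  have hget : ∀ i (hi : i < (c :: t).length), ∃ h : (p.length + i) % w.length < w.length,
      (c :: t)[i] = w[(p.length + i) % w.length] := by
    intro i hi
    rw [List.length_cons] at hi
    have hl : (wpow w n).length = n * w.length := length_wpow w n
    have h0 : 0 < w.length := by
      by_contra h0
      have : w.length = 0 := by omega
      rw [this, Nat.mul_zero] at hl
      omega
    refine ⟨Nat.mod_lt _ h0, ?_⟩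
    rw [← getElem_wpow w n (p.length + i) (by omega)]
    simp only [← e]
    rw [List.getElem_append_left (by simp; omega), List.getElem_append_right (by omega)]
    simp
  have hlt : t.length < w.length := by
    by_contra hlt
    have h0 : w.length ≠ 0 := by
      obtain ⟨h, -⟩ := hget 0 (by simp)
      omega
    obtain ⟨h1, e1⟩ := hget 0 (by simp)
    obtain ⟨h2, e2⟩ := hget w.length (by simp; omega)
    have e3 : (p.length + w.length) % w.length = (p.length + 0) % w.length := by simp
    simp only [e3] at e2
    rw [← e1] at e2
    obtain ⟨l, hl⟩ := Nat.exists_eq_succ_of_ne_zero h0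
    simp only [hl] at e2
    simp only [List.getElem_cons_succ, List.getElem_cons_zero] at e2
    exact hc (e2 ▸ List.getElem_mem _)
  refine ⟨p.length, List.IsPrefix.isInfix ?_⟩
  rw [List.prefix_iff_getElem]
  refine ⟨by simpa using hlt, fun i hi => ?_⟩
  obtain ⟨h, e'⟩ := hget i hi
  rw [e', List.getElem_rotate]
  simp only [Nat.add_comm]

theorem mem_asc {ε : Bool} {a b : ℕ} {c : Letter} :
    c ∈ asc ε a b ↔ c.2 = ε ∧ a ≤ c.1 ∧ c.1 ≤ b := by
  obtain ⟨j, e⟩ := c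
  simp only [asc, List.mem_map, List.mem_range'_1, Prod.mk.injEq]
  constructor
  · rintro ⟨i, h, rfl, rfl⟩
    refine ⟨rfl, ?_, ?_⟩ <;> omega
  · rintro ⟨rfl, h1, h2⟩
    exact ⟨j, by omega, rfl, rfl⟩

theorem mem_desc {ε : Bool} {a b : ℕ} {c : Letter} :
    c ∈ desc ε b a ↔ c.2 = ε ∧ a ≤ c.1 ∧ c.1 ≤ b := by
  rw [desc, List.mem_reverse, mem_asc]

theorem nodup_asc (ε : Bool) (a b : ℕ) : (asc ε a b).Nodup :=
  List.Nodup.map (fun _ _ h => congrArg Prod.fst h) List.nodup_range'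

theorem nodup_desc (ε : Bool) (b a : ℕ) : (desc ε b a).Nodup :=
  List.nodup_reverse.2 (nodup_asc ε a b)

theorem exists_cons_of_nodup {α : Type*} {l : List α} (h : l.Nodup) {c : α} (hc : c ∈ l) :
    ∃ c t, l = c :: t ∧ c ∉ t := by
  obtain - | ⟨b, t⟩ := l
  · simp at hc
  · exact ⟨b, t, rfl, (List.nodup_cons.1 h).1⟩

/-- The first letter of a leading word does not recur in it. -/
theorem GroebnerD.exists_cons {g : ℕ} (hg : 2 ≤ g) {l r : List Letter} (h : GroebnerD g l r) :
    ∃ c t, l = c :: t ∧ c ∉ t := by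
  cases h with
  | d1 j s hj hj' hs =>
    refine ⟨_, _, rfl, fun h => ?_⟩
    rcases List.mem_append.1 h with h | h
    · rcases List.mem_append.1 (mem_of_mem_wpow h) with h | h <;> rw [mem_desc] at h
      · dsimp only at h
        omega
      · exact absurd h.1 (by simp)
    · simp at h
  | d2 j s hj hj' hs =>
    refine ⟨_, _, rfl, fun h => ?_⟩
    rcases List.mem_append.1 h with h | h
    · rcases List.mem_append.1 (mem_of_mem_wpow h) with h | h <;> rw [mem_asc] at h
      · dsimp only at h
        omega
      · exact absurd h.1 (by simp)
    · simp at h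
  | d3 =>
    exact exists_cons_of_nodup (nodup_desc _ _ _) (c := (1, false)) (mem_desc.2 ⟨rfl, by simp; omega⟩)
  | d4 =>
    exact exists_cons_of_nodup (nodup_asc _ _ _) (c := (1, true)) (mem_asc.2 ⟨rfl, by simp; omega⟩)
  | d5 i hi hi' =>
    refine exists_cons_of_nodup (List.nodup_append.2 ⟨nodup_asc _ _ _, nodup_asc _ _ _, ?_⟩)
      (c := (i, false)) (List.mem_append_left _ (mem_asc.2 ⟨rfl, le_rfl, hi'⟩))
    intro a ha b hb e
    rw [mem_asc] at ha hb
    rw [e, hb.1] at ha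
    simp at ha
  | d6 i hi hi' =>
    refine exists_cons_of_nodup (List.nodup_append.2 ⟨nodup_desc _ _ _, nodup_desc _ _ _, ?_⟩)
      (c := (i, true)) (List.mem_append_right _ (mem_desc.2 ⟨rfl, le_rfl, hi'⟩))
    intro a ha b hb e
    rw [mem_desc] at ha hb
    rw [e, hb.1] at ha
    simp at ha
  | d7 i hi hi' => exact ⟨_, _, rfl, by simp⟩
  | d8 i hi hi' => exact ⟨_, _, rfl, by simp⟩

theorem IsCyclicallyDReduced.wpow {g : ℕ} (hg : 2 ≤ g) {w : List Letter}
    (h : IsCyclicallyDReduced g w) (n : ℕ) : IsDReduced g (wpow w n) := by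
  intro l r hl hinf
  obtain ⟨c, t, rfl, hc⟩ := hl.exists_cons hg
  obtain ⟨k, hk⟩ := infix_rotate_of_infix_wpow hc hinf
  exact h k _ _ hl hk

theorem opp_ne (a : Letter) : opp a ≠ a := fun h => by
  have := congrArg Prod.snd h
  simp [opp] at this

theorem iterate_nxt_ne {g : ℕ} {c : Letter} (hc : IsLetter g c) (ε : Bool) {n : ℕ} (h0 : 0 < n)
    (h1 : n ≤ 2 * g) : (nxt g ε)^[n] c ≠ c := by
  intro e
  obtain ⟨-, k, hk⟩ := iterate_nxt_fst hc ε n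
  rw [e] at hk
  have hs : sgn ε = 1 ∨ sgn ε = -1 := by cases ε <;> simp [sgn]
  have hdvd : 2 * g ∣ n := by
    zify
    rcases hs with hs | hs <;> rw [hs] at hk
    · exact ⟨n + 2 * k, by linear_combination hk⟩
    · exact ⟨-(n + 2 * k), by linear_combination -hk⟩
  obtain rfl := Nat.le_antisymm h1 (Nat.le_of_dvd h0 hdvd)
  rw [iterate_nxt_two_mul hc] at e
  exact opp_ne c e

theorem not_mem_block {g : ℕ} (hg : 2 ≤ g) {c : Letter} (hc : IsLetter g c) (ε : Bool) :
    c ∉ block g ε c := by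
  intro h
  unfold block at h
  rw [List.mem_iff_getElem] at h
  obtain ⟨i, hi, e⟩ := h
  rw [List.length_iterate] at hi
  rw [List.getElem_iterate, ← Function.iterate_succ_apply] at e
  exact iterate_nxt_ne hc ε (Nat.succ_pos i) (by omega) e

/-- A cancelling pair or a chain begins with a letter that does not recur in it, so it occurs in a
power of `w` only if it occurs in a rotation of `w`. -/
theorem isTight_wpow {g : ℕ} (hg : 2 ≤ g) {w : List Letter} (h : ∀ k, IsTight g (w.rotate k))
    (n : ℕ) : IsTight g (wpow w n) := by
  constructor
  · intro c hc hinf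
    obtain ⟨k, hk⟩ := infix_rotate_of_infix_wpow (by simpa using (opp_ne c).symm) hinf
    exact (h k).1 c hc hk
  · intro c hc ε s hs hinf
    rw [List.append_assoc, List.singleton_append] at hinf
    have hne : c ∉ wpow (block g ε c) s ++ [opp c] := fun hm => by
      rcases List.mem_append.1 hm with hm | hm
      · exact not_mem_block hg hc ε (mem_of_mem_wpow hm)
      · exact opp_ne c (List.mem_singleton.1 hm).symm
    obtain ⟨k, hk⟩ := infix_rotate_of_infix_wpow hne hinf
    exact (h k).2 c hc ε s hs (by simpa using hk)

theorem wordElt_rotate (g : ℕ) (w : List Letter) (k : ℕ) :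
    wordElt g (w.rotate k) = (wordElt g (w.take (k % w.length)))⁻¹ * wordElt g w *
      wordElt g (w.take (k % w.length)) := by
  rcases List.eq_nil_or_concat w with rfl | ⟨v, a, hv⟩
  · simp
  conv_lhs => rw [← List.rotate_mod, List.rotate_eq_drop_append_take
    (Nat.mod_lt _ (by simp [hv])).le]
  rw [wordElt_append]
  generalize k % w.length = n
  have h : wordElt g w = wordElt g (w.take n) * wordElt g (w.drop n) := by
    rw [← wordElt_append, List.take_append_drop]
  rw [h]
  group

/-- Every conjugacy class contains an element represented by a word all of whose rotations are
tight. -/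
theorem exists_cyclically_tight {g : ℕ} (hg : 2 ≤ g) {γ : SL(2, ℝ)} (hγ : γ ∈ Gam g) :
    ∃ (w : List Letter) (δ : SL(2, ℝ)), (∀ a ∈ w, IsLetter g a) ∧ (∀ k, IsTight g (w.rotate k)) ∧
      wordElt g w = δ * γ * δ⁻¹ := by
  obtain ⟨w₀, hw₀, e₀⟩ := exists_wordElt_eq hγ
  obtain ⟨w, ⟨hw, δ, e⟩, hmin⟩ := WellFounded.has_min (measure List.length).wf
    {w : List Letter | (∀ a ∈ w, IsLetter g a) ∧ ∃ δ, wordElt g w = δ * γ * δ⁻¹}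
    ⟨w₀, hw₀, 1, by simpa using e₀⟩
  refine ⟨w, δ, hw, fun k => ?_, e⟩
  by_contra h
  obtain ⟨v, hv, hlt, hvw⟩ := exists_shorter hg (fun a ha => hw a (List.mem_rotate.1 ha)) h
  refine hmin v ⟨hv, (wordElt g (w.take (k % w.length)))⁻¹ * δ, ?_⟩ (by
    rw [List.length_rotate] at hlt
    exact hlt)
  rw [hvw, wordElt_rotate, e]
  group

/-- The group is torsion-free. -/
theorem eq_one_of_pow_eq_one {g : ℕ} (hg : 2 ≤ g) {γ : SL(2, ℝ)} (hγ : γ ∈ Gam g) {n : ℕ}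
    (hn : n ≠ 0)
    (h : γ ^ n = 1) : γ = 1 := by
  obtain ⟨w, δ, hw, ht, e⟩ := exists_cyclically_tight hg hγ
  by_contra hne
  have hw0 : w ≠ [] := by
    rintro rfl
    refine hne ?_
    have : γ = δ⁻¹ * (δ * γ * δ⁻¹) * δ := by group
    rw [this, ← e]
    simp
  have h1 : wpow w n ≠ [] := by
    rw [← List.length_pos_iff, length_wpow]
    exact Nat.mul_pos (Nat.pos_of_ne_zero hn) (List.length_pos_iff.2 hw0)
  obtain ⟨b, hb, h2⟩ := exists_side_neg_of_tight hg (fun a ha => hw a (mem_of_mem_wpow ha))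
    (isTight_wpow hg ht n) h1 (inPoly_I hg)
  rw [wordElt_wpow, e, conj_pow, h] at h2
  exact (inPoly_I hg b hb).not_gt (by simpa using h2)

/-- The group acts freely. -/
theorem eq_one_of_smul_eq {g : ℕ} (hg : 2 ≤ g) {γ : SL(2, ℝ)} (hγ : γ ∈ Gam g) {z : ℍ}
    (h : γ • z = z) : γ = 1 := by
  -- otherwise the powers of `γ` are infinitely many elements that move `i` by a bounded distance
  by_contra hne
  have hz : ∀ n : ℕ, γ ^ n • z = z := by
    intro n
    induction n with
    | zero => simp
    | succ n ih => rw [pow_succ, mul_smul, h, ih]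
  have hinj : Function.Injective fun n : ℕ => γ ^ n := by
    have key : ∀ m n : ℕ, m < n → γ ^ m ≠ γ ^ n := by
      intro m n hmn e
      refine hne (eq_one_of_pow_eq_one hg hγ (n := n - m) (by omega) ?_)
      rw [pow_sub _ hmn.le, e, mul_inv_cancel]
    intro m n e
    rcases lt_trichotomy m n with h1 | h1 | h1
    exacts [absurd e (key m n h1), h1, absurd e.symm (key n m h1)]
  refine Set.infinite_range_of_injective hinj ((finite_orbit hg
    (dist UpperHalfPlane.I z + dist UpperHalfPlane.I z)).subset ?_)
  rintro _ ⟨n, rfl⟩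
  refine ⟨pow_mem hγ n, (dist_triangle_right _ _ z).trans ?_⟩
  dsimp only
  gcongr
  conv_lhs => rw [← hz n]
  rw [dist_smul]

/-- Only finitely many elements of the group move a point of a bounded set into a bounded set. -/
theorem finite_setOf_dist_le {g : ℕ} (hg : 2 ≤ g) (R : ℝ) :
    {γ : SL(2, ℝ) | γ ∈ Gam g ∧ ∃ z z', dist z UpperHalfPlane.I ≤ R ∧ dist z' UpperHalfPlane.I ≤ R ∧
      dist (γ • z) z' ≤ R}.Finite := by
  refine (finite_orbit hg (R + R + R)).subset ?_
  rintro γ ⟨hγ, z, z', h1, h2, h3⟩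
  refine ⟨hγ, ?_⟩
  have h4 := dist_triangle4 (γ • UpperHalfPlane.I) (γ • z) z' UpperHalfPlane.I
  rw [dist_smul, dist_comm UpperHalfPlane.I z] at h4
  linarith

/-- The translates of the points of a bounded set are uniformly separated. -/
theorem exists_displacement {g : ℕ} (hg : 2 ≤ g) {K : Set ℍ} (hK : IsCompact K) :
    ∃ c > 0, ∀ γ ∈ Gam g, γ ≠ 1 → ∀ z ∈ K, c ≤ dist (γ • z) z := by
  obtain ⟨R, hR⟩ := hK.isBounded.subset_closedBall UpperHalfPlane.I
  set R' := max R 1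
  have hfin := finite_setOf_dist_le hg R'
  have hpos : ∀ γ ∈ Gam g, γ ≠ 1 → ∃ c > 0, ∀ z ∈ K, c ≤ dist (γ • z) z := by
    intro γ hγ h1
    rcases K.eq_empty_or_nonempty with rfl | hne
    · exact ⟨1, one_pos, by simp⟩
    obtain ⟨z, hz, hmin⟩ := hK.exists_isMinOn hne
      (f := fun z => dist (γ • z) z) (by fun_prop)
    exact ⟨dist (γ • z) z, dist_pos.2 fun h => h1 (eq_one_of_smul_eq hg hγ h), fun y hy => hmin hy⟩
  choose! c hc hc' using hpos
  obtain ⟨c₀, hc₀, hle⟩ : ∃ c₀ > 0, ∀ γ ∈ hfin.toFinset, γ ≠ 1 → c₀ ≤ c γ := by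
    have : ∀ s : Finset SL(2, ℝ), (∀ γ ∈ s, γ ∈ Gam g) → ∃ c₀ > 0, ∀ γ ∈ s, γ ≠ 1 → c₀ ≤ c γ := by
      intro s
      induction s using Finset.induction_on with
      | empty => exact fun _ => ⟨1, one_pos, by simp⟩
      | insert a s ha ih =>
        intro hs
        obtain ⟨c₀, h1, h2⟩ := ih fun γ hγ => hs γ (Finset.mem_insert_of_mem hγ)
        by_cases ha1 : a = 1
        · refine ⟨c₀, h1, fun γ hγ hne => ?_⟩
          rcases Finset.mem_insert.1 hγ with rfl | hγ
          exacts [absurd ha1 hne, h2 γ hγ hne]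
        · refine ⟨min c₀ (c a), lt_min h1 (hc a (hs a (by simp)) ha1), fun γ hγ hne => ?_⟩
          rcases Finset.mem_insert.1 hγ with rfl | hγ
          exacts [min_le_right _ _, (min_le_left _ _).trans (h2 γ hγ hne)]
    exact this _ fun γ hγ => (hfin.mem_toFinset.1 hγ).1
  refine ⟨min c₀ 1, lt_min hc₀ one_pos, fun γ hγ h1 z hz => ?_⟩
  by_contra h
  push Not at h
  have hzR : dist z UpperHalfPlane.I ≤ R' := (hR hz).trans (le_max_left _ _)
  have hmem : γ ∈ hfin.toFinset := hfin.mem_toFinset.2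
    ⟨hγ, z, z, hzR, hzR, h.le.trans ((min_le_right _ _).trans (le_max_right _ _))⟩
  exact absurd ((hle γ hmem h1).trans (hc' γ hγ h1 z hz)) (not_le.2 (h.trans_le (min_le_left _ _)))

/-! ### Points given by timelike vectors -/

/-- A future-directed timelike vector. -/
def Timelike (v : ℝ × ℝ × ℝ) : Prop := 0 < v.1 ∧ 0 < lprod v v

/-- The point of `ℍ` on the ray of a future-directed timelike vector (the value for other vectors is
irrelevant). -/
def ofVec (v : ℝ × ℝ × ℝ) : ℍ :=
  if h : 0 < Real.sqrt (lprod v v) / (v.1 - v.2.1) then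
    ⟨⟨v.2.2 / (v.1 - v.2.1), Real.sqrt (lprod v v) / (v.1 - v.2.1)⟩, h⟩
  else UpperHalfPlane.I

theorem Timelike.sub_pos {v : ℝ × ℝ × ℝ} (h : Timelike v) : 0 < v.1 - v.2.1 := by
  obtain ⟨h1, h2⟩ := h
  rw [lprod] at h2
  nlinarith [sq_nonneg v.2.2]

theorem Timelike.im_pos {v : ℝ × ℝ × ℝ} (h : Timelike v) :
    0 < Real.sqrt (lprod v v) / (v.1 - v.2.1) :=
  div_pos (Real.sqrt_pos.2 h.2) h.sub_pos

theorem timelike_lor (z : ℍ) : Timelike (lor z) :=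
    ⟨lor_fst_pos z, by rw [lprod_lor_self]; exact one_pos⟩

theorem Timelike.smul {v : ℝ × ℝ × ℝ} (h : Timelike v) {r : ℝ} (hr : 0 < r) : Timelike (r • v) := by
  refine ⟨mul_pos hr h.1, ?_⟩
  have : lprod (r • v) (r • v) = r ^ 2 * lprod v v := by
    simp only [lprod, Prod.smul_fst, Prod.smul_snd, smul_eq_mul]
    ring
  rw [this]
  exact mul_pos (by positivity) h.2

theorem lor_ofVec {v : ℝ × ℝ × ℝ} (h : Timelike v) :
    lor (ofVec v) = (Real.sqrt (lprod v v))⁻¹ • v := by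
  have h1 := h.sub_pos
  have h2 := Real.sqrt_pos.2 h.2
  have h3 := Real.sq_sqrt h.2.le
  rw [ofVec, dif_pos h.im_pos]
  simp only [lor, UpperHalfPlane.re, UpperHalfPlane.im]
  generalize Real.sqrt (lprod v v) = q at *
  obtain ⟨T, X, Y⟩ := v
  simp only [lprod] at h3
  simp only [Prod.smul_mk, smul_eq_mul]
  dsimp only at h1
  refine Prod.ext ?_ (Prod.ext ?_ ?_) <;> dsimp only <;> field_simp <;> linear_combination h3

theorem lor_ofVec_of_eq_one {v : ℝ × ℝ × ℝ} (h : 0 < v.1) (h1 : lprod v v = 1) :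
    lor (ofVec v) = v := by
  rw [lor_ofVec ⟨h, by rw [h1]; exact one_pos⟩, h1, Real.sqrt_one, inv_one, one_smul]

theorem ofVec_lor (z : ℍ) : ofVec (lor z) = z :=
  lor_injective (lor_ofVec_of_eq_one (lor_fst_pos z) (lprod_lor_self z))

theorem timelike_add {z w : ℍ} {r : ℝ} (hr : 0 ≤ r) : Timelike (lor z + r • lor w) := by
  have h1 := cosh_dist_eq_lprod z w
  have h2 := Real.cosh_pos (dist z w)
  have h3 := lprod_lor_self z
  have h4 := lprod_lor_self w
  refine ⟨?_, ?_⟩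
  · have := lor_fst_pos z
    have := lor_fst_pos w
    simp only [Prod.fst_add, Prod.smul_fst, smul_eq_mul]
    positivity
  · have : lprod (lor z + r • lor w) (lor z + r • lor w) =
        lprod (lor z) (lor z) + 2 * r * lprod (lor z) (lor w) + r ^ 2 * lprod (lor w) (lor w) := by
      simp only [lprod, Prod.fst_add, Prod.smul_fst, Prod.snd_add, Prod.smul_snd, smul_eq_mul]
      ring
    rw [this, h3, h4, ← h1]
    positivity

theorem Timelike.eq_smul {v : ℝ × ℝ × ℝ} (h : Timelike v) :
    v = Real.sqrt (lprod v v) • lor (ofVec v) := by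
  rw [lor_ofVec h, smul_smul, mul_inv_cancel₀ (Real.sqrt_pos.2 h.2).ne', one_smul]

theorem Timelike.lact {v : ℝ × ℝ × ℝ} (h : Timelike v) (A : SL(2, ℝ)) : Timelike (lact A v) := by
  rw [h.eq_smul, lact_smul, ← lor_smul]
  exact (timelike_lor _).smul (Real.sqrt_pos.2 h.2)

theorem smul_ofVec {v : ℝ × ℝ × ℝ} (h : Timelike v) (A : SL(2, ℝ)) :
    A • ofVec v = ofVec (SurfaceLoops.lact A v) := by
  apply lor_injective
  rw [lor_smul, lor_ofVec h, lor_ofVec (h.lact A), lprod_lact, lact_smul]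

theorem continuousOn_ofVec : ContinuousOn ofVec {v | Timelike v} := by
  have key : ContinuousOn (fun v : ℝ × ℝ × ℝ =>
      (⟨v.2.2 / (v.1 - v.2.1), Real.sqrt (lprod v v) / (v.1 - v.2.1)⟩ : ℂ)) {v | Timelike v} := by
    have hd : ContinuousOn (fun v : ℝ × ℝ × ℝ => (v.1 - v.2.1)) {v | Timelike v} := by fun_prop
    have h1 : ContinuousOn (fun v : ℝ × ℝ × ℝ => v.2.2 / (v.1 - v.2.1)) {v | Timelike v} :=
      ContinuousOn.div (by fun_prop) hd fun v hv => hv.sub_pos.ne'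
    have h2 : ContinuousOn (fun v : ℝ × ℝ × ℝ => Real.sqrt (lprod v v) / (v.1 - v.2.1))
        {v | Timelike v} :=
      ContinuousOn.div (by unfold lprod; fun_prop) hd fun v hv => hv.sub_pos.ne'
    exact (Complex.equivRealProdCLM.symm.continuous.comp_continuousOn (h1.prodMk h2))
  rw [UpperHalfPlane.isEmbedding_coe.isInducing.continuousOn_iff]
  refine key.congr fun v hv => ?_
  simp only [Function.comp, ofVec, dif_pos (Timelike.im_pos hv)]

theorem isOpen_timelike : IsOpen {v | Timelike v} := by
  have : {v : ℝ × ℝ × ℝ | Timelike v} = {v | 0 < v.1} ∩ {v | 0 < lprod v v} := rfl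
  rw [this]
  exact (isOpen_lt continuous_const (by fun_prop)).inter
    (isOpen_lt continuous_const (by unfold lprod; fun_prop))

/-! ### The edges -/

/-- The translation length of the letters. -/
def edgeLen (g : ℕ) : ℝ := Real.arsinh (2 * sideS g * sideC g)

/-- The point with parameter `τ` on the geodesic from `i` in the direction of a letter, as a point
of the hyperboloid. -/
def edgeVec (g : ℕ) (a : Letter) (τ : ℝ) : ℝ × ℝ × ℝ :=
  (Real.cosh (τ * edgeLen g), Real.cos (ang g a) * Real.sinh (τ * edgeLen g),
    Real.sin (ang g a) * Real.sinh (τ * edgeLen g))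

/-- The point with parameter `τ` on the geodesic from `i` in the direction of a letter. -/
def edge (g : ℕ) (a : Letter) (τ : ℝ) : ℍ := ofVec (edgeVec g a τ)

theorem lprod_edgeVec (g : ℕ) (a : Letter) (τ : ℝ) : lprod (edgeVec g a τ) (edgeVec g a τ) = 1 := by
  have h1 := Real.cosh_sq (τ * edgeLen g)
  have h2 := Real.sin_sq_add_cos_sq (ang g a)
  simp only [lprod, edgeVec]
  linear_combination h1 - Real.sinh (τ * edgeLen g) ^ 2 * h2

theorem lor_edge (g : ℕ) (a : Letter) (τ : ℝ) : lor (edge g a τ) = edgeVec g a τ :=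
  lor_ofVec_of_eq_one (Real.cosh_pos _) (lprod_edgeVec g a τ)

theorem timelike_edgeVec (g : ℕ) (a : Letter) (τ : ℝ) : Timelike (edgeVec g a τ) := by
  rw [← lor_edge]
  exact timelike_lor _

theorem continuous_edgeVec (g : ℕ) (a : Letter) : Continuous (edgeVec g a) := by
  unfold edgeVec
  fun_prop

theorem continuous_edge (g : ℕ) (a : Letter) : Continuous (edge g a) :=
  continuousOn_ofVec.comp_continuous (continuous_edgeVec g a) (timelike_edgeVec g a)

theorem sinh_edgeLen (g : ℕ) : Real.sinh (edgeLen g) = 2 * sideS g * sideC g := Real.sinh_arsinh _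

theorem cosh_edgeLen {g : ℕ} (hg : 2 ≤ g) : Real.cosh (edgeLen g) = sideC g ^ 2 + sideS g ^ 2 := by
  have h1 := Real.cosh_sq (edgeLen g)
  have h2 := sideC_sq_sub hg
  have h3 := Real.cosh_pos (edgeLen g)
  have h4 := sideC_pos hg
  rw [sinh_edgeLen] at h1
  refine (sq_eq_sq₀ h3.le (by positivity)).1 ?_
  rw [h1]
  linear_combination (-sideC g ^ 2 + sideS g ^ 2 - 1) * h2

theorem edgeLen_pos {g : ℕ} (hg : 2 ≤ g) : 0 < edgeLen g := by
  have h4 := sideC_pos hg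
  have h5 := sideS_pos hg
  exact Real.arsinh_pos_iff.2 (by positivity)

theorem edge_zero (g : ℕ) (a : Letter) : edge g a 0 = UpperHalfPlane.I :=
  lor_injective (by rw [lor_edge, lor_I]; simp [edgeVec])

/-- The edges of `a` and of its inverse are the same, up to the direction and the action of `a`. -/
theorem letterElt_smul_edge {g : ℕ} (hg : 2 ≤ g) (a : Letter) (τ : ℝ) :
    letterElt g a • edge g (opp a) τ = edge g a (1 - τ) := by
  apply lor_injective
  rw [lor_smul, lor_edge, lor_edge, lact_letterElt hg]
  obtain ⟨h1, h2⟩ := trig_opp hg a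
  have h3 := Real.sin_sq_add_cos_sq (ang g a)
  have e : (1 - τ) * edgeLen g = edgeLen g - τ * edgeLen g := by ring
  simp only [boost, edgeVec, dco, wco, h1, h2, e, Real.cosh_sub, Real.sinh_sub, sinh_edgeLen,
    cosh_edgeLen hg]
  generalize Real.sinh (τ * edgeLen g) = σ
  generalize Real.cosh (τ * edgeLen g) = κ
  generalize sideC g ^ 2 + sideS g ^ 2 = p
  generalize 2 * sideS g * sideC g = q
  generalize Real.sin (ang g a) = s at *
  generalize Real.cos (ang g a) = c at *
  refine Prod.ext ?_ (Prod.ext ?_ ?_) <;> dsimp only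
  · linear_combination -q * σ * h3
  · linear_combination -p * σ * c * h3
  · linear_combination -p * σ * s * h3

theorem edge_one {g : ℕ} (hg : 2 ≤ g) (a : Letter) :
    edge g a 1 = letterElt g a • UpperHalfPlane.I := by
  rw [← edge_zero g (opp a), letterElt_smul_edge hg, sub_zero]

theorem dist_edge_I {g : ℕ} (hg : 2 ≤ g) (a : Letter) :
    dist UpperHalfPlane.I (letterElt g a • UpperHalfPlane.I) = edgeLen g := by
  have h := cosh_dist_eq_lprod UpperHalfPlane.I (letterElt g a • UpperHalfPlane.I)
  rw [← edge_one hg, lor_I, lor_edge] at h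
  simp only [lprod, edgeVec, one_mul, zero_mul, sub_zero] at h
  rw [edge_one hg] at h
  exact Real.cosh_strictMonoOn.injOn dist_nonneg (edgeLen_pos hg).le h

/-- A geodesic arc from `i` to its image under a letter is the edge of the letter. -/
theorem IsGeodesicArc.eq_edge {g : ℕ} (hg : 2 ≤ g) {a : Letter} {c : ℝ → ℍ}
    (hc : IsGeodesicArc c UpperHalfPlane.I (letterElt g a • UpperHalfPlane.I)) {τ : ℝ}
    (hτ : τ ∈ Set.Icc (0 : ℝ) 1) : c τ = edge g a τ := by
  obtain ⟨h0, h1, h2⟩ := hc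
  have hL := edgeLen_pos hg
  have d0 := h2 0 ⟨le_rfl, zero_le_one⟩ τ hτ
  have d1 := h2 1 ⟨zero_le_one, le_rfl⟩ τ hτ
  rw [h0, zero_sub, abs_neg, abs_of_nonneg hτ.1, dist_edge_I hg] at d0
  rw [h1, abs_of_nonneg (sub_nonneg.2 hτ.2), dist_edge_I hg] at d1
  have e0 := cosh_dist_eq_lprod UpperHalfPlane.I (c τ)
  have e1 := cosh_dist_eq_lprod (letterElt g a • UpperHalfPlane.I) (c τ)
  have e2 := lor_sq (c τ)
  rw [d0, lor_I] at e0
  rw [d1, ← edge_one hg, lor_edge] at e1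
  apply lor_injective
  rw [lor_edge]
  have e : (1 - τ) * edgeLen g = edgeLen g - τ * edgeLen g := by ring
  rw [e, Real.cosh_sub] at e1
  simp only [lprod, edgeVec, one_mul, zero_mul, sub_zero] at e0 e1
  have hs := Real.sinh_pos_iff.2 hL
  have h3 := Real.sin_sq_add_cos_sq (ang g a)
  have h4 := Real.cosh_sq (τ * edgeLen g)
  simp only [edgeVec]
  generalize Real.sinh (edgeLen g) = q at *
  generalize Real.sinh (τ * edgeLen g) = σ at *
  generalize Real.cosh (τ * edgeLen g) = κ at *
  generalize Real.sin (ang g a) = s at *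
  generalize Real.cos (ang g a) = k at *
  generalize lor (c τ) = v at *
  obtain ⟨T, X, Y⟩ := v
  dsimp only at *
  subst e0
  -- the component along the edge is known, and so the orthogonal one vanishes
  have h5 : k * X + s * Y = σ := by
    have : q * (k * X + s * Y - σ) = 0 := by linear_combination e1
    linarith [(mul_eq_zero.1 this).resolve_left hs.ne']
  have h6 : -s * X + k * Y = 0 := by
    have : (-s * X + k * Y) ^ 2 = 0 := by
      linear_combination (X ^ 2 + Y ^ 2) * h3 + e2 + h4 - (k * X + s * Y + σ) * h5
    exact pow_eq_zero_iff (two_ne_zero) |>.1 this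
  refine Prod.ext rfl (Prod.ext ?_ ?_) <;> dsimp only
  · linear_combination k * h5 - s * h6 - X * h3
  · linear_combination s * h5 + k * h6 - Y * h3

/-! ### Intersections of edges -/

theorem side_add (g : ℕ) (a : Letter) (v w : ℝ × ℝ × ℝ) :
    side g a (v + w) = side g a v + side g a w := by
  simp only [side, sideAt, dco, Prod.fst_add, Prod.snd_add]
  ring

theorem side_smul (g : ℕ) (a : Letter) (r : ℝ) (v : ℝ × ℝ × ℝ) :
    side g a (r • v) = r * side g a v := by
  simp only [side, sideAt, dco, Prod.smul_fst, Prod.smul_snd, smul_eq_mul]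
  ring

theorem side_edgeVec_self (g : ℕ) (a : Letter) (τ : ℝ) : side g a (edgeVec g a τ) =
    sideS g * Real.cosh (τ * edgeLen g) - sideC g * Real.sinh (τ * edgeLen g) := by
  have h := Real.sin_sq_add_cos_sq (ang g a)
  simp only [side, sideAt, dco, edgeVec]
  linear_combination -sideC g * Real.sinh (τ * edgeLen g) * h

theorem side_edgeVec_add {g : ℕ} (hg : 2 ≤ g) (a : Letter) (τ : ℝ) :
    side g a (edgeVec g a (1 - τ)) = -side g a (edgeVec g a τ) := by
  have h1 := side_opp_lact_inv hg a (edgeVec g a (1 - τ))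
  have h2 := letterElt_smul_edge hg a τ
  rw [← eq_inv_smul_iff] at h2
  rw [← lor_edge, ← lor_smul, ← h2, lor_edge, side_edgeVec_self, lor_edge] at h1
  rw [side_edgeVec_self g a τ, h1, neg_neg]

theorem side_half {g : ℕ} (hg : 2 ≤ g) (a : Letter) : side g a (edgeVec g a (1 / 2)) = 0 := by
  have h := side_edgeVec_add hg a (1 / 2)
  norm_num at h ⊢
  linarith

theorem side_edgeVec_pos {g : ℕ} (hg : 2 ≤ g) (a : Letter) {τ : ℝ} (h : τ < 1 / 2) :
    0 < side g a (edgeVec g a τ) := by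
  by_contra hneg
  push Not at hneg
  have h1 := side_half hg a
  rw [side_edgeVec_self] at hneg h1
  have hS := sideS_pos hg
  have hC := sideC_pos hg
  have hL := edgeLen_pos hg
  have h2 : Real.sinh (1 / 2 * edgeLen g - τ * edgeLen g) > 0 := Real.sinh_pos_iff.2 (by nlinarith)
  rw [Real.sinh_sub] at h2
  have c1 := Real.cosh_pos (τ * edgeLen g)
  have c2 := Real.cosh_pos (1 / 2 * edgeLen g)
  have e : sideC g * (Real.sinh (1 / 2 * edgeLen g) * Real.cosh (τ * edgeLen g) -
      Real.cosh (1 / 2 * edgeLen g) * Real.sinh (τ * edgeLen g)) ≤ 0 := by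
    nlinarith
  nlinarith

theorem side_edgeVec_pos_of_ne {g : ℕ} (hg : 2 ≤ g) {a b : Letter} (ha : IsLetter g a)
    (hb : IsLetter g b) (hab : b ≠ a) {τ : ℝ} (h0 : 0 ≤ τ) (h1 : τ ≤ 1 / 2) :
    0 < side g b (edgeVec g a τ) := by
  have hS := sideS_pos hg
  have hC := sideC_pos hg
  have hL := edgeLen_pos hg
  have hcos : Real.cos (ang g a - ang g b) < 1 := by
    refine lt_of_le_of_ne (Real.cos_le_one _) fun h => hab ?_
    rw [Real.cos_eq_one_iff] at h
    obtain ⟨k, hk⟩ := h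
    refine dir_injective hb ha ⟨-k, ?_⟩
    have h2 := mul_stepAngle hg
    have h3 := stepAngle_pos hg
    simp only [ang] at hk
    rw [← h2] at hk
    have h4 : stepAngle g * ((dir g b : ℝ) - (dir g a + 4 * g * ((-k : ℤ) : ℝ))) = 0 := by
      push_cast
      linear_combination hk
    have h5 := (mul_eq_zero.1 h4).resolve_left h3.ne'
    have h6 : (dir g b : ℝ) = dir g a + 4 * g * ((-k : ℤ) : ℝ) := by linarith
    exact_mod_cast h6
  have e : side g b (edgeVec g a τ) = sideS g * Real.cosh (τ * edgeLen g) -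
      sideC g * Real.sinh (τ * edgeLen g) * Real.cos (ang g a - ang g b) := by
    simp only [side, sideAt, dco, edgeVec, Real.cos_sub]
    ring
  rw [e]
  rcases h0.eq_or_lt with rfl | h0
  · simpa using hS
  have h2 : 0 ≤ side g a (edgeVec g a τ) := by
    rcases h1.eq_or_lt with rfl | h1
    exacts [(side_half hg a).ge, (side_edgeVec_pos hg a h1).le]
  rw [side_edgeVec_self] at h2
  have h3 : 0 < Real.sinh (τ * edgeLen g) := Real.sinh_pos_iff.2 (by positivity)
  have h4 : 0 < sideC g * Real.sinh (τ * edgeLen g) * (1 - Real.cos (ang g a - ang g b)) :=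
    mul_pos (mul_pos hC h3) (by linarith)
  linarith

theorem inPoly_edge {g : ℕ} (hg : 2 ≤ g) {a : Letter} (ha : IsLetter g a) {τ : ℝ} (h0 : 0 ≤ τ)
    (h1 : τ < 1 / 2) : InPoly g (edge g a τ) := by
  intro b hb
  rw [lor_edge]
  by_cases hab : b = a
  · rw [hab]
    exact side_edgeVec_pos hg a h1
  · exact side_edgeVec_pos_of_ne hg ha hb hab h0 h1.le

theorem side_edge_nonneg {g : ℕ} (hg : 2 ≤ g) {a : Letter} (ha : IsLetter g a) {τ : ℝ} (h0 : 0 ≤ τ)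
    (h1 : τ ≤ 1 / 2) {b : Letter} (hb : IsLetter g b) : 0 ≤ side g b (lor (edge g a τ)) := by
  rcases h1.eq_or_lt with rfl | h1
  · rw [lor_edge]
    by_cases hab : b = a
    · rw [hab, side_half hg]
    · exact (side_edgeVec_pos_of_ne hg ha hb hab h0 le_rfl).le
  · exact (inPoly_edge hg ha h0 h1 b hb).le

theorem finite_setOf_isLetter (g : ℕ) : {a : Letter | IsLetter g a}.Finite := by
  refine ((Set.finite_Icc 1 (2 * g)).prod Set.finite_univ).subset ?_
  rintro ⟨j, e⟩ ⟨h1, h2⟩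
  exact ⟨⟨h1, h2⟩, trivial⟩

theorem inPoly_ofVec {g : ℕ} {v : ℝ × ℝ × ℝ} (hv : Timelike v)
    (h : ∀ a, IsLetter g a → 0 < side g a v) : InPoly g (ofVec v) := by
  intro a ha
  rw [lor_ofVec hv, side_smul]
  exact mul_pos (inv_pos.2 (Real.sqrt_pos.2 hv.2)) (h a ha)

/-- Positivity of finitely many linear forms is preserved by small perturbations. -/
theorem exists_perturbation {g : ℕ} {P : Letter → Prop} {f h : Letter → ℝ}
    (hf : ∀ a, IsLetter g a → P a → 0 < f a) :
    ∀ᶠ r in nhds (0 : ℝ), ∀ a, IsLetter g a → P a → 0 < f a + r * h a := by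
  have := (Filter.eventually_all_finite (finite_setOf_isLetter g) (l := nhds (0 : ℝ))
    (p := fun a r => P a → 0 < f a + r * h a)).2 fun a ha => ?_
  · exact this
  by_cases hP : P a
  · have hc : ContinuousAt (fun r : ℝ => f a + r * h a) 0 := by fun_prop
    filter_upwards [hc.eventually_const_lt (by simpa using hf a ha hP)] with r hr _ using hr
  · exact Filter.Eventually.of_forall fun r h => absurd h hP

/-- If a point of the closed polygon and an interior point of the side of a letter are equivalent,
then by the trivial element or by the letter. -/
theorem eq_one_or_eq_letterElt {g : ℕ} (hg : 2 ≤ g) {γ : SL(2, ℝ)} (hγ : γ ∈ Gam g) {x : ℍ}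
    (hx : ∀ a, IsLetter g a → 0 ≤ side g a (lor x)) {b : Letter} (hb : IsLetter g b)
    (h0 : side g b (lor (γ • x)) = 0)
    (hpos : ∀ a, IsLetter g a → a ≠ b → 0 < side g a (lor (γ • x)))
    (hpos' : ∀ a, IsLetter g a → a ≠ opp b → 0 < side g a (lor ((letterElt g b)⁻¹ • γ • x))) :
    γ = 1 ∨ γ = letterElt g b := by
  -- perturb `x` to an interior point whose image is not on the side
  obtain ⟨p, hp, hpb⟩ : ∃ p, InPoly g p ∧ side g b (lor (γ • p)) ≠ 0 := by
    by_cases h1 : side g b (lor (γ • UpperHalfPlane.I)) = 0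
    · have h2 := exists_perturbation (g := g) (P := fun _ => True)
        (f := fun a => side g a (lor UpperHalfPlane.I))
        (h := fun a => side g a (lor (γ⁻¹ • UpperHalfPlane.I))) fun a ha _ => inPoly_I hg a ha
      obtain ⟨r, hr, hr0⟩ := ((h2.filter_mono nhdsWithin_le_nhds).and
        (self_mem_nhdsWithin : Set.Ioi (0 : ℝ) ∈ nhdsWithin 0 (Set.Ioi 0))).exists
      have ht := timelike_add (z := UpperHalfPlane.I) (w := γ⁻¹ • UpperHalfPlane.I) (le_of_lt hr0)
      refine ⟨_, inPoly_ofVec ht fun a ha => ?_, ?_⟩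
      · rw [side_add, side_smul]
        exact hr a ha trivial
      · rw [lor_smul, lor_ofVec ht, lact_smul, side_smul, lact_add, lact_smul, ← lor_smul, ←
          lor_smul,
          side_add, h1, smul_inv_smul, side_smul, zero_add]
        exact mul_ne_zero (inv_ne_zero (Real.sqrt_pos.2 ht.2).ne')
          (mul_ne_zero (ne_of_gt hr0) (inPoly_I hg b hb).ne')
    · exact ⟨_, inPoly_I hg, h1⟩
  have h2 := exists_perturbation (g := g) (P := fun a => a ≠ b)
    (f := fun a => side g a (lor (γ • x)))
    (h := fun a => side g a (lor (γ • p))) hpos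
  have h3 := exists_perturbation (g := g) (P := fun a => a ≠ opp b)
    (f := fun a => side g a (lor ((letterElt g b)⁻¹ • γ • x)))
    (h := fun a => side g a (lor ((letterElt g b)⁻¹ • γ • p))) hpos'
  obtain ⟨r, ⟨hr, hr'⟩, hr0⟩ := (((h2.and h3).filter_mono nhdsWithin_le_nhds).and
    (self_mem_nhdsWithin : Set.Ioi (0 : ℝ) ∈ nhdsWithin 0 (Set.Ioi 0))).exists
  have ht := timelike_add (z := x) (w := p) (le_of_lt hr0)
  have hq : InPoly g (ofVec (lor x + r • lor p)) := inPoly_ofVec ht fun a ha => by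
    rw [side_add, side_smul]
    exact add_pos_of_nonneg_of_pos (hx a ha) (mul_pos hr0 (hp a ha))
  have hside : ∀ (A : SL(2, ℝ)) a, ∃ s > 0, side g a (lor (A • ofVec (lor x + r • lor p))) =
      s * (side g a (lor (A • x)) + r * side g a (lor (A • p))) := fun A a =>
    ⟨_, inv_pos.2 (Real.sqrt_pos.2 ht.2), by
      rw [lor_smul, lor_ofVec ht, lact_smul, side_smul, lact_add, lact_smul, ← lor_smul, ← lor_smul,
        side_add, side_smul]⟩
  rcases hpb.lt_or_gt with hlt | hgt
  · right
    by_contra hne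
    obtain ⟨a, ha, hn⟩ := exists_side_neg hg (mul_mem (inv_mem (letterElt_mem hb)) hγ)
      (fun h => hne (inv_mul_eq_one.1 h).symm) hq
    obtain ⟨s, hs, e⟩ := hside ((letterElt g b)⁻¹ * γ) a
    rw [e, mul_smul, mul_smul] at hn
    refine hn.not_gt (mul_pos hs ?_)
    by_cases hab : a = opp b
    · rw [hab, lor_smul, lor_smul (letterElt g b)⁻¹ (γ • p), side_opp_lact_inv hg,
        side_opp_lact_inv hg, h0]
      have := mul_pos hr0 (neg_pos.2 hlt)
      linarith
    · exact hr' a ha hab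
  · left
    by_contra hne
    obtain ⟨a, ha, hn⟩ := exists_side_neg hg hγ hne hq
    obtain ⟨s, hs, e⟩ := hside γ a
    rw [e] at hn
    refine hn.not_gt (mul_pos hs ?_)
    by_cases hab : a = b
    · rw [hab, h0, zero_add]
      exact mul_pos hr0 hgt
    · exact hr a ha hab

theorem edge_injective {g : ℕ} (hg : 2 ≤ g) {a b : Letter} (ha : IsLetter g a) (hb : IsLetter g b)
    {σ τ : ℝ} (hσ : 0 ≤ σ) (hτ : 0 ≤ τ) (h : edge g a σ = edge g b τ) :
    (a = b ∧ σ = τ) ∨ (σ = 0 ∧ τ = 0) := by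
  have h1 : edgeVec g a σ = edgeVec g b τ := by rw [← lor_edge, ← lor_edge, h]
  have hL := edgeLen_pos hg
  have e : σ = τ := by
    have h2 := congrArg Prod.fst h1
    have h3 := Real.cosh_strictMonoOn.injOn (mul_nonneg hσ hL.le) (mul_nonneg hτ hL.le) h2
    exact mul_right_cancel₀ hL.ne' h3
  subst e
  rcases hσ.eq_or_lt with rfl | h0
  · exact Or.inr ⟨rfl, rfl⟩
  refine Or.inl ⟨?_, rfl⟩
  have hs : 0 < Real.sinh (σ * edgeLen g) := Real.sinh_pos_iff.2 (by positivity)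
  simp only [edgeVec, Prod.mk.injEq, mul_eq_mul_right_iff, hs.ne', or_false, true_and] at h1
  by_contra hab
  -- the directions of different letters are different
  have h3 := side_edgeVec_pos_of_ne hg ha hb (Ne.symm hab) (τ := 1 / 2) (by norm_num) le_rfl
  have h4 := side_half hg b
  simp only [side, sideAt, dco, edgeVec, h1.1, h1.2] at h3 h4
  linarith

/-- Two half-edges meet only in a common initial point or in a common midpoint. -/
theorem eq_of_smul_half_edge_eq {g : ℕ} (hg : 2 ≤ g) {γ : SL(2, ℝ)} (hγ : γ ∈ Gam g) {a b : Letter}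
    (ha : IsLetter g a) (hb : IsLetter g b) {σ τ : ℝ} (hσ : 0 ≤ σ) (hσ' : σ ≤ 1 / 2) (hτ : 0 ≤ τ)
    (hτ' : τ ≤ 1 / 2) (h : γ • edge g a σ = edge g b τ) :
    (γ = 1 ∧ ((a = b ∧ σ = τ) ∨ (σ = 0 ∧ τ = 0))) ∨
      (γ = letterElt g b ∧ a = opp b ∧ σ = 1 / 2 ∧ τ = 1 / 2) := by
  by_cases h1 : γ = 1
  · left
    rw [h1, one_smul] at h
    exact ⟨h1, edge_injective hg ha hb hσ hτ h⟩
  right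
  have hτ1 : τ = 1 / 2 := by
    by_contra hne
    have h2 := inPoly_edge hg hb hτ (lt_of_le_of_ne hτ' hne)
    rw [← h] at h2
    obtain ⟨c, hc, hn⟩ := exists_side_neg hg (inv_mem hγ) (fun e => h1 (inv_eq_one.1 e)) h2
    rw [inv_smul_smul] at hn
    exact (side_edge_nonneg hg ha hσ hσ' hc).not_gt hn
  subst hτ1
  have h2 : γ = letterElt g b := by
    refine (eq_one_or_eq_letterElt hg hγ (fun c hc => side_edge_nonneg hg ha hσ hσ' hc) hb ?_ ?_
      ?_).resolve_left h1
    · rw [h, lor_edge, side_half hg]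
    · intro c hc hcb
      rw [h, lor_edge]
      exact side_edgeVec_pos_of_ne hg hb hc hcb hτ le_rfl
    · intro c hc hcb
      have : (letterElt g b)⁻¹ • edge g b (1 / 2) = edge g (opp b) (1 / 2) := by
        rw [inv_smul_eq_iff, letterElt_smul_edge hg]
        norm_num
      rw [h, this, lor_edge]
      exact side_edgeVec_pos_of_ne hg hb.opp hc hcb hτ le_rfl
  subst h2
  have h3 : edge g a σ = edge g (opp b) (1 / 2) := by
    refine MulAction.injective (letterElt g b) (h.trans ?_)
    dsimp only
    rw [letterElt_smul_edge hg]
    norm_num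
  rcases edge_injective hg ha hb.opp hσ (by norm_num) h3 with ⟨h4, h5⟩ | ⟨-, h5⟩
  · exact ⟨rfl, h4, h5, rfl⟩
  · norm_num at h5

/-- The end of an edge that is nearest to a point of the edge. -/
theorem exists_half_edge {g : ℕ} (hg : 2 ≤ g) {a : Letter} (ha : IsLetter g a) {τ : ℝ} (hτ : 0 ≤ τ)
    (hτ' : τ ≤ 1) : ∃ (A : SL(2, ℝ)) (a' : Letter) (τ' : ℝ), A ∈ Gam g ∧ IsLetter g a' ∧ 0 ≤ τ' ∧
      τ' ≤ 1 / 2 ∧ edge g a τ = A • edge g a' τ' ∧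
      ((A = 1 ∧ a = a' ∧ τ = τ') ∨ (A = letterElt g a ∧ a' = opp a ∧ τ' = 1 - τ)) := by
  rcases le_total τ (1 / 2) with h | h
  · exact ⟨1, a, τ, one_mem _, ha, hτ, h, (one_smul _ _).symm, Or.inl ⟨rfl, rfl, rfl⟩⟩
  · refine ⟨letterElt g a, opp a, 1 - τ, letterElt_mem ha, ha.opp, by linarith, by linarith, ?_,
      Or.inr ⟨rfl, rfl, rfl⟩⟩
    rw [letterElt_smul_edge hg, sub_sub_cancel]

/-- Two edges that meet in a point are equal, or equal up to the direction, or meet in a common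
end. -/
theorem eq_of_smul_edge_eq {g : ℕ} (hg : 2 ≤ g) {γ : SL(2, ℝ)} (hγ : γ ∈ Gam g) {a b : Letter}
    (ha : IsLetter g a) (hb : IsLetter g b) {σ τ : ℝ} (hσ : 0 ≤ σ) (hσ' : σ ≤ 1) (hτ : 0 ≤ τ)
    (hτ' : τ ≤ 1) (h : γ • edge g a σ = edge g b τ) :
    (γ = 1 ∧ a = b ∧ σ = τ) ∨ (γ = letterElt g b ∧ a = opp b) ∨
      (((σ = 0 ∧ τ = 0) ∧ γ = 1) ∨ ((σ = 0 ∧ τ = 1) ∧ γ = letterElt g b) ∨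
        ((σ = 1 ∧ τ = 0) ∧ γ * letterElt g a = 1) ∨
        ((σ = 1 ∧ τ = 1) ∧ γ * letterElt g a = letterElt g b)) := by
  obtain ⟨A, a', σ', hA, ha', h1, h2, h3, h4⟩ := exists_half_edge hg ha hσ hσ'
  obtain ⟨B, b', τ', hB, hb', k1, k2, k3, k4⟩ := exists_half_edge hg hb hτ hτ'
  rw [h3, k3, ← inv_smul_eq_iff, ← mul_smul, ← mul_smul] at h
  have key := eq_of_smul_half_edge_eq hg (mul_mem (inv_mem hB) (mul_mem hγ hA)) ha' hb' h1 h2 k1 k2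
    (by rw [← h]; simp only [mul_smul])
  rw [inv_mul_eq_one, eq_comm (a := B), inv_mul_eq_iff_eq_mul] at key
  rcases h4 with ⟨rfl, rfl, rfl⟩ | ⟨rfl, rfl, rfl⟩ <;> rcases k4 with ⟨rfl, rfl, rfl⟩ |
    ⟨rfl, rfl, rfl⟩
  · rw [mul_one, one_mul] at key
    tauto
  · rw [mul_one, letterElt_opp, mul_inv_cancel, opp_opp] at key
    rcases key with ⟨h5, h6 | h6⟩ | ⟨h5, h6, h7, h8⟩
    · exact Or.inr (Or.inl ⟨h5, h6.1⟩)
    · exact Or.inr (Or.inr (Or.inr (Or.inl ⟨⟨h6.1, by linarith [h6.2]⟩, h5⟩)))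
    · exact Or.inl ⟨h5, h6, by linarith⟩
  · rw [one_mul] at key
    have hinv : γ * letterElt g a = letterElt g b → a = b → γ = 1 := by
      rintro h5 rfl
      exact mul_eq_right.1 h5
    rcases key with ⟨h5, h6 | h6⟩ | ⟨h5, h6, h7, h8⟩
    · obtain rfl : b = opp a := h6.1.symm
      refine Or.inr (Or.inl ⟨?_, by rw [opp_opp]⟩)
      rw [letterElt_opp]
      exact eq_inv_of_mul_eq_one_left h5
    · exact Or.inr (Or.inr (Or.inr (Or.inr (Or.inl ⟨⟨by linarith [h6.1], h6.2⟩, h5⟩))))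
    · have := opp_injective h6
      exact Or.inl ⟨hinv h5 this, this, by linarith⟩
  · rw [letterElt_opp, mul_inv_cancel, opp_opp] at key
    rcases key with ⟨h5, h6 | h6⟩ | ⟨h5, h6, h7, h8⟩
    · have := opp_injective h6.1
      subst this
      exact Or.inl ⟨mul_eq_right.1 h5, rfl, by linarith [h6.2]⟩
    · exact Or.inr (Or.inr
      (Or.inr (Or.inr (Or.inr ⟨⟨by linarith [h6.1], by linarith [h6.2]⟩, h5⟩))))
    · rw [← h6, letterElt_opp]
      exact Or.inr (Or.inl ⟨eq_inv_of_mul_eq_one_left h5, (opp_opp a).symm⟩)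

/-! ### The periodic edge path of a word -/

/-- The letter with index `n` of the periodic bi-infinite word `⋯ w w w ⋯`. -/
def perLetter (w : List Letter) (n : ℤ) : Letter := w.getD (n % w.length).toNat (1, true)

/-- The vertex with index `n` of the edge path of `⋯ w w w ⋯`, as an element of the group. -/
def vert (g : ℕ) (w : List Letter) (n : ℤ) : SL(2, ℝ) :=
  wordElt g w ^ (n / w.length) * wordElt g (w.take (n % w.length).toNat)

section Path

variable {g : ℕ} {w : List Letter}

theorem length_pos_int (hne : w ≠ []) : (0 : ℤ) < w.length := by
  exact_mod_cast List.length_pos_iff.2 hne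

theorem toNat_emod_lt (hne : w ≠ []) (n : ℤ) : (n % w.length).toNat < w.length := by
  have h := length_pos_int hne
  have := Int.emod_lt_of_pos n h
  omega

theorem perLetter_eq_getElem (hne : w ≠ []) (n : ℤ) :
    perLetter w n = w[(n % w.length).toNat]'(toNat_emod_lt hne n) := by
  rw [perLetter, List.getD_eq_getElem]

theorem perLetter_add_mul (n k : ℤ) : perLetter w (n + k * w.length) = perLetter w n := by
  rw [perLetter, perLetter, Int.add_mul_emod_self_right]

theorem isLetter_perLetter (hw : ∀ a ∈ w, IsLetter g a) (hne : w ≠ []) (n : ℤ) :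
    IsLetter g (perLetter w n) := by
  rw [perLetter_eq_getElem hne]
  exact hw _ (List.getElem_mem _)

theorem vert_add_mul (hne : w ≠ []) (n k : ℤ) :
    vert g w (n + k * w.length) = wordElt g w ^ k * vert g w n := by
  have h := (length_pos_int hne).ne'
  rw [vert, vert, Int.add_mul_emod_self_right, Int.add_mul_ediv_right _ _ h, add_comm, zpow_add,
    mul_assoc]

theorem vert_succ (hne : w ≠ []) (n : ℤ) :
    vert g w (n + 1) = vert g w n * letterElt g (perLetter w n) := by
  have h := length_pos_int hne
  have h1 := Int.emod_nonneg n h.ne'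
  have h2 := Int.emod_lt_of_pos n h
  have h3 := Int.mul_ediv_add_emod n w.length
  rw [perLetter_eq_getElem hne]
  have htake : wordElt g (w.take ((n % w.length).toNat + 1)) = wordElt g
    (w.take (n % w.length).toNat) *
      letterElt g (w[(n % w.length).toNat]'(toNat_emod_lt hne n)) := by
    rw [List.take_add_one, wordElt_append, List.getElem?_eq_getElem (toNat_emod_lt hne n)]
    simp
  by_cases hlt : n % w.length + 1 < w.length
  · have e1 : (n + 1) % w.length = n % w.length + 1 := by
      rw [Int.emod_eq_iff h.ne']
      refine ⟨by omega, by rw [Int.natAbs_natCast]; exact hlt, ⟨-(n / w.length), by linarith⟩⟩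
    have e2 : (n + 1) / w.length = n / w.length := by
      have h4 := Int.mul_ediv_add_emod (n + 1) w.length
      rw [e1] at h4
      exact mul_left_cancel₀ h.ne' (by linarith)
    rw [vert, vert, e1, e2, Int.toNat_add h1 zero_le_one, Int.toNat_one, htake, mul_assoc]
  · have e0 : n % w.length + 1 = w.length := by omega
    have e1 : (n + 1) % w.length = 0 := by
      rw [Int.emod_eq_zero_of_dvd ⟨n / w.length + 1, by linarith⟩]
    have e2 : (n + 1) / w.length = n / w.length + 1 := by
      have h4 := Int.mul_ediv_add_emod (n + 1) w.length
      rw [e1] at h4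
      exact mul_left_cancel₀ h.ne' (by linarith)
    have e3 : (n % w.length).toNat + 1 = w.length := by omega
    rw [e3, List.take_length] at htake
    rw [vert, vert, e1, e2, zpow_add_one, mul_assoc, mul_assoc, ← htake]
    simp

theorem vert_mem (hw : ∀ a ∈ w, IsLetter g a) (n : ℤ) : vert g w n ∈ Gam g :=
  mul_mem (zpow_mem (wordElt_mem hw) _) (wordElt_mem fun a ha => hw a (List.mem_of_mem_take ha))

/-- The subword of length `k` of `⋯ w w w ⋯` that begins with the letter with index `n`. -/
def segment (w : List Letter) (n : ℤ) (k : ℕ) : List Letter :=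
  (List.range k).map fun i : ℕ => perLetter w (n + (i : ℤ))

theorem vert_add_nat (hne : w ≠ []) (n : ℤ) (k : ℕ) :
    vert g w (n + k) = vert g w n * wordElt g (segment w n k) := by
  induction k with
  | zero => simp [segment]
  | succ k ih =>
    have : segment w n (k + 1) = segment w n k ++ [perLetter w (n + k)] := by
      simp [segment, List.range_succ]
    rw [this, wordElt_append, ← mul_assoc, ← ih]
    push_cast
    rw [← add_assoc, vert_succ hne]
    simp

theorem segment_infix (hne : w ≠ []) (n : ℤ) (k : ℕ) : ∃ N, segment w n k <:+: wpow w N := by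
  have h := length_pos_int hne
  set o := (n % w.length).toNat
  have hl : (wpow w (o + k)).length = (o + k) * w.length := length_wpow w _
  have hm : 1 ≤ w.length := by exact_mod_cast h
  have hle : o + k ≤ (wpow w (o + k)).length := by
    rw [hl]
    exact Nat.le_mul_of_pos_right _ hm
  have e : segment w n k = ((wpow w (o + k)).drop o).take k := by
    refine List.ext_getElem ?_ fun i h1 h2 => ?_
    · simp only [segment, List.length_map, List.length_range, List.length_take, List.length_drop]
      omega
    · rw [segment, List.length_map, List.length_range] at h1
      simp only [segment, List.getElem_map, List.getElem_range, List.getElem_take,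
        List.getElem_drop]
      rw [getElem_wpow w _ _ (by omega) (Nat.mod_lt _ hm), perLetter_eq_getElem hne]
      congr 1
      zify
      have h1 := Int.emod_nonneg n h.ne'
      rw [Int.toNat_of_nonneg (Int.emod_nonneg _ h.ne'), Int.toNat_of_nonneg h1]
      simp
  refine ⟨o + k, ?_⟩
  rw [e]
  exact (List.take_prefix _ _).isInfix.trans (List.drop_suffix _ _).isInfix

theorem isDReduced_segment (hg : 2 ≤ g) (hD : IsCyclicallyDReduced g w) (hne : w ≠ []) (n : ℤ)
    (k : ℕ) :
    IsDReduced g (segment w n k) := by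
  obtain ⟨N, hN⟩ := segment_infix hne n k
  exact (hD.wpow hg N).of_infix hN

/-- The edge path does not return to a vertex: a non-empty subword of `⋯ w w w ⋯` is `D`-reduced, so
it does not represent the identity. -/
theorem vert_injective (hg : 2 ≤ g) (hw : ∀ a ∈ w, IsLetter g a) (hD : IsCyclicallyDReduced g w)
    (hne : w ≠ []) : Function.Injective (vert g w) := by
  have key : ∀ (n : ℤ) (k : ℕ), vert g w (n + k) = vert g w n → k = 0 := by
    intro n k h
    rw [vert_add_nat hne, mul_eq_left] at h
    have h1 := IsDReduced.eq_of_wordElt_eq hg (v := []) (fun b hb => ?_) (by simp)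
      (isDReduced_segment hg hD hne n k) (fun l r hl hi => ?_) h
    · simpa [segment] using h1
    · obtain ⟨i, -, rfl⟩ := List.mem_map.1 hb
      exact isLetter_perLetter hw hne _
    · obtain ⟨c, t, rfl, -⟩ := hl.exists_cons hg
      simp at hi
  intro a b h
  rcases le_total a b with hab | hab
  · obtain ⟨k, rfl⟩ := Int.le.dest hab
    simp [key a k h.symm]
  · obtain ⟨k, rfl⟩ := Int.le.dest hab
    simp [key b k h]

theorem perLetter_succ_ne (hg : 2 ≤ g) (hw : ∀ a ∈ w, IsLetter g a) (hD : IsCyclicallyDReduced g w)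
    (hne : w ≠ []) (n : ℤ) : perLetter w (n + 1) ≠ opp (perLetter w n) := by
  intro h
  have h1 := (isDReduced_segment hg hD hne n 2).isTight hg
  refine h1.1 (perLetter w n) (isLetter_perLetter hw hne n) ?_
  rw [← h]
  simp [segment, List.range_succ]

theorem conj_vert (hne : w ≠ []) (n : ℤ) : (vert g w n)⁻¹ * wordElt g w * vert g w n =
    wordElt g (w.rotate (n % w.length).toNat) := by
  rw [wordElt_rotate, Nat.mod_eq_of_lt (toNat_emod_lt hne n), vert]
  group

theorem perLetter_rotate (hne : w ≠ []) {n : ℤ} {i : ℕ} (hi : i < w.length) :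
    perLetter w (n + i) = (w.rotate (n % w.length).toNat)[i]'(by rwa [List.length_rotate]) := by
  have h := length_pos_int hne
  rw [List.getElem_rotate, perLetter_eq_getElem hne]
  congr 1
  zify
  rw [Int.toNat_of_nonneg (Int.emod_nonneg _ h.ne'), Int.toNat_of_nonneg (Int.emod_nonneg _ h.ne')]
  rw [add_comm]
  simp

/-- The edge path of the bi-infinite word `⋯ w w w ⋯`, which runs through an edge in unit time. -/
def path (g : ℕ) (w : List Letter) (t : ℝ) : ℍ :=
  vert g w ⌊t⌋ • edge g (perLetter w ⌊t⌋) (Int.fract t)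

end Path

/-- Gluing a function from functions on the unit intervals. -/
theorem continuous_floor_glue {X : Type*} [TopologicalSpace X] {F : ℤ → ℝ → X}
    (hF : ∀ n, Continuous (F n)) (h : ∀ n, F n 1 = F (n + 1) 0) :
    Continuous fun t : ℝ => F ⌊t⌋ (Int.fract t) := by
  have hlf : LocallyFinite fun n : ℤ => Set.Icc (n : ℝ) (n + 1) := by
    intro x
    refine ⟨Set.Ioo (x - 1) (x + 1), Ioo_mem_nhds (by linarith) (by linarith), ?_⟩
    refine (Set.finite_Icc (⌊x⌋ - 2) (⌊x⌋ + 2)).subset ?_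
    rintro n ⟨y, ⟨h1, h2⟩, h3, h4⟩
    have h5 := Int.floor_le x
    have h6 := Int.lt_floor_add_one x
    have h7 : (n : ℝ) < ((⌊x⌋ + 2 : ℤ) : ℝ) := by push_cast; linarith
    have h8 : ((⌊x⌋ - 2 : ℤ) : ℝ) < n := by push_cast; linarith
    exact ⟨(Int.cast_lt.1 h8).le, (Int.cast_lt.1 h7).le⟩
  refine hlf.continuous ?_ (fun _ => isClosed_Icc) fun n => ?_
  · refine Set.eq_univ_of_forall fun t => Set.mem_iUnion.2 ⟨⌊t⌋, Int.floor_le t, ?_⟩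
    exact (Int.lt_floor_add_one t).le
  · refine ContinuousOn.congr (f := fun t : ℝ => F n (t - n)) ?_ fun t ht => ?_
    · exact ((hF n).comp (by fun_prop)).continuousOn
    · rcases ht.2.eq_or_lt with h1 | h1
      · rw [h1]
        have : ⌊(n : ℝ) + 1⌋ = n + 1 := by
          rw [Int.floor_eq_iff]
          push_cast
          constructor <;> linarith
        simp only [Int.fract, this]
        push_cast
        rw [sub_self, ← h, add_sub_cancel_left]
      · have : ⌊t⌋ = n := Int.floor_eq_iff.2 ⟨ht.1, h1⟩
        simp only [Int.fract, this]

/-- The values of a glued function, including the right ends of the unit intervals. -/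
theorem floor_glue_apply {X : Type*} {F : ℤ → ℝ → X} (h : ∀ n, F n 1 = F (n + 1) 0) (n : ℤ) {τ : ℝ}
    (h0 : 0 ≤ τ) (h1 : τ ≤ 1) : F ⌊n + τ⌋ (Int.fract (n + τ)) = F n τ := by
  rcases h1.eq_or_lt with rfl | h1
  · have : ⌊(n : ℝ) + 1⌋ = n + 1 := by
      rw [Int.floor_eq_iff]
      push_cast
      constructor <;> linarith
    rw [Int.fract, this]
    push_cast
    rw [sub_self, h]
  · have : ⌊(n : ℝ) + τ⌋ = n := Int.floor_eq_iff.2 ⟨by linarith, by linarith⟩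
    rw [Int.fract, this, add_sub_cancel_left]

section Path

variable {g : ℕ} {w : List Letter}

theorem path_glue (hg : 2 ≤ g) (hne : w ≠ []) (n : ℤ) :
    vert g w n • edge g (perLetter w n) 1 = vert g w (n + 1) • edge g (perLetter w (n + 1)) 0 := by
  rw [edge_one hg, edge_zero, vert_succ hne, mul_smul]

theorem continuous_path (hg : 2 ≤ g) (hne : w ≠ []) : Continuous (path g w) :=
  continuous_floor_glue (F := fun n τ => vert g w n • edge g (perLetter w n) τ)
    (fun _ => (continuous_edge g _).const_smul _) (path_glue hg hne)

theorem path_add (hg : 2 ≤ g) (hne : w ≠ []) (n : ℤ) {τ : ℝ} (h0 : 0 ≤ τ) (h1 : τ ≤ 1) :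
    path g w (n + τ) = vert g w n • edge g (perLetter w n) τ :=
  floor_glue_apply (F := fun n τ => vert g w n • edge g (perLetter w n) τ) (path_glue hg hne) n h0
    h1

theorem path_add_mul (hne : w ≠ []) (t : ℝ) (k : ℤ) :
    path g w (t + k * w.length) = wordElt g w ^ k • path g w t := by
  have h1 : t + (k : ℝ) * w.length = t + ((k * w.length : ℤ) : ℝ) := by push_cast; ring
  rw [path, path, h1, Int.floor_add_intCast, Int.fract_add_intCast, vert_add_mul hne,
    perLetter_add_mul, mul_smul]

/-- If a translate of the edge path meets the edge path, then in the translates of two vertices. -/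
theorem path_eq_smul_path (hg : 2 ≤ g) (hw : ∀ a ∈ w, IsLetter g a) (hne : w ≠ []) {ζ : SL(2, ℝ)}
    (hζ : ζ ∈ Gam g) {s t : ℝ} (h : path g w s = ζ • path g w t) :
    (∃ a b : ℤ, ζ * vert g w b = vert g w a ∧ s = a ∧ t = b) ∨
      (∃ a b : ℤ, ζ * vert g w b = vert g w a ∧ perLetter w a = perLetter w b ∧ s - a = t - b) ∨
      ∃ a b : ℤ, ζ * vert g w b = vert g w (a + 1) ∧ perLetter w b = opp (perLetter w a) := by
  rw [path, path, eq_comm, ← mul_smul, ← inv_smul_eq_iff, ← mul_smul] at h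
  have ha := isLetter_perLetter hw hne ⌊t⌋
  have hb := isLetter_perLetter hw hne ⌊s⌋
  have hs := Int.floor_add_fract s
  have ht := Int.floor_add_fract t
  have es := Int.fract_lt_one s
  have et := Int.fract_lt_one t
  rcases eq_of_smul_edge_eq hg (mul_mem (inv_mem (vert_mem hw _)) (mul_mem hζ (vert_mem hw _))) ha
    hb
    (Int.fract_nonneg _) et.le (Int.fract_nonneg _) es.le h with
    ⟨h1, h2, h3⟩ | ⟨h1, h2⟩ | ⟨⟨h1, h2⟩, h3⟩ | ⟨⟨h1, h2⟩, h3⟩ | ⟨⟨h1, h2⟩, h3⟩ | ⟨⟨h1, h2⟩, h3⟩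
  · exact Or.inr (Or.inl ⟨⌊s⌋, ⌊t⌋, (inv_mul_eq_one.1 h1).symm, h2.symm, by linarith⟩)
  · refine Or.inr (Or.inr ⟨⌊s⌋, ⌊t⌋, ?_, h2⟩)
    rw [vert_succ hne, ← h1, mul_inv_cancel_left]
  · exact Or.inl ⟨⌊s⌋, ⌊t⌋, (inv_mul_eq_one.1 h3).symm, by linarith, by linarith⟩
  · linarith
  · linarith
  · linarith

/-- The edge path is injective, as its vertices are distinct and it does not turn back. -/
theorem path_injective (hg : 2 ≤ g) (hw : ∀ a ∈ w, IsLetter g a) (hD : IsCyclicallyDReduced g w)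
    (hne : w ≠ []) : Function.Injective (path g w) := by
  intro s t h
  have hinj := vert_injective hg hw hD hne
  rcases path_eq_smul_path hg hw hne (one_mem _) (s := s) (t := t) (by rw [one_smul, h]) with
    ⟨a, b, h1, h2, h3⟩ | ⟨a, b, h1, h2, h3⟩ | ⟨a, b, h1, h2⟩
  · rw [one_mul] at h1
    rw [h2, h3, hinj h1]
  · rw [one_mul] at h1
    rw [hinj h1] at h3
    linarith
  · rw [one_mul] at h1
    rw [hinj h1] at h2
    exact absurd h2 (perLetter_succ_ne hg hw hD hne a)

theorem vert_shift (hne : w ≠ []) {ζ : SL(2, ℝ)} {a b : ℤ} (h : ζ * vert g w b = vert g w a)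
    (hu : ∀ i, perLetter w (a + i) = perLetter w (b + i)) (i : ℤ) :
    ζ * vert g w (b + i) = vert g w (a + i) := by
  induction i with
  | zero => simpa using h
  | succ i ih => rw [← add_assoc, ← add_assoc, vert_succ hne, vert_succ hne, ← mul_assoc, ih, hu]
  | pred i ih =>
    have e1 : b + -(i : ℤ) = b + (-(i : ℤ) - 1) + 1 := by ring
    have e2 : a + -(i : ℤ) = a + (-(i : ℤ) - 1) + 1 := by ring
    rw [e1, e2, vert_succ hne, vert_succ hne, ← mul_assoc, hu] at ih
    exact mul_right_cancel ih

theorem path_shift (hne : w ≠ []) {ζ : SL(2, ℝ)} {a b : ℤ} (h : ζ * vert g w b = vert g w a)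
    (hu : ∀ i, perLetter w (a + i) = perLetter w (b + i)) (t : ℝ) :
    ζ • path g w t = path g w (t + (a - b : ℤ)) := by
  rw [path, path, Int.floor_add_intCast, Int.fract_add_intCast, ← mul_smul]
  have h1 := vert_shift hne h hu (⌊t⌋ - b)
  have h2 := hu (⌊t⌋ - b)
  rw [add_sub_cancel] at h1 h2
  rw [h1, ← h2, show a + (⌊t⌋ - b) = ⌊t⌋ + (a - b) by ring]

theorem perLetter_eq_of_rotate_eq (hne : w ≠ []) {a b : ℤ}
    (h : w.rotate (a % w.length).toNat = w.rotate (b % w.length).toNat) (i : ℤ) :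
    perLetter w (a + i) = perLetter w (b + i) := by
  have hpos := length_pos_int hne
  have h1 := Int.emod_nonneg i hpos.ne'
  have h2 := toNat_emod_lt hne i
  have h3 := Int.mul_ediv_add_emod i w.length
  have key : ∀ c : ℤ, perLetter w (c + i) = perLetter w (c + (i % w.length).toNat) := by
    intro c
    rw [← perLetter_add_mul (c + ((i % w.length).toNat : ℤ)) (i / w.length), Int.toNat_of_nonneg h1]
    congr 1
    linarith
  rw [key, key, perLetter_rotate hne h2, perLetter_rotate hne h2]
  simp only [h]

theorem wpow_injective {u v : List Letter} (hl : u.length = v.length) {n : ℕ} (hn : n ≠ 0)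
    (h : wpow u n = wpow v n) : u = v := by
  obtain ⟨k, rfl⟩ := Nat.exists_eq_succ_of_ne_zero hn
  rw [wpow_succ, wpow_succ] at h
  exact (List.append_inj h hl).1

/-- An element of the group whose square is a power of the translation along the edge path, and
which moves a vertex of the path to a vertex of the path, shifts the path: rotations of `w` with
conjugate powers have equal powers, as normal forms are unique. -/
theorem exists_shift (hg : 2 ≤ g) (hw : ∀ a ∈ w, IsLetter g a) (hD : IsCyclicallyDReduced g w)
    (hne : w ≠ []) {ζ : SL(2, ℝ)} (hζ : ζ ∈ Gam g) {k : ℤ} (hk : ζ * ζ = wordElt g w ^ k) {a b : ℤ}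
    (hab : ζ * vert g w b = vert g w a) : ∃ c : ℤ, ∀ t, ζ • path g w t = path g w (t + c) := by
  by_cases hk0 : k = 0
  · rw [hk0, zpow_zero, ← sq] at hk
    rw [eq_one_of_pow_eq_one hg hζ two_ne_zero hk]
    exact ⟨0, fun t => by simp⟩
  have hconj : wordElt g (w.rotate (a % w.length).toNat) ^ k =
      wordElt g (w.rotate (b % w.length).toNat) ^ k := by
    have hz : ∀ (x y : SL(2, ℝ)), (x⁻¹ * y * x) ^ k = x⁻¹ * y ^ k * x := by
      intro x y
      have := conj_zpow (a := x⁻¹) (b := y) (i := k)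
      rwa [inv_inv] at this
    rw [← conj_vert hne, ← conj_vert hne, hz, hz, ← hab, ← hk]
    group
  have hnat : wordElt g (w.rotate (a % w.length).toNat) ^ k.natAbs =
      wordElt g (w.rotate (b % w.length).toNat) ^ k.natAbs := by
    rcases Int.natAbs_eq k with e | e
    · rw [e, zpow_natCast, zpow_natCast] at hconj
      exact hconj
    · rw [e, zpow_neg, zpow_neg, zpow_natCast, zpow_natCast, inv_inj] at hconj
      exact hconj
  rw [← wordElt_wpow, ← wordElt_wpow] at hnat
  have hrot : ∀ n, IsCyclicallyDReduced g (w.rotate n) := fun n k => by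
    rw [List.rotate_rotate]
    exact hD _
  have hlet : ∀ n N, ∀ b ∈ wpow (w.rotate n) N, IsLetter g b := fun n N b hb =>
    hw b (List.mem_rotate.1 (mem_of_mem_wpow hb))
  have h1 := IsDReduced.eq_of_wordElt_eq hg (hlet _ _) (hlet _ _) ((hrot _).wpow hg _)
    ((hrot _).wpow hg _) hnat
  have h2 := wpow_injective (by simp) (Int.natAbs_ne_zero.2 hk0) h1
  exact ⟨a - b, path_shift hne hab (perLetter_eq_of_rotate_eq hne h2)⟩

end Path

/-! ### A parallel of the edge path on its left -/

/-- The normal of the plane through the edge of a letter, pointing to the left. -/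
def leftNormal (g : ℕ) (a : Letter) : ℝ × ℝ × ℝ := (0, -Real.sin (ang g a), Real.cos (ang g a))

theorem lact_leftNormal {g : ℕ} (hg : 2 ≤ g) (a : Letter) :
    lact (letterElt g a) (leftNormal g a) = leftNormal g a := by
  rw [lact_letterElt hg]
  have h := Real.sin_sq_add_cos_sq (ang g a)
  simp only [boost, leftNormal, dco, wco]
  refine Prod.ext ?_ (Prod.ext ?_ ?_) <;> dsimp only
  · ring
  · linear_combination -Real.sin (ang g a) * h
  · linear_combination Real.cos (ang g a) * h

theorem lprod_add_left (u v w : ℝ × ℝ × ℝ) : lprod (u + v) w = lprod u w + lprod v w := by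
  simp only [lprod, Prod.fst_add, Prod.snd_add]
  ring

theorem lprod_smul_left (r : ℝ) (v w : ℝ × ℝ × ℝ) : lprod (r • v) w = r * lprod v w := by
  simp only [lprod, Prod.smul_fst, Prod.smul_snd, smul_eq_mul]
  ring

theorem lprod_edgeVec_leftNormal (g : ℕ) (a b : Letter) (τ : ℝ) :
    lprod (edgeVec g a τ) (leftNormal g b) =
      -Real.sinh (τ * edgeLen g) * Real.sin (ang g a - ang g b) := by
  simp only [lprod, edgeVec, leftNormal, Real.sin_sub]
  ring

theorem lprod_leftNormal (g : ℕ) (a b : Letter) :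
    lprod (leftNormal g a) (leftNormal g b) = -Real.cos (ang g a - ang g b) := by
  simp only [lprod, leftNormal, Real.cos_sub]
  ring

theorem neg_one_lt_cos {g : ℕ} (hg : 2 ≤ g) {a b : Letter} (ha : IsLetter g a) (hb : IsLetter g b)
    (hab : b ≠ opp a) : -1 < Real.cos (ang g b - ang g a) := by
  refine lt_of_le_of_ne (Real.neg_one_le_cos _) fun h => hab ?_
  rw [eq_comm, Real.cos_eq_neg_one_iff] at h
  obtain ⟨k, hk⟩ := h
  obtain ⟨l, hl⟩ := dir_opp g a
  refine dir_injective hb ha.opp ⟨k - l, ?_⟩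
  have h2 := mul_stepAngle hg
  have h3 := stepAngle_pos hg
  simp only [ang] at hk
  rw [← h2] at hk
  have h4 : stepAngle g * ((dir g b : ℝ) - (dir g a + 2 * g + 4 * g * k)) = 0 := by
    linear_combination -hk
  have h5 := (mul_eq_zero.1 h4).resolve_left h3.ne'
  have h6 : dir g b = dir g a + 2 * g + 4 * g * k := by
    have h6 : (dir g b : ℝ) = dir g a + 2 * g + 4 * g * k := by linarith
    exact_mod_cast h6
  rw [h6, hl]
  ring

/-- A point moved to the left of an edge is not on the edge. -/
theorem edgeVec_add_ne_smul {g : ℕ} (hg : 2 ≤ g) {a b : Letter} (ha : IsLetter g a)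
    (hb : IsLetter g b)
    (hab : b ≠ opp a) {σ τ θ χ r : ℝ} (hθ : 0 < θ) (h0 : 0 ≤ χ) (h1 : χ ≤ 1) {M : ℝ × ℝ × ℝ}
    (hM : lprod M (leftNormal g a) = -Real.cos (ang g b - ang g a)) :
    edgeVec g a σ + θ • (leftNormal g a + χ • M) ≠ r • edgeVec g a τ := by
  intro h
  have h2 := congrArg (fun v => lprod v (leftNormal g a)) h
  have h3 := neg_one_lt_cos hg ha hb hab
  simp only [lprod_add_left, lprod_smul_left, lprod_edgeVec_leftNormal, lprod_leftNormal, sub_self,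
    Real.sin_zero, Real.cos_zero, hM] at h2
  have h4 : 0 < 1 + χ * Real.cos (ang g b - ang g a) := by
    rcases h0.eq_or_lt with rfl | h0
    · simp
    · nlinarith
  nlinarith

/-- A point of the second edge of a corner, moved to the left, is not on the first edge. -/
theorem corner_ne_smul {g : ℕ} (hg : 2 ≤ g) {a b : Letter} (ha : IsLetter g a) (hb : IsLetter g b)
    (hab : b ≠ opp a) {σ τ θ r : ℝ} (hσ : 0 ≤ σ) (hτ : 0 ≤ τ) (hθ : 0 < θ) (hr : 0 < r) :
    edgeVec g b σ + θ • (leftNormal g b + leftNormal g a) ≠ r • edgeVec g (opp a) τ := by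
  intro h
  have ha2 := congrArg (fun v => lprod v (leftNormal g (opp a))) h
  have hb2 := congrArg (fun v => lprod v (leftNormal g b)) h
  have h3 := neg_one_lt_cos hg ha hb hab
  have hL := edgeLen_pos hg
  have hs1 : 0 ≤ Real.sinh (σ * edgeLen g) := Real.sinh_nonneg_iff.2 (by positivity)
  have hs2 : 0 ≤ Real.sinh (τ * edgeLen g) := Real.sinh_nonneg_iff.2 (by positivity)
  obtain ⟨t1, t2⟩ := trig_opp hg a
  have e1 : Real.sin (ang g b - ang g (opp a)) = -Real.sin (ang g b - ang g a) := by
    rw [Real.sin_sub, Real.sin_sub, t1, t2]; ring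
  have e2 : Real.sin (ang g (opp a) - ang g b) = Real.sin (ang g b - ang g a) := by
    rw [Real.sin_sub, Real.sin_sub, t1, t2]; ring
  have e3 : Real.cos (ang g b - ang g (opp a)) = -Real.cos (ang g b - ang g a) := by
    rw [Real.cos_sub, Real.cos_sub, t1, t2]; ring
  have e4 : Real.cos (ang g a - ang g (opp a)) = -1 := by
    rw [Real.cos_sub, t1, t2]
    linear_combination -Real.sin_sq_add_cos_sq (ang g a)
  have e5 : Real.cos (ang g a - ang g b) = Real.cos (ang g b - ang g a) := by
    rw [← Real.cos_neg, neg_sub]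
  simp only [lprod_add_left, lprod_smul_left, lprod_edgeVec_leftNormal, lprod_leftNormal, sub_self,
    Real.sin_zero, Real.cos_zero, e1, e2, e3, e4, e5] at ha2 hb2
  have h4 := mul_pos hθ (by linarith : 0 < 1 + Real.cos (ang g b - ang g a))
  -- at a left turn the point is on the left of the first line, at a right turn the first edge is on
  -- the right of the second line
  rcases le_total 0 (Real.sin (ang g b - ang g a)) with hs | hs
  · have := mul_nonneg hs1 hs
    linarith
  · have := mul_nonneg (mul_nonneg hr.le hs2) (neg_nonneg.2 hs)
    linarith

/-- A point of the first edge of a corner, moved to the left, is not on the second edge. -/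
theorem corner_ne_smul' {g : ℕ} (hg : 2 ≤ g) {a b : Letter} (ha : IsLetter g a) (hb : IsLetter g b)
    (hab : b ≠ opp a) {σ τ θ r : ℝ} (hσ : 0 ≤ σ) (hτ : 0 ≤ τ) (hθ : 0 < θ) (hr : 0 < r) :
    edgeVec g (opp a) σ + θ • (leftNormal g a + leftNormal g b) ≠ r • edgeVec g b τ := by
  intro h
  have ha2 := congrArg (fun v => lprod v (leftNormal g a)) h
  have hb2 := congrArg (fun v => lprod v (leftNormal g b)) h
  have h3 := neg_one_lt_cos hg ha hb hab
  have hL := edgeLen_pos hg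
  have hs1 : 0 ≤ Real.sinh (σ * edgeLen g) := Real.sinh_nonneg_iff.2 (by positivity)
  have hs2 : 0 ≤ Real.sinh (τ * edgeLen g) := Real.sinh_nonneg_iff.2 (by positivity)
  obtain ⟨t1, t2⟩ := trig_opp hg a
  have e1 : Real.sin (ang g (opp a) - ang g a) = 0 := by
    rw [Real.sin_sub, t1, t2]; ring
  have e2 : Real.sin (ang g (opp a) - ang g b) = Real.sin (ang g b - ang g a) := by
    rw [Real.sin_sub, Real.sin_sub, t1, t2]; ring
  have e5 : Real.cos (ang g a - ang g b) = Real.cos (ang g b - ang g a) := by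
    rw [← Real.cos_neg, neg_sub]
  simp only [lprod_add_left, lprod_smul_left, lprod_edgeVec_leftNormal, lprod_leftNormal, sub_self,
    Real.sin_zero, Real.cos_zero, e1, e2, e5] at ha2 hb2
  have h4 := mul_pos hθ (by linarith : 0 < 1 + Real.cos (ang g b - ang g a))
  rcases le_total 0 (Real.sin (ang g b - ang g a)) with hs | hs
  · have := mul_nonneg hs1 hs
    linarith
  · have := mul_nonneg (mul_nonneg hr.le hs2) (neg_nonneg.2 hs)
    linarith

/-- A cutoff function that is `1` on `[0, 1/4]` and vanishes on `[1/2, 1]`. -/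
def cutoff (τ : ℝ) : ℝ := max 0 (min 1 (2 - 4 * τ))

theorem cutoff_nonneg (τ : ℝ) : 0 ≤ cutoff τ := le_max_left _ _

theorem cutoff_le_one (τ : ℝ) : cutoff τ ≤ 1 := max_le zero_le_one (min_le_left _ _)

theorem cutoff_eq_one {τ : ℝ} (h : τ ≤ 1 / 4) : cutoff τ = 1 := by
  rw [cutoff, min_eq_left (by linarith), max_eq_right zero_le_one]

theorem cutoff_eq_zero {τ : ℝ} (h : 1 / 2 ≤ τ) : cutoff τ = 0 :=
  max_eq_left ((min_le_right _ _).trans (by linarith))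

theorem continuous_cutoff : Continuous cutoff := by
  unfold cutoff
  fun_prop

theorem continuous_lact (A : SL(2, ℝ)) : Continuous (lact A) := by
  unfold lact
  fun_prop

/-- The normal direction along the edge with index `n`, in the frame of its initial vertex: near a
corner, it is the sum of the normals of both edges. -/
def relNormal (g : ℕ) (w : List Letter) (n : ℤ) (τ : ℝ) : ℝ × ℝ × ℝ :=
  leftNormal g (perLetter w n) + cutoff τ • leftNormal g (perLetter w (n - 1)) +
    cutoff (1 - τ) • lact (letterElt g (perLetter w n)) (leftNormal g (perLetter w (n + 1)))

/-- The normal direction along the edge path. -/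
def pathNormal (g : ℕ) (w : List Letter) (t : ℝ) : ℝ × ℝ × ℝ :=
  lact (vert g w ⌊t⌋) (relNormal g w ⌊t⌋ (Int.fract t))

section Path

variable {g : ℕ} {w : List Letter}

theorem continuous_relNormal (n : ℤ) : Continuous (relNormal g w n) := by
  have := continuous_cutoff
  unfold relNormal
  fun_prop

theorem normal_glue (hg : 2 ≤ g) (hne : w ≠ []) (n : ℤ) :
    lact (vert g w n) (relNormal g w n 1) = lact (vert g w (n + 1)) (relNormal g w (n + 1) 0) := by
  rw [vert_succ hne, lact_mul, relNormal, relNormal, sub_self, sub_zero,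
    cutoff_eq_one (τ := 0) (by norm_num), cutoff_eq_zero (τ := 1) (by norm_num),
      add_sub_cancel_right,
    zero_smul, zero_smul, one_smul, one_smul, add_zero, add_zero, lact_add (letterElt g _),
    lact_leftNormal hg, add_comm]

theorem continuous_pathNormal (hg : 2 ≤ g) (hne : w ≠ []) : Continuous (pathNormal g w) :=
  continuous_floor_glue (F := fun n τ => lact (vert g w n) (relNormal g w n τ))
    (fun n => (continuous_lact _).comp (continuous_relNormal n)) (normal_glue hg hne)

theorem pathNormal_add_mul (hne : w ≠ []) (t : ℝ) (k : ℤ) :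
    pathNormal g w (t + k * w.length) = lact (wordElt g w ^ k) (pathNormal g w t) := by
  have h1 : t + (k : ℝ) * w.length = t + ((k * w.length : ℤ) : ℝ) := by push_cast; ring
  rw [pathNormal, pathNormal, h1, Int.floor_add_intCast, Int.fract_add_intCast, vert_add_mul hne,
    lact_mul]
  simp only [relNormal]
  rw [perLetter_add_mul, add_sub_right_comm, perLetter_add_mul,
    add_right_comm ⌊t⌋ (k * (w.length : ℤ)) 1, perLetter_add_mul]

theorem lact_injective (A : SL(2, ℝ)) : Function.Injective (lact A) := fun v v' h => by
  rw [← lact_one v, ← inv_mul_cancel A, lact_mul, h, ← lact_mul, inv_mul_cancel, lact_one]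

/-- The edge path, moved to the left, is locally disjoint from the edge path. -/
theorem lor_path_add_ne_smul (hg : 2 ≤ g) (hw : ∀ a ∈ w, IsLetter g a)
    (hD : IsCyclicallyDReduced g w) (hne : w ≠ []) {s t θ r : ℝ} (hst : |s - t| < 1 / 4)
      (hθ : 0 < θ)
    (hr : 0 < r) : lor (path g w t) + θ • pathNormal g w t ≠ r • lor (path g w s) := by
  rw [abs_lt] at hst
  have hlet := isLetter_perLetter hw hne
  have hsucc := perLetter_succ_ne hg hw hD hne
  obtain ⟨n, τ, h0, h1, rfl⟩ : ∃ (n : ℤ) (τ : ℝ), 0 ≤ τ ∧ τ < 1 ∧ t = n + τ :=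
    ⟨⌊t⌋, Int.fract t, Int.fract_nonneg t, Int.fract_lt_one t, (Int.floor_add_fract t).symm⟩
  have e1 := path_add hg hne n h0 h1.le
  have e2 : pathNormal g w (n + τ) = lact (vert g w n) (relNormal g w n τ) :=
    floor_glue_apply (F := fun n τ => lact (vert g w n) (relNormal g w n τ)) (normal_glue hg hne) n
      h0
      h1.le
  rw [e1, e2, lor_smul, lor_edge, ← lact_smul, ← lact_add]
  have hprev := hsucc (n - 1)
  rw [sub_add_cancel] at hprev
  by_cases h2 : s < n
  · -- the other point is on the previous edge
    obtain ⟨τ', h3, h4, rfl⟩ : ∃ τ' : ℝ, 0 ≤ τ' ∧ τ' ≤ 1 ∧ s = (n - 1 : ℤ) + τ' := by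
      refine ⟨s - n + 1, by linarith, by linarith, ?_⟩
      push_cast
      ring
    have e3 : letterElt g (perLetter w (n - 1)) • edge g (opp (perLetter w (n - 1))) (1 - τ') =
        edge g (perLetter w (n - 1)) τ' := by rw [letterElt_smul_edge hg, sub_sub_cancel]
    have e4 := vert_succ (g := g) hne (n - 1)
    rw [sub_add_cancel] at e4
    rw [path_add hg hne _ h3 h4, ← e3, ← mul_smul, ← e4, lor_smul, lor_edge, ← lact_smul,
      (lact_injective _).ne_iff, relNormal, cutoff_eq_one (by push_cast at hst; linarith), one_smul,
      cutoff_eq_zero (by push_cast at hst; linarith), zero_smul, add_zero]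
    exact corner_ne_smul hg (hlet _) (hlet _) hprev h0 (by linarith) hθ hr
  by_cases h3 : s ≤ n + 1
  · -- both points are on the same edge
    obtain ⟨τ', h6, h4, rfl⟩ : ∃ τ' : ℝ, 0 ≤ τ' ∧ τ' ≤ 1 ∧ s = n + τ' :=
      ⟨s - n, by linarith, by linarith, by ring⟩
    rw [path_add hg hne _ h6 h4, lor_smul, lor_edge, ← lact_smul, (lact_injective _).ne_iff,
      relNormal]
    rcases le_total τ (1 / 2) with h5 | h5
    · rw [cutoff_eq_zero (τ := 1 - τ) (by linarith), zero_smul, add_zero]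
      refine edgeVec_add_ne_smul hg (hlet n) (hlet (n - 1)).opp.opp (fun h => hprev ?_) hθ
        (cutoff_nonneg _) (cutoff_le_one _) ?_
      · rw [← opp_opp (perLetter w n), ← h, opp_opp]
      · rw [opp_opp, lprod_leftNormal]
    · rw [cutoff_eq_zero h5, zero_smul, add_zero]
      refine edgeVec_add_ne_smul hg (hlet n) (hlet (n + 1)) (hsucc n) hθ
        (cutoff_nonneg _) (cutoff_le_one _) ?_
      conv_lhs => rw [← lact_leftNormal hg (perLetter w n), lprod_lact]
      rw [lprod_leftNormal]
  · -- the other point is on the next edge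
    push Not at h3
    obtain ⟨τ', h6, h4, rfl⟩ : ∃ τ' : ℝ, 0 ≤ τ' ∧ τ' ≤ 1 ∧ s = (n + 1 : ℤ) + τ' := by
      refine ⟨s - n - 1, by linarith, by linarith, ?_⟩
      push_cast
      ring
    have e3 : edgeVec g (perLetter w n) τ =
        lact (letterElt g (perLetter w n)) (edgeVec g (opp (perLetter w n)) (1 - τ)) := by
      rw [← lor_edge, ← lor_edge, ← lor_smul, letterElt_smul_edge hg, sub_sub_cancel]
    have e4 : relNormal g w n τ = lact (letterElt g (perLetter w n))
        (leftNormal g (perLetter w n) + leftNormal g (perLetter w (n + 1))) := by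
      rw [relNormal, cutoff_eq_one (τ := 1 - τ) (by push_cast at hst; linarith), one_smul,
        cutoff_eq_zero (by push_cast at hst; linarith), zero_smul, add_zero, lact_add,
        lact_leftNormal hg]
    rw [path_add hg hne _ h6 h4, vert_succ hne, mul_smul, lor_smul, lor_smul, lor_edge, e3, e4,
      ← lact_smul, ← lact_add, ← lact_smul, ← lact_smul, (lact_injective _).ne_iff,
      (lact_injective _).ne_iff]
    exact corner_ne_smul' hg (hlet _) (hlet _) (hsucc n) (by linarith) h6 hθ hr

/-- The parallel of the edge path with parameter `θ`. -/
def parallel (g : ℕ) (w : List Letter) (t θ : ℝ) : ℍ :=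
  ofVec (lor (path g w t) + θ • pathNormal g w t)

theorem parallel_vec_add_mul (hne : w ≠ []) (t θ : ℝ) (k : ℤ) :
    lor (path g w (t + k * w.length)) + θ • pathNormal g w (t + k * w.length) =
      lact (wordElt g w ^ k) (lor (path g w t) + θ • pathNormal g w t) := by
  rw [path_add_mul hne, pathNormal_add_mul hne, lor_smul, lact_add, lact_smul]

theorem continuous_parallel_vec (hg : 2 ≤ g) (hne : w ≠ []) : Continuous fun p : ℝ × ℝ =>
    lor (path g w p.1) + p.2 • pathNormal g w p.1 := by
  have h1 := continuous_path hg hne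
  have h2 := continuous_pathNormal hg hne
  have h3 := continuous_lor
  fun_prop

theorem parallel_ne (hg : 2 ≤ g) (hw : ∀ a ∈ w, IsLetter g a)
    (hD : IsCyclicallyDReduced g w) (hne : w ≠ []) {s t θ : ℝ} (hst : |s - t| < 1 / 4) (hθ : 0 < θ)
    (ht : Timelike (lor (path g w t) + θ • pathNormal g w t)) : parallel g w t θ ≠ path g w s := by
  intro h
  refine lor_path_add_ne_smul hg hw hD hne hst hθ (Real.sqrt_pos.2 ht.2) ?_
  rw [← h, parallel]
  exact ht.eq_smul

end Path

/-! ### Liftings and common value classes -/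

theorem proj_eq_proj {g : ℕ} {z z' : ℍ} : proj g z = proj g z' ↔ ∃ γ ∈ Gam g, z = γ • z' := by
  rw [proj, proj, Quotient.eq]
  constructor
  · rintro ⟨γ, h⟩
    exact ⟨γ, γ.2, h.symm⟩
  · rintro ⟨γ, hγ, h⟩
    exact ⟨⟨γ, hγ⟩, h.symm⟩

theorem continuous_proj (g : ℕ) : Continuous (proj g) := continuous_quotient_mk'

theorem proj_smul {g : ℕ} {γ : SL(2, ℝ)} (hγ : γ ∈ Gam g) (z : ℍ) : proj g (γ • z) = proj g z :=
  proj_eq_proj.2 ⟨γ, hγ, rfl⟩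

theorem circleCover_eq {s t : ℝ} : circleCover s = circleCover t ↔ ∃ k : ℤ, s = t + k := by
  have hpi := Real.pi_pos
  rw [circleCover, circleCover, Circle.exp_eq_exp]
  refine exists_congr fun k => ⟨fun h => ?_, fun h => by rw [h]; ring⟩
  have : 2 * Real.pi * (s - (t + k)) = 0 := by linarith
  linarith [(mul_eq_zero.1 this).resolve_left (by positivity)]

theorem circleCover_add (s t : ℝ) : circleCover (s + t) = circleCover s * circleCover t := by
  rw [circleCover, mul_add, Circle.exp_add]
  rfl

theorem circleCover_zero : circleCover 0 = 1 := by simp [circleCover]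

theorem circleCover_add_intCast (t : ℝ) (k : ℤ) : circleCover (t + k) = circleCover t :=
  circleCover_eq.2 ⟨k, rfl⟩

theorem isOpenQuotientMap_circleCover : IsOpenQuotientMap circleCover := by
  have hpi := Real.pi_pos
  have e : circleCover = Circle.exp ∘ (Homeomorph.mulLeft₀ (2 * Real.pi) (by positivity)) := rfl
  rw [e]
  exact (IsOpenQuotientMap.mk Circle.exp_surjective Circle.exp.continuous
    isLocalHomeomorph_circleExp.isOpenMap).comp (Homeomorph.isOpenQuotientMap _)

/-- Two liftings of a loop differ by an element of the group. -/
theorem exists_smul_of_proj_eq {g : ℕ} (hg : 2 ≤ g) {Φ Ψ : ℝ → ℍ} (hΦ : Continuous Φ)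
    (hΨ : Continuous Ψ)
    (h : ∀ t, proj g (Φ t) = proj g (Ψ t)) : ∃ γ ∈ Gam g, ∀ t, Φ t = γ • Ψ t := by
  obtain ⟨γ, hγ, h0⟩ := proj_eq_proj.1 (h 0)
  refine ⟨γ, hγ, fun t => ?_⟩
  have hclopen : IsClopen {t | Φ t = γ • Ψ t} := by
    refine ⟨isClosed_eq hΦ (hΨ.const_smul γ), ?_⟩
    rw [isOpen_iff_mem_nhds]
    intro t₀ ht₀
    obtain ⟨c, hc, hd⟩ := exists_displacement hg (isCompact_closedBall (γ • Ψ t₀) 1)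
    have h1 : ∀ᶠ t in nhds t₀, dist (γ • Ψ t) (γ • Ψ t₀) < 1 :=
      (hΨ.const_smul γ).continuousAt.eventually (Metric.ball_mem_nhds _ one_pos)
    have h2 : ∀ᶠ t in nhds t₀, dist (Φ t) (γ • Ψ t) < c := by
      have h3 : ContinuousAt (fun t => dist (Φ t) (γ • Ψ t)) t₀ :=
        (hΦ.dist (hΨ.const_smul γ)).continuousAt
      refine h3.eventually_lt_const ?_
      dsimp only
      rw [show Φ t₀ = γ • Ψ t₀ from ht₀, dist_self]
      exact hc
    filter_upwards [h1, h2] with t h3 h4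
    obtain ⟨δ, hδ, e⟩ := proj_eq_proj.1 (h t)
    have e' : Φ t = (δ * γ⁻¹) • γ • Ψ t := by rw [mul_smul, inv_smul_smul, e]
    by_cases h5 : δ * γ⁻¹ = 1
    · rw [h5, one_smul] at e'
      exact e'
    · rw [e'] at h4
      exact absurd (hd _ (mul_mem hδ (inv_mem hγ)) h5 _ (Metric.mem_closedBall.2 h3.le)) h4.not_ge
  have := hclopen.eq_univ ⟨0, h0⟩
  exact this.ge (Set.mem_univ t)

/-- `Φ` is a lifting of `φ`, and `h` is the element of the group by which its values at `t + 1` and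
`t` differ. -/
structure IsLiftingWith {g : ℕ} (φ : C(Circle, Surface g)) (Φ : ℝ → ℍ) (h : SL(2, ℝ)) : Prop where
  lifting : IsLifting φ Φ
  mem : h ∈ Gam g
  add_one : ∀ t, Φ (t + 1) = h • Φ t

/-- The common value class of `Φ` and `η • Φ`. -/
def classOf (Φ : ℝ → ℍ) (η : SL(2, ℝ)) : Set (Circle × Circle) :=
  Prod.map circleCover circleCover '' {x | Φ x.1 = η • Φ x.2}

section Lift

variable {g : ℕ} {φ : C(Circle, Surface g)} {Φ : ℝ → ℍ} {h : SL(2, ℝ)}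

theorem IsLiftingWith.add_int (H : IsLiftingWith φ Φ h) (t : ℝ) (k : ℤ) :
    Φ (t + k) = h ^ k • Φ t := by
  induction k with
  | zero => simp
  | succ k ih =>
    push_cast at ih ⊢
    rw [← add_assoc, H.add_one, ih, ← mul_smul, ← zpow_one_add, add_comm]
  | pred k ih =>
    push_cast at ih ⊢
    have := H.add_one (t + (-(k : ℝ) - 1))
    rw [show t + (-(k : ℝ) - 1) + 1 = t + -(k : ℝ) by ring, ih] at this
    rw [← inv_smul_eq_iff.2 this, ← mul_smul, ← zpow_neg_one, ← zpow_add, add_comm, sub_eq_add_neg]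

theorem IsLiftingWith.eq_iff (H : IsLiftingWith φ Φ h) {s t : ℝ} :
    φ (circleCover s) = φ (circleCover t) ↔ ∃ γ ∈ Gam g, Φ s = γ • Φ t := by
  rw [← H.lifting.2, ← H.lifting.2, proj_eq_proj]

theorem IsLiftingWith.exists_classOf (hg : 2 ≤ g) (H : IsLiftingWith φ Φ h)
    {C : Set (Circle × Circle)}
    (hC : IsCommonValueClass φ φ C) : C.Nonempty ∧ ∃ η ∈ Gam g, C = classOf Φ η := by
  obtain ⟨hne, Φ₁, Φ₂, h1, h2, rfl⟩ := hC
  obtain ⟨γ₁, m1, e1⟩ := exists_smul_of_proj_eq hg h1.1 H.lifting.1 fun t => by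
    rw [h1.2, H.lifting.2]
  obtain ⟨γ₂, m2, e2⟩ := exists_smul_of_proj_eq hg h2.1 H.lifting.1 fun t => by
    rw [h2.2, H.lifting.2]
  refine ⟨hne, γ₁⁻¹ * γ₂, mul_mem (inv_mem m1) m2, ?_⟩
  rw [classOf]
  congr 1
  ext x
  rw [cvp, Set.mem_ofPred_eq, Set.mem_ofPred_eq, e1, e2, mul_smul, eq_inv_smul_iff]

theorem IsLiftingWith.isCommonValueClass (H : IsLiftingWith φ Φ h) {η : SL(2, ℝ)} (hη : η ∈ Gam g)
    (hne : (classOf Φ η).Nonempty) : IsCommonValueClass φ φ (classOf Φ η) :=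
  ⟨hne, Φ, fun t => η • Φ t, H.lifting,
    ⟨H.lifting.1.const_smul η, fun t => by rw [proj_smul hη, H.lifting.2]⟩, rfl⟩

theorem IsLiftingWith.mem_classOf (H : IsLiftingWith φ Φ h) {η : SL(2, ℝ)} {s t : ℝ} :
    (circleCover s, circleCover t) ∈ classOf Φ η ↔
      ∃ a b : ℤ, Φ s = (h ^ a * η * h ^ b) • Φ t := by
  constructor
  · rintro ⟨⟨s', t'⟩, hst, e⟩
    rw [Prod.map_apply, Prod.mk.injEq] at e
    obtain ⟨a, ha⟩ := circleCover_eq.1 e.1.symm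
    obtain ⟨b, hb⟩ := circleCover_eq.1 e.2
    refine ⟨a, b, ?_⟩
    have hst' : Φ s' = η • Φ t' := hst
    rw [ha, H.add_int, hst', hb, H.add_int, mul_smul, mul_smul]
  · rintro ⟨a, b, e⟩
    refine ⟨(s + (-a : ℤ), t + b), ?_, ?_⟩
    · change Φ (s + (-a : ℤ)) = η • Φ (t + b)
      rw [H.add_int, H.add_int, e, ← mul_smul, ← mul_smul]
      congr 1
      group
    · rw [Prod.map_apply, circleCover_add_intCast, circleCover_add_intCast]

theorem IsLiftingWith.classOf_shift (H : IsLiftingWith φ Φ h) (η : SL(2, ℝ)) (a b : ℤ) :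
    classOf Φ (h ^ a * η * h ^ b) = classOf Φ η := by
  ext ⟨x, y⟩
  obtain ⟨s, rfl⟩ := isOpenQuotientMap_circleCover.surjective x
  obtain ⟨t, rfl⟩ := isOpenQuotientMap_circleCover.surjective y
  rw [H.mem_classOf, H.mem_classOf]
  constructor
  · rintro ⟨a', b', e⟩
    refine ⟨a' + a, b + b', ?_⟩
    rw [e]
    congr 1
    group
  · rintro ⟨a', b', e⟩
    refine ⟨a' - a, b' - b, ?_⟩
    rw [e]
    congr 1
    group

theorem swap_classOf (Φ : ℝ → ℍ) (η : SL(2, ℝ)) :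
    Prod.swap '' classOf Φ η = classOf Φ η⁻¹ := by
  ext ⟨x, y⟩
  simp only [classOf, Set.mem_image, Prod.exists, Prod.swap_prod_mk, Prod.map_apply, Prod.mk.injEq,
    Set.mem_ofPred_eq]
  constructor
  · rintro ⟨_, _, ⟨s, t, e, rfl, rfl⟩, rfl, rfl⟩
    exact ⟨t, s, by rw [e, inv_smul_smul], rfl, rfl⟩
  · rintro ⟨s, t, e, rfl, rfl⟩
    exact ⟨_, _, ⟨t, s, by rw [e, smul_inv_smul], rfl, rfl⟩, rfl, rfl⟩

theorem IsLiftingWith.swap_isCommonValueClass (hg : 2 ≤ g) (H : IsLiftingWith φ Φ h)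
    {C : Set (Circle × Circle)} (hC : IsCommonValueClass φ φ C) :
    IsCommonValueClass φ φ (Prod.swap '' C) := by
  obtain ⟨hne, η, hη, rfl⟩ := H.exists_classOf hg hC
  have hne' := hne.image Prod.swap
  rw [swap_classOf] at hne' ⊢
  exact H.isCommonValueClass (inv_mem hη) hne'

theorem IsLiftingWith.exists_fract (H : IsLiftingWith φ Φ h) (t : ℝ) :
    ∃ k : ℤ, Φ t = h ^ k • Φ (Int.fract t) :=
  ⟨⌊t⌋, by rw [← H.add_int, Int.fract_add_floor]⟩

/-- The translates of each point of a lifting are uniformly separated. -/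
theorem IsLiftingWith.exists_displacement (hg : 2 ≤ g) (H : IsLiftingWith φ Φ h) :
    ∃ c > 0, ∀ γ ∈ Gam g, ∀ γ' ∈ Gam g, ∀ t, dist (γ • Φ t) (γ' • Φ t) < c → γ = γ' := by
  obtain ⟨c, hc, hd⟩ := SurfaceLoops.exists_displacement hg
    ((isCompact_Icc (a := (0 : ℝ)) (b := 1)).image H.lifting.1)
  refine ⟨c, hc, fun γ hγ γ' hγ' t hlt => ?_⟩
  by_contra hne
  obtain ⟨k, hk⟩ := H.exists_fract t
  have hk' := zpow_mem H.mem k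
  refine (hd ((γ' * h ^ k)⁻¹ * (γ * h ^ k)) (mul_mem (inv_mem (mul_mem hγ' hk')) (mul_mem hγ hk'))
    (fun e => hne ?_) _ (Set.mem_image_of_mem Φ
      ⟨Int.fract_nonneg t, (Int.fract_lt_one t).le⟩)).not_gt ?_
  · exact (mul_right_cancel (inv_mul_eq_one.1 e)).symm
  · rw [mul_smul, ← dist_smul (γ' * h ^ k), smul_inv_smul, mul_smul, mul_smul, ← hk]
    exact hlt

/-- The pairs near a class at which the translate by `η` is close to the lifting form an isolating
neighborhood, by the uniform separation of translates. -/
theorem IsLiftingWith.isIsolated (hg : 2 ≤ g) (H : IsLiftingWith φ Φ h)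
    {C : Set (Circle × Circle)} (hC : IsCommonValueClass φ φ C) : IsIsolated φ φ C := by
  obtain ⟨-, η, hη, rfl⟩ := H.exists_classOf hg hC
  obtain ⟨c, hc, hd⟩ := H.exists_displacement hg
  refine ⟨Prod.map circleCover circleCover '' {x | dist (Φ x.1) (η • Φ x.2) < c}, ?_, ?_⟩
  · refine (isOpenQuotientMap_circleCover.isOpenMap.prodMap
      isOpenQuotientMap_circleCover.isOpenMap) _ (isOpen_lt ?_ continuous_const)
    have := H.lifting.1
    exact (this.comp continuous_fst).dist ((this.comp continuous_snd).const_smul η)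
  · ext p
    constructor
    · rintro ⟨⟨⟨s, t⟩, hst, rfl⟩, hp⟩
      obtain ⟨γ, hγ, e⟩ := H.eq_iff.1 hp
      refine ⟨(s, t), ?_, rfl⟩
      have hst' : dist (Φ s) (η • Φ t) < c := hst
      rw [e] at hst'
      rw [Set.mem_ofPred_eq, e, hd _ hγ _ hη _ hst']
    · rintro ⟨⟨s, t⟩, hst, rfl⟩
      have hst' : Φ s = η • Φ t := hst
      refine ⟨⟨(s, t), ?_, rfl⟩, H.eq_iff.2 ⟨η, hη, hst'⟩⟩
      rw [Set.mem_ofPred_eq, hst', dist_self]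
      exact hc

/-- Up to powers of `h` on both sides, the element that gives a class moves a point of a compact
piece of the lifting to this piece. -/
theorem IsLiftingWith.finite_classes (hg : 2 ≤ g) (H : IsLiftingWith φ Φ h) :
    {C | IsCommonValueClass φ φ C}.Finite := by
  obtain ⟨R, hR⟩ := ((isCompact_Icc (a := (0 : ℝ)) (b := 1)).image
    H.lifting.1).isBounded.subset_closedBall UpperHalfPlane.I
  refine ((finite_setOf_dist_le hg (max R 0)).image (classOf Φ)).subset ?_
  intro C hC
  obtain ⟨⟨p, hp⟩, η, hη, rfl⟩ := H.exists_classOf hg hC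
  obtain ⟨⟨s, t⟩, e, -⟩ := hp
  obtain ⟨a, ha⟩ := H.exists_fract s
  obtain ⟨b, hb⟩ := H.exists_fract t
  have hb' : ∀ t, dist (Φ (Int.fract t)) UpperHalfPlane.I ≤ max R 0 := fun t =>
    (hR (Set.mem_image_of_mem Φ ⟨Int.fract_nonneg t, (Int.fract_lt_one t).le⟩)).trans
      (le_max_left _ _)
  have e' : Φ s = η • Φ t := e
  refine ⟨h ^ (-a) * η * h ^ b, ⟨mul_mem (mul_mem (zpow_mem H.mem _) hη) (zpow_mem H.mem _),
    _, _, hb' t, hb' s, ?_⟩, H.classOf_shift η _ _⟩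
  rw [mul_smul, mul_smul, ← hb, ← e', ha, ← mul_smul, ← zpow_add, neg_add_cancel, zpow_zero,
    one_smul,
    dist_self]
  exact le_max_right _ _

/-- A symmetric class is given by an element whose square is a power of `h`. -/
theorem IsLiftingWith.exists_of_isSymmetricClass (hg : 2 ≤ g) (H : IsLiftingWith φ Φ h)
    {C : Set (Circle × Circle)} (hC : IsCommonValueClass φ φ C) (hs : IsSymmetricClass C) :
    ∃ ζ ∈ Gam g, C = classOf Φ ζ ∧ (∃ s t, Φ s = ζ • Φ t) ∧ ∃ k : ℤ, ζ * ζ = h ^ k := by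
  obtain ⟨-, η, hη, rfl⟩ := H.exists_classOf hg hC
  obtain ⟨x, y, hxy, hyx⟩ := hs
  obtain ⟨s, rfl⟩ := isOpenQuotientMap_circleCover.surjective x
  obtain ⟨t, rfl⟩ := isOpenQuotientMap_circleCover.surjective y
  obtain ⟨a, b, e⟩ := H.mem_classOf.1 hxy
  obtain ⟨a', b', e'⟩ := H.mem_classOf.1 hyx
  have hh := fun k : ℤ => zpow_mem H.mem k
  have h1 : (h ^ a * η * h ^ b) * (h ^ a' * η * h ^ b') = 1 := by
    refine eq_one_of_smul_eq hg (mul_mem (mul_mem (mul_mem (hh _) hη) (hh _))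
      (mul_mem (mul_mem (hh _) hη) (hh _))) (z := Φ s) ?_
    rw [mul_smul, ← e', ← e]
  refine ⟨η * h ^ (b + a'), mul_mem hη (hh _), ?_, ⟨s + (-a : ℤ), t + (-a' : ℤ), ?_⟩,
    (-a - b' + (b + a')), ?_⟩
  · rw [← H.classOf_shift η 0 (b + a'), zpow_zero, one_mul]
  · rw [H.add_int, H.add_int, e, ← mul_smul, ← mul_smul]
    congr 1
    group
  · have h2 : η * h ^ (b + a') * η = h ^ (-a - b') := by
      have : h ^ (-a) * ((h ^ a * η * h ^ b) * (h ^ a' * η * h ^ b')) * h ^ (-b') =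
          h ^ (-a - b') := by
        rw [h1, mul_one, ← zpow_add, sub_eq_add_neg]
      rw [← this]
      group
    rw [← mul_assoc, h2, ← zpow_add]

end Lift

/-! ### Relative homology -/

section Homology

variable {X Y Z : Type} [TopologicalSpace X] [TopologicalSpace Y] [TopologicalSpace Z]

/-- The projection to the relative chain complex. -/
def relπ (X : Type) [TopologicalSpace X] (A : Set X) : singC.obj (TopCat.of X) ⟶ relComplex X A :=
  cokernel.π (singC.map (incl A))

instance (A : Set X) : Epi (relπ X A) := inferInstanceAs (Epi (cokernel.π (singC.map (incl A))))

theorem relπ_relComplexMap (f : C(X, Y)) {A : Set X} {B : Set Y} (h : Set.MapsTo f A B) :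
    relπ X A ≫ relComplexMap f h = singC.map (TopCat.ofHom f) ≫ relπ Y B :=
  cokernel.π_desc _ _ _

theorem map_incl_relπ (A : Set X) : singC.map (incl A) ≫ relπ X A = 0 := cokernel.condition _

theorem relComplexMap_comp (f : C(X, Y)) (f' : C(Y, Z)) {A : Set X} {B : Set Y} {D : Set Z}
    (h : Set.MapsTo f A B) (h' : Set.MapsTo f' B D) :
    relComplexMap (f'.comp f) (h'.comp h) = relComplexMap f h ≫ relComplexMap f' h' := by
  refine (cancel_epi (relπ X A)).1 ?_
  rw [relπ_relComplexMap, ← Category.assoc, relπ_relComplexMap, Category.assoc, relπ_relComplexMap,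
    ← Category.assoc, ← Functor.map_comp]
  rfl

theorem relComplexMap_id {A : Set X} (h : Set.MapsTo (ContinuousMap.id X) A A) :
    relComplexMap (ContinuousMap.id X) h = 𝟙 _ := by
  refine (cancel_epi (relπ X A)).1 ?_
  rw [relπ_relComplexMap]
  have e : singC.map (TopCat.ofHom (ContinuousMap.id X)) = 𝟙 _ := CategoryTheory.Functor.map_id _ _
  rw [e, Category.id_comp, Category.comp_id]

theorem relHMap_comp (n : ℕ) (f : C(X, Y)) (f' : C(Y, Z)) {A : Set X} {B : Set Y} {D : Set Z}
    (h : Set.MapsTo f A B) (h' : Set.MapsTo f' B D) :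
    relHMap n (f'.comp f) (h'.comp h) = relHMap n f h ≫ relHMap n f' h' := by
  rw [relHMap, relComplexMap_comp, HomologicalComplex.homologyMap_comp]
  rfl

theorem relHMap_id (n : ℕ) {A : Set X} (h : Set.MapsTo (ContinuousMap.id X) A A) :
    relHMap n (ContinuousMap.id X) h = 𝟙 _ := by
  rw [relHMap, relComplexMap_id, HomologicalComplex.homologyMap_id]

theorem toRelH_relHMap (n : ℕ) (f : C(X, Y)) {A : Set X} {B : Set Y} (h : Set.MapsTo f A B) :
    toRelH n X A ≫ relHMap n f h =
      HomologicalComplex.homologyMap (singC.map (TopCat.ofHom f)) n ≫ toRelH n Y B := by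
  have e := congrArg (fun f => HomologicalComplex.homologyMap f n) (relπ_relComplexMap f h)
  rw [HomologicalComplex.homologyMap_comp, HomologicalComplex.homologyMap_comp] at e
  exact e

theorem relHMap_eq_zero (n : ℕ) (f : C(X, Y)) {A : Set X} {B : Set Y} (h : Set.MapsTo f A B)
    (hB : ∀ x, f x ∈ B) : relHMap n f h = 0 := by
  have h0 : relComplexMap f h = 0 := by
    refine (cancel_epi (relπ X A)).1 ?_
    have e : TopCat.ofHom f = TopCat.ofHom (⟨fun x => ⟨f x, hB x⟩, by fun_prop⟩ : C(X, B)) ≫ incl B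
      := rfl
    rw [relπ_relComplexMap, e, Functor.map_comp, Category.assoc, map_incl_relπ, comp_zero,
      comp_zero]
  rw [relHMap, h0, HomologicalComplex.homologyMap_zero]

instance (A : Set X) : Mono (singC.map (incl A)) := by
  have : Mono (incl A) := (TopCat.mono_iff_injective _).2 Subtype.val_injective
  infer_instance

/-- The short exact sequence of a pair. -/
theorem shortExact_pair (A : Set X) :
    (ShortComplex.mk (singC.map (incl A)) (relπ X A) (map_incl_relπ A)).ShortExact where
  exact := ShortComplex.exact_of_g_is_cokernel _ (cokernelIsCokernel (singC.map (incl A)))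
  mono_f := inferInstanceAs (Mono (singC.map (incl A)))
  epi_g := inferInstanceAs (Epi (relπ X A))

theorem quasiIso_of_section {P Q : TopCat.{0}} {f : P ⟶ Q} {s : Q ⟶ P} (h : s ≫ f = 𝟙 Q)
    (H : TopCat.Homotopy (f ≫ s) (𝟙 P)) : QuasiIso (singC.map f) := by
  rw [quasiIso_iff]
  intro n
  rw [quasiIsoAt_iff_isIso_homologyMap]
  refine ⟨HomologicalComplex.homologyMap (singC.map s) n, ?_, ?_⟩
  · rw [← HomologicalComplex.homologyMap_comp, ← Functor.map_comp,
      TopCat.Homotopy.congr_homologyMap_singularChainComplexFunctor H,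
        CategoryTheory.Functor.map_id,
      HomologicalComplex.homologyMap_id]
  · rw [← HomologicalComplex.homologyMap_comp, ← Functor.map_comp, h, CategoryTheory.Functor.map_id,
      HomologicalComplex.homologyMap_id]

/-- The cylinder over a subset. -/
def cyl (A : Set X) : Set (X × unitInterval) := {p | p.1 ∈ A}

theorem mapsTo_fst (A : Set X) :
    Set.MapsTo (ContinuousMap.fst : C(X × unitInterval, X)) (cyl A) A :=
  fun _ hp => hp

/-- The inclusion of a level of a cylinder. -/
def level (X : Type) [TopologicalSpace X] (τ : unitInterval) : C(X, X × unitInterval) :=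
  ⟨fun x => (x, τ), by fun_prop⟩

theorem mapsTo_level (A : Set X) (τ : unitInterval) :
    Set.MapsTo (level X τ) A (cyl A) := fun _ hx => hx

/-- The projection of a cylinder, restricted to the part over a subset. -/
def fstRestrict (A : Set X) : C(cyl A, A) :=
  ⟨(mapsTo_fst A).restrict,
    (ContinuousMap.fst : C(X × unitInterval, X)).continuous.continuousOn.mapsToRestrict
      (mapsTo_fst A)⟩

/-- The projection of a cylinder is a quasi-isomorphism. -/
theorem quasiIso_fst (X : Type) [TopologicalSpace X] :
    QuasiIso (singC.map (TopCat.ofHom (ContinuousMap.fst : C(X × unitInterval, X)))) := by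
  refine quasiIso_of_section (s := TopCat.ofHom (level X 0)) rfl ?_
  have F : ContinuousMap.Homotopy ((level X 0).comp ContinuousMap.fst)
      (ContinuousMap.id (X × unitInterval)) :=
    { toFun := fun p => (p.2.1, p.1 * p.2.2)
      continuous_toFun := by fun_prop
      map_zero_left := fun p => Prod.ext rfl (zero_mul _)
      map_one_left := fun p => Prod.ext rfl (one_mul _) }
  exact F

theorem quasiIso_fstRestrict (A : Set X) : QuasiIso (singC.map (TopCat.ofHom (fstRestrict A))) := by
  let s : C(A, cyl A) := ⟨fun x => ⟨(x, 0), x.2⟩, by fun_prop⟩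
  refine quasiIso_of_section (s := TopCat.ofHom s) rfl ?_
  have F : ContinuousMap.Homotopy (s.comp (fstRestrict A)) (ContinuousMap.id (cyl A)) :=
    { toFun := fun p => ⟨(p.2.1.1, p.1 * p.2.1.2), p.2.2⟩
      continuous_toFun := by fun_prop
      map_zero_left := fun p => Subtype.ext (Prod.ext rfl (zero_mul _))
      map_one_left := fun p => Subtype.ext (Prod.ext rfl (one_mul _)) }
  exact F

theorem quasiIso_relComplexMap_fst (A : Set X) : QuasiIso (relComplexMap _ (mapsTo_fst A)) := by
  have h1 := quasiIso_fstRestrict A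
  have h2 := quasiIso_fst X
  exact HomologicalComplex.HomologySequence.quasiIso_τ₃
    (ShortComplex.homMk (S₁ := ShortComplex.mk _ _ (map_incl_relπ (cyl A)))
      (S₂ := ShortComplex.mk _ _ (map_incl_relπ A)) (singC.map (TopCat.ofHom (fstRestrict A)))
      (singC.map (TopCat.ofHom ContinuousMap.fst)) (relComplexMap _ (mapsTo_fst A))
      (by dsimp only; rw [← Functor.map_comp, ← Functor.map_comp]; rfl)
      (relπ_relComplexMap _ _).symm)
    (shortExact_pair _) (shortExact_pair _) h1 h2

/-- Homotopy invariance of relative homology: both levels are sections of the projection of the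
cylinder, which is a quasi-isomorphism of relative complexes. -/
theorem relHMap_level (n : ℕ) (A : Set X) (σ τ : unitInterval) :
    relHMap n (level X σ) (mapsTo_level A σ) = relHMap n (level X τ) (mapsTo_level A τ) := by
  have h := quasiIso_relComplexMap_fst A
  have hiso : IsIso (relHMap n _ (mapsTo_fst A)) := by
    rw [quasiIso_iff] at h
    exact (quasiIsoAt_iff_isIso_homologyMap _ n).1 (h n)
  refine (cancel_mono (relHMap n _ (mapsTo_fst A))).1 ?_
  rw [← relHMap_comp, ← relHMap_comp]
  rfl

/-- A map of pairs that is homotopic, through maps of pairs, to a map into the subspace induces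
zero. -/
theorem relHMap_eq_zero_of_homotopy (n : ℕ) {A : Set X} {B : Set Y} (F : C(X × unitInterval, Y))
    (hF : Set.MapsTo F (cyl A) B) (h1 : ∀ x, F (x, 1) ∈ B) {f : C(X, Y)} (hf : Set.MapsTo f A B)
    (h0 : ∀ x, F (x, 0) = f x) : relHMap n f hf = 0 := by
  obtain rfl : F.comp (level X 0) = f := ContinuousMap.ext h0
  have e := relHMap_comp n (level X 0) F (mapsTo_level A 0) hF
  rw [relHMap_level n A 0 1, ← relHMap_comp,
    relHMap_eq_zero n (F.comp (level X 1)) (hF.comp (mapsTo_level A 1)) h1] at e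
  exact e

end Homology

/-! ### Consequences for the index -/

section Index

variable {Y : Type} [TopologicalSpace Y] {φ ψ : C(Circle, Y)}

/-- The index of `C` is zero if the common value pairs in `C` can be removed by a homotopy of `φ ×
ψ` that does not create new ones. -/
theorem hasIndexZero_of_homotopy {C : Set (Circle × Circle)}
    (F : C((Circle × Circle) × unitInterval, Y × Y)) (h0 : ∀ p, F (p, 0) = (φ p.1, ψ p.2))
    (h1 : ∀ p ∈ C, (F (p, 1)).1 ≠ (F (p, 1)).2)
    (hne : ∀ p : Circle × Circle, φ p.1 ≠ ψ p.2 → ∀ τ, (F (p, τ)).1 ≠ (F (p, τ)).2) :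
    HasIndexZero φ ψ C := by
  rintro z v ⟨N, hN, y, -, rfl⟩
  have hcvp : ∀ p ∈ N, p ∉ C → φ p.1 ≠ ψ p.2 := fun p hp hC h => hC (hN.2 ▸ ⟨hp, h⟩)
  have hF : Set.MapsTo (F.comp ⟨fun p : N × unitInterval => (p.1.1, p.2), by fun_prop⟩)
      (cyl {x : N | (x : Circle × Circle) ∉ C}) (Set.diagonal Y)ᶜ := fun p hp =>
    hne _ (hcvp _ p.1.2 hp) p.2
  have h2 := relHMap_eq_zero_of_homotopy 2 _ hF (fun x => ?_) (mapsTo_prodMapOn hN) fun x => h0 x.1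
  · rw [h2]
    rfl
  · by_cases hx : (x : Circle × Circle) ∈ C
    · exact h1 _ hx
    · exact hne _ (hcvp _ x.2 hx) 1

theorem image_swap_eq (C : Set (Circle × Circle)) : Prod.swap '' C = Prod.swap ⁻¹' C :=
  congrFun Set.image_swap_eq_preimage_swap C

theorem swap_image_swap (C : Set (Circle × Circle)) : Prod.swap '' (Prod.swap '' C) = C := by
  rw [← Set.image_comp, Prod.swap_swap_eq, Set.image_id]

/-- The index of the class obtained by interchanging the coordinates is zero if the index of the
class is. -/
theorem HasIndexZero.swap {C : Set (Circle × Circle)} (h : HasIndexZero φ φ C) :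
    HasIndexZero φ φ (Prod.swap '' C) := by
  rintro z v ⟨N, hN, y, hy, rfl⟩
  have hN' : IsIsolating φ φ C (Prod.swap ⁻¹' N) := by
    refine ⟨hN.1.preimage continuous_swap, ?_⟩
    have h2 := congrArg (Set.preimage Prod.swap) hN.2
    rw [image_swap_eq, ← Set.preimage_comp, Prod.swap_swap_eq, Set.preimage_id, Set.preimage_inter]
      at h2
    rw [← h2]
    congr 1
    ext p
    exact eq_comm
  have hC : ∀ p : Circle × Circle, p ∉ Prod.swap '' C → p.swap ∉ C := by
    intro p hp
    rwa [image_swap_eq] at hp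
  let sT : C(Circle × Circle, Circle × Circle) := ⟨Prod.swap, continuous_swap⟩
  let sY : C(Y × Y, Y × Y) := ⟨Prod.swap, continuous_swap⟩
  let sN : C(N, (Prod.swap ⁻¹' N : Set (Circle × Circle))) :=
    ⟨fun x => ⟨x.1.swap, by simp⟩, by fun_prop⟩
  have mT : Set.MapsTo sT (Prod.swap '' C)ᶜ Cᶜ := fun p hp => hC p hp
  have mY : Set.MapsTo sY (Set.diagonal Y)ᶜ (Set.diagonal Y)ᶜ := fun p hp h => hp (Eq.symm h)
  have mN : Set.MapsTo sN {x : N | (x : Circle × Circle) ∉ Prod.swap '' C}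
      {x : (Prod.swap ⁻¹' N : Set (Circle × Circle)) | (x : Circle × Circle) ∉ C} :=
    fun p hp => hC p hp
  have e1 := relHMap_comp 2 _ _ mN (mapsTo_val C (Prod.swap ⁻¹' N))
  have e2 := relHMap_comp 2 _ _ (mapsTo_val (Prod.swap '' C) N) mT
  have e3 := relHMap_comp 2 _ _ mN (mapsTo_prodMapOn hN')
  have e4 := relHMap_comp 2 _ _ (mapsTo_prodMapOn hN) mY
  have e5 := relHMap_comp 2 _ _ mY mY
  have e6 := toRelH_relHMap 2 _ mT
  have key := h ((HomologicalComplex.homologyMap (singC.map (TopCat.ofHom sT)) 2).hom z)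
    ((relHMap 2 sY mY).hom ((relHMap 2 _ (mapsTo_prodMapOn hN)).hom y))
    ⟨_, hN', (relHMap 2 sN mN).hom y, ?_, ?_⟩
  · have e7 : relHMap 2 sY mY ≫ relHMap 2 sY mY = 𝟙 _ := by
      rw [← e5]
      exact relHMap_id 2 _
    have e8 := congrArg (relHMap 2 sY mY).hom key
    rw [map_zero, ← ModuleCat.comp_apply, e7] at e8
    exact e8
  · have e9 : relHMap 2 sN mN ≫ relHMap 2 _ (mapsTo_val C (Prod.swap ⁻¹' N)) =
        relHMap 2 _ (mapsTo_val (Prod.swap '' C) N) ≫ relHMap 2 sT mT := e1.symm.trans e2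
    rw [← ModuleCat.comp_apply, e9, ModuleCat.comp_apply, hy, ← ModuleCat.comp_apply, e6]
    rfl
  · have e9 : relHMap 2 sN mN ≫ relHMap 2 _ (mapsTo_prodMapOn hN') =
        relHMap 2 _ (mapsTo_prodMapOn hN) ≫ relHMap 2 sY mY := e3.symm.trans e4
    rw [← ModuleCat.comp_apply, e9]
    rfl

end Index

/-! ### Removing a shifted diagonal -/

/-- The tube lemma for periodic sets. -/
theorem exists_tube {U : Set (ℝ × ℝ)} (hU : IsOpen U) (h0 : ∀ t, (t, 0) ∈ U)
    (hper : ∀ t u (k : ℤ), (t, u) ∈ U → (t + k, u) ∈ U) :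
    ∃ δ > 0, ∀ t u, |u| ≤ δ → (t, u) ∈ U := by
  obtain ⟨A, B, -, hB, hAs, hB0, hAB⟩ := generalized_tube_lemma
    (isCompact_Icc (a := (0 : ℝ)) (b := 1))
    (isCompact_singleton (x := (0 : ℝ))) hU (by rintro ⟨t, u⟩ ⟨-, rfl⟩; exact h0 t)
  obtain ⟨δ, hδ, hball⟩ := Metric.isOpen_iff.1 hB 0 (hB0 rfl)
  refine ⟨δ / 2, half_pos hδ, fun t u hu => ?_⟩
  have h1 : u ∈ B := hball (by rw [Metric.mem_ball, Real.dist_eq, sub_zero]; linarith)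
  have h2 := hper (Int.fract t) u ⌊t⌋
    (hAB ⟨hAs ⟨Int.fract_nonneg t, (Int.fract_lt_one t).le⟩, h1⟩)
  rwa [Int.fract_add_floor] at h2

/-- If translating by `ζ` is a shift of an injective lifting of `φ`, and if the lifting can be moved
off itself equivariantly, then the class of `ζ`, a shifted diagonal, has index zero. -/
theorem hasIndexZero_of_shift {g : ℕ} (hg : 2 ≤ g) {φ : C(Circle, Surface g)} {Φ : ℝ → ℍ}
    {h : SL(2, ℝ)} (H : IsLiftingWith φ Φ h) (hinj : Function.Injective Φ) {V : ℝ × ℝ → ℝ × ℝ × ℝ}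
    (hV : Continuous V) (hV0 : ∀ t, V (t, 0) = lor (Φ t))
    (hVper : ∀ t θ (k : ℤ), V (t + k, θ) = lact (h ^ k) (V (t, θ))) {ε : ℝ} (hε : 0 < ε)
    (hVne : ∀ s t θ, |s - t| < ε → 0 < θ → Timelike (V (t, θ)) → ofVec (V (t, θ)) ≠ Φ s)
    {ζ : SL(2, ℝ)} (hζ : ζ ∈ Gam g) {c : ℝ} (hc : ∀ t, ζ • Φ t = Φ (t + c)) :
    HasIndexZero φ φ (classOf Φ ζ) := by
  have hΦ := H.lifting.1
  obtain ⟨c₀, hc₀, hd⟩ := H.exists_displacement hg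
  have hK0 : ∀ t, ofVec (V (t, 0)) = Φ t := fun t => by rw [hV0, ofVec_lor]
  have hT : IsOpen {p : ℝ × ℝ | Timelike (V p)} := isOpen_timelike.preimage hV
  have hKc : ContinuousOn (fun p => ofVec (V p)) {p : ℝ × ℝ | Timelike (V p)} :=
    continuousOn_ofVec.comp hV.continuousOn fun p hp => hp
  have hKper : ∀ t θ (k : ℤ), Timelike (V (t, θ)) →
      Timelike (V (t + k, θ)) ∧ ofVec (V (t + k, θ)) = h ^ k • ofVec (V (t, θ)) := by
    intro t θ k ht
    rw [hVper, smul_ofVec ht]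
    exact ⟨ht.lact _, rfl⟩
  -- the values of `δ` and `ε'` for which nothing moves by more than half the separation
  obtain ⟨δ, hδ, hδT⟩ := exists_tube
    (U := {p | Timelike (V p)} ∩ (fun p => dist (ofVec (V p)) (Φ p.1)) ⁻¹' Set.Iio (c₀ / 2))
    ((continuous_dist.comp_continuousOn (hKc.prodMk (hΦ.comp continuous_fst).continuousOn))
      |>.isOpen_inter_preimage hT isOpen_Iio)
    (fun t => ⟨by
      change Timelike (V (t, 0))
      rw [hV0]
      exact timelike_lor _, by
      change dist (ofVec (V (t, 0))) (Φ t) < c₀ / 2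
      rw [hK0, dist_self]
      exact half_pos hc₀⟩)
    (fun t u k hp => by
      obtain ⟨h1, h2⟩ := hp
      obtain ⟨h3, h4⟩ := hKper t u k h1
      refine ⟨h3, ?_⟩
      change dist (ofVec (V (t + k, u))) (Φ (t + k)) < c₀ / 2
      rw [h4, H.add_int, dist_smul]
      exact h2)
  obtain ⟨ε', hε', hε'd⟩ := exists_tube (U := {p : ℝ × ℝ | dist (Φ (p.1 + p.2)) (Φ p.1) < c₀ / 2})
    (isOpen_lt (by fun_prop) continuous_const)
    (fun t => by
      change dist (Φ (t + 0)) (Φ t) < c₀ / 2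
      rw [add_zero, dist_self]
      exact half_pos hc₀)
    (fun t u k hp => by
      change dist (Φ (t + k + u)) (Φ (t + k)) < c₀ / 2
      rw [add_right_comm, H.add_int, H.add_int, dist_smul]
      exact hp)
  -- the homotopy of the second loop, for parameters in the unit interval
  let kfun : Circle × unitInterval → Surface g := fun p =>
    proj g (ofVec (V (Function.surjInv isOpenQuotientMap_circleCover.surjective p.1, δ * p.2)))
  have hle : ∀ θ : unitInterval, |δ * (θ : ℝ)| ≤ δ := fun θ => by
    rw [abs_of_nonneg (mul_nonneg hδ.le θ.2.1)]
    exact mul_le_of_le_one_right hδ.le θ.2.2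
  have hk : ∀ t (θ : unitInterval), kfun (circleCover t, θ) = proj g (ofVec (V (t, δ * θ))) := by
    intro t θ
    obtain ⟨k, hk⟩ := circleCover_eq.1
      (Function.surjInv_eq isOpenQuotientMap_circleCover.surjective (circleCover t))
    change proj g (ofVec (V
      (Function.surjInv isOpenQuotientMap_circleCover.surjective (circleCover t),
      δ * θ))) = _
    rw [hk, (hKper t _ k (hδT t _ (hle θ)).1).2, proj_smul (zpow_mem H.mem k)]
  have hkc : Continuous kfun := by
    rw [← (isOpenQuotientMap_circleCover.prodMap
      (IsOpenQuotientMap.id (X := unitInterval))).continuous_comp_iff]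
    have e : kfun ∘ Prod.map circleCover id = fun p : ℝ × unitInterval =>
        proj g (ofVec (V (p.1, δ * p.2))) := funext fun p => hk p.1 p.2
    rw [e]
    exact (continuous_proj g).comp (hKc.comp_continuous (by fun_prop)
      fun p => (hδT p.1 _ (hle p.2)).1)
  have hk0 : ∀ y, kfun (y, 0) = φ y := by
    intro y
    obtain ⟨t, rfl⟩ := isOpenQuotientMap_circleCover.surjective y
    rw [hk, Set.Icc.coe_zero, mul_zero, hK0, H.lifting.2]
  obtain ⟨r, hr, hball⟩ := Metric.isOpen_iff.1
    (isOpenQuotientMap_circleCover.isOpenMap _ (isOpen_Ioo (a := -(min ε ε')) (b := min ε ε'))) 1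
    ⟨0, ⟨by simpa using ⟨hε, hε'⟩, by simpa using ⟨hε, hε'⟩⟩, circleCover_zero⟩
  let q : Circle × Circle → ℝ := fun p => dist (p.1 * p.2⁻¹ * (circleCover c)⁻¹) 1
  have hqc : Continuous q := by fun_prop
  let ρ : Circle × Circle → unitInterval := fun p =>
    ⟨max 0 (1 - q p / r), le_max_left _ _, max_le zero_le_one
      (sub_le_self _ (div_nonneg dist_nonneg hr.le))⟩
  have hρc : Continuous ρ := by
    refine Continuous.subtype_mk ?_ _
    fun_prop
  have core : ∀ p : Circle × Circle, 0 < (ρ p : ℝ) → ∀ θ : unitInterval, 0 < (θ : ℝ) →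
      φ p.1 ≠ kfun (p.2, θ) := by
    rintro ⟨x, y⟩ hp θ hθ e
    obtain ⟨t, rfl⟩ := isOpenQuotientMap_circleCover.surjective y
    have hq : q (x, circleCover t) < r := by
      by_contra hq
      push Not at hq
      refine hp.ne' (max_eq_left ?_)
      linarith [(one_le_div hr).2 hq]
    obtain ⟨u, hu, hxu⟩ := hball (Metric.mem_ball.2 hq)
    have hx : x = circleCover (t + u + c) := by
      rw [circleCover_add, circleCover_add, hxu, mul_comm (circleCover t), mul_right_comm,
        inv_mul_cancel_right, inv_mul_cancel_right]
    obtain ⟨hu1, hu2⟩ := hu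
    have hu3 : |u| < min ε ε' := abs_lt.2 ⟨hu1, hu2⟩
    dsimp only at e
    rw [hk, hx, ← H.lifting.2, ← hc, proj_smul hζ] at e
    obtain ⟨γ, hγ, e'⟩ := proj_eq_proj.1 e
    obtain ⟨hTt, hKt⟩ := hδT t _ (hle θ)
    have hγ1 : γ = 1 := by
      refine hd γ hγ 1 (one_mem _) t ?_
      rw [one_smul]
      have h1 : dist (ofVec (V (t, δ * θ))) (Φ t) < c₀ / 2 := hKt
      have h2 : dist (Φ (t + u)) (Φ t) < c₀ / 2 := hε'd t u (hu3.le.trans (min_le_right _ _))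
      rw [e'] at h2
      have h3 := dist_triangle (γ • Φ t) (γ • ofVec (V (t, δ * θ))) (Φ t)
      rw [dist_smul, dist_comm (Φ t)] at h3
      linarith
    rw [hγ1, one_smul] at e'
    refine hVne (t + u) t (δ * θ) ?_ (mul_pos hδ hθ) hTt e'.symm
    rw [add_sub_cancel_left]
    exact hu3.trans_le (min_le_left _ _)
  refine hasIndexZero_of_homotopy
    ⟨fun p => (φ p.1.1, kfun (p.1.2, p.2 * ρ p.1)), by fun_prop⟩ ?_ ?_ ?_
  · intro p
    change (φ p.1, kfun (p.2, 0 * ρ p)) = _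
    rw [zero_mul, hk0]
  · rintro _ ⟨⟨s, t⟩, hst, rfl⟩
    have hst' : Φ s = ζ • Φ t := hst
    rw [hc] at hst'
    obtain rfl := hinj hst'
    have hρ : (ρ (Prod.map circleCover circleCover (t + c, t)) : ℝ) = 1 := by
      have : q (Prod.map circleCover circleCover (t + c, t)) = 0 := by
        change dist (circleCover (t + c) * (circleCover t)⁻¹ * (circleCover c)⁻¹) 1 = 0
        rw [circleCover_add, dist_eq_zero, mul_comm (circleCover t), mul_inv_cancel_right,
          mul_inv_cancel]
      change max 0 (1 - q _ / r) = 1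
      rw [this]
      simp
    refine core _ (by rw [hρ]; exact one_pos) _ ?_
    rw [one_mul, hρ]
    exact one_pos
  · intro p hp τ
    change φ p.1 ≠ kfun (p.2, τ * ρ p)
    rcases (τ * ρ p).2.1.eq_or_lt with h1 | h1
    · have h2 : τ * ρ p = 0 := Subtype.ext h1.symm
      rw [h2, hk0]
      exact hp
    · refine core p ?_ _ h1
      by_contra h2
      have h3 : (ρ p : ℝ) = 0 := le_antisymm (not_lt.1 h2) (ρ p).2.1
      have h4 : ((τ * ρ p : unitInterval) : ℝ) = 0 := by
        rw [Set.Icc.coe_mul, h3, mul_zero]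
      exact h1.ne' h4

/-! ### Symmetric classes -/

/-- The edge path of a non-empty word, run through in unit time per period, is a lifting of the
piecewise-geodesic loop of the word. -/
theorem IsPiecewiseGeodesicLoop.isLiftingWith {g : ℕ} (hg : 2 ≤ g) {w : List Letter}
    (hw : IsWord g w)
    (hne : w ≠ []) {φ : C(Circle, Surface g)} (hφ : IsPiecewiseGeodesicLoop g w φ) :
    IsLiftingWith φ (fun t => path g w (t * w.length)) (wordElt g w) where
  lifting := by
    refine ⟨(continuous_path hg hne).comp (by fun_prop), fun t => ?_⟩
    have hpos := length_pos_int hne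
    have hpos' : (0 : ℝ) < w.length := by exact_mod_cast hpos
    set n := ⌊t * w.length⌋
    have hn : t * w.length = n + Int.fract (t * w.length) := (Int.floor_add_fract _).symm
    set τ := Int.fract (t * w.length)
    have hτ : τ ∈ Set.Icc (0 : ℝ) 1 := ⟨Int.fract_nonneg _, (Int.fract_lt_one _).le⟩
    have hk := toNat_emod_lt hne n
    obtain ⟨c, hc, h⟩ := hφ.2 (n % w.length).toNat hk
    have e : circleCover t = circleCover ((((n % w.length).toNat : ℕ) + τ) / w.length) := by
      refine circleCover_eq.2 ⟨n / w.length, ?_⟩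
      have h1 : (((n % w.length).toNat : ℕ) : ℝ) = ((n % w.length : ℤ) : ℝ) := by
        exact_mod_cast Int.toNat_of_nonneg (Int.emod_nonneg n hpos.ne')
      have h2 : ((n % w.length : ℤ) : ℝ) + w.length * ((n / w.length : ℤ) : ℝ) = n := by
        exact_mod_cast Int.emod_add_mul_ediv n w.length
      rw [h1]
      field_simp
      linarith
    dsimp only
    rw [e, h τ hτ, hc.eq_edge hg hτ, ← perLetter_eq_getElem hne, hn, path_add hg hne n hτ.1 hτ.2,
      proj_smul (vert_mem hw n)]
  mem := wordElt_mem hw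
  add_one t := by
    have := path_add_mul (g := g) hne (t * w.length) 1
    rw [Int.cast_one, zpow_one] at this
    rw [← this]
    congr 1
    ring

theorem IsPiecewiseGeodesicLoop.isLiftingWith_nil {g : ℕ} {φ : C(Circle, Surface g)}
    (hφ : IsPiecewiseGeodesicLoop g [] φ) : IsLiftingWith φ (fun _ => UpperHalfPlane.I) 1 where
  lifting := ⟨continuous_const, fun _ => (hφ.1 rfl _).symm⟩
  mem := one_mem _
  add_one _ := (one_smul _ _).symm

theorem IsPiecewiseGeodesicLoop.exists_isLiftingWith {g : ℕ} (hg : 2 ≤ g) {w : List Letter}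
    (hw : IsWord g w) {φ : C(Circle, Surface g)} (hφ : IsPiecewiseGeodesicLoop g w φ) :
    ∃ Φ h, IsLiftingWith φ Φ h := by
  rcases eq_or_ne w [] with rfl | hne
  exacts [⟨_, _, hφ.isLiftingWith_nil⟩, ⟨_, _, hφ.isLiftingWith hg hw hne⟩]

/-- For the constant loop, every index is zero: one of the two constant loops can be moved away. -/
theorem hasIndexZero_of_const {g : ℕ} (hg : 2 ≤ g) {φ : C(Circle, Surface g)}
    (hφ : ∀ x, φ x = proj g UpperHalfPlane.I) (C : Set (Circle × Circle)) : HasIndexZero φ φ C := by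
  have hl : IsLetter g (1, true) := ⟨le_rfl, by dsimp only; omega⟩
  have hcont := continuous_edge g (1, true)
  have hproj := continuous_proj g
  refine hasIndexZero_of_homotopy ⟨fun p => (proj g UpperHalfPlane.I,
    proj g (edge g (1, true) ((p.2 : ℝ) / 4))), by fun_prop⟩ ?_ ?_ ?_
  · intro p
    change (proj g UpperHalfPlane.I, proj g (edge g (1, true) (((0 : unitInterval) : ℝ) / 4))) = _
    rw [Set.Icc.coe_zero, zero_div, edge_zero, hφ, hφ]
  · intro p _ h
    change proj g UpperHalfPlane.I = proj g (edge g (1, true) (((1 : unitInterval) : ℝ) / 4)) at h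
    obtain ⟨γ, hγ, e⟩ := proj_eq_proj.1 h
    rw [Set.Icc.coe_one, ← edge_zero g (1, true)] at e
    rcases eq_of_smul_half_edge_eq hg hγ hl hl (by norm_num) (by norm_num) le_rfl (by norm_num)
      e.symm with ⟨-, ⟨-, h⟩ | ⟨h, -⟩⟩ | ⟨-, -, h, -⟩ <;> norm_num at h
  · intro p hp
    exact absurd ((hφ _).trans (hφ _).symm) hp

/-- Symmetric classes are shifted diagonals, and these can be removed by moving one copy of the loop
to its left. -/
theorem hasIndexZero_of_isSymmetricClass {g : ℕ} (hg : 2 ≤ g) {w : List Letter} (hw : IsWord g w)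
    (hD : IsCyclicallyDReduced g w) {φ : C(Circle, Surface g)} (hφ : IsPiecewiseGeodesicLoop g w φ)
    {C : Set (Circle × Circle)} (hC : IsCommonValueClass φ φ C) (hs : IsSymmetricClass C) :
    HasIndexZero φ φ C := by
  rcases eq_or_ne w [] with rfl | hne
  · exact hasIndexZero_of_const hg (hφ.1 rfl) C
  have H := hφ.isLiftingWith hg hw hne
  obtain ⟨ζ, hζ, rfl, ⟨s, t, hst⟩, k, hk⟩ := H.exists_of_isSymmetricClass hg hC hs
  have hpos : (0 : ℝ) < w.length := by exact_mod_cast length_pos_int hne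
  obtain ⟨a, b, hab⟩ : ∃ a b : ℤ, ζ * vert g w b = vert g w a := by
    rcases path_eq_smul_path hg hw hne hζ hst with ⟨a, b, h, -⟩ | ⟨a, b, h, -⟩ | ⟨a, b, h, -⟩
    exacts [⟨_, _, h⟩, ⟨_, _, h⟩, ⟨_, _, h⟩]
  obtain ⟨c, hc⟩ := exists_shift hg hw hD hne hζ hk hab
  refine hasIndexZero_of_shift hg H
    (V := fun p => lor (path g w (p.1 * w.length)) + p.2 • pathNormal g w (p.1 * w.length))
    (ε := 1 / (4 * w.length)) ?_ ?_ ?_ ?_ (by positivity) ?_ hζ (c := c / w.length) ?_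
  · intro s t h
    exact mul_right_cancel₀ hpos.ne' (path_injective hg hw hD hne h)
  · exact (continuous_parallel_vec hg hne).comp
      (f := fun p : ℝ × ℝ => (p.1 * (w.length : ℝ), p.2)) (by fun_prop)
  · intro t
    simp
  · intro t θ k
    dsimp only
    rw [add_mul]
    exact parallel_vec_add_mul hne _ θ k
  · intro s t θ hst hθ ht
    refine parallel_ne hg hw hD hne ?_ hθ ht
    rw [← sub_mul, abs_mul, abs_of_pos hpos]
    calc |s - t| * w.length < 1 / (4 * w.length) * w.length := by gcongr
      _ = 1 / 4 := by field_simp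
  · intro t
    rw [hc, add_mul, div_mul_cancel₀ _ hpos.ne']

theorem even_ncard_of_involution {α : Type*} {S : Set α} (hS : S.Finite) (f : α → α)
    (hmem : ∀ a ∈ S, f a ∈ S) (hne : ∀ a ∈ S, f a ≠ a) (hinv : ∀ a, f (f a) = a) : Even S.ncard :=
      by
  rw [Set.ncard_eq_toFinset_card S hS, ← ZMod.natCast_eq_zero_iff_even]
  have := Finset.sum_involution (s := hS.toFinset) (f := fun _ => (1 : ZMod 2)) (fun a _ => f a)
    (fun _ _ => by decide) (fun a ha _ => hne a (hS.mem_toFinset.1 ha))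
    (fun a ha => hS.mem_toFinset.2 (hmem a (hS.mem_toFinset.1 ha))) (fun a _ => hinv a)
  simpa using this

end SurfaceLoops

end

theorem mainTheorem7 (g : ℕ) (hg : 2 ≤ g) (w : List Letter) (hw : IsWord g w)
    (hD : IsCyclicallyDReduced g w) (φ : C(Circle, Surface g))
    (hφ : IsPiecewiseGeodesicLoop g w φ) :
    -- every self-common value class is isolated, so that its index is defined
    (∀ C, IsCommonValueClass φ φ C → IsIsolated φ φ C) ∧
    -- every symmetric self-common value class has index zero
    (∀ C, IsCommonValueClass φ φ C → IsSymmetricClass C → HasIndexZero φ φ C) ∧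
    -- essential self-common value classes come in pairs
    (∀ C, IsEssentialClass φ φ C →
      IsEssentialClass φ φ (Prod.swap '' C) ∧ Prod.swap '' C ≠ C) ∧
    {C | IsEssentialClass φ φ C}.Finite ∧
    Even {C | IsEssentialClass φ φ C}.ncard := by
  obtain ⟨Φ, h, H⟩ := hφ.exists_isLiftingWith hg hw
  have hsym : ∀ C, IsCommonValueClass φ φ C → IsSymmetricClass C → HasIndexZero φ φ C :=
    fun C hC hs => hasIndexZero_of_isSymmetricClass hg hw hD hφ hC hs
  have hswap : ∀ C, IsEssentialClass φ φ C → IsEssentialClass φ φ (Prod.swap '' C) := by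
    refine fun C hC => ⟨H.swap_isCommonValueClass hg hC.1, fun h0 => hC.2 ?_⟩
    have h1 := h0.swap
    rwa [swap_image_swap] at h1
  have hne : ∀ C, IsEssentialClass φ φ C → Prod.swap '' C ≠ C := by
    intro C hC e
    obtain ⟨⟨x, y⟩, hxy⟩ := hC.1.1
    exact hC.2 (hsym C hC.1 ⟨x, y, hxy, e ▸ ⟨(x, y), hxy, rfl⟩⟩)
  have hfin : {C | IsEssentialClass φ φ C}.Finite :=
    (H.finite_classes hg).subset fun C hC => hC.1
  exact ⟨fun C hC => H.isIsolated hg hC, hsym, fun C hC => ⟨hswap C hC, hne C hC⟩, hfin,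
    even_ncard_of_involution hfin (fun C => Prod.swap '' C) hswap hne swap_image_swap⟩
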